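/- Conventions. Let $\Gamma$ be a group (written multiplicatively, not necessarily abelian), let $R=\bigoplus_{\gamma\in\Gamma}R_\gamma$ be a $\Gamma$-graded (associative, unital) ring, and let $\Omega\subseteq\Omega'$ be normal subgroups of $\Gamma$. For a normal subgroup $N$ of $\Gamma$ the ring $R$ is regarded as $\Gamma/N$-graded by $R_\alpha=\bigoplus_{\gamma\in\alpha}R_\gamma$ ($\alpha\in\Gamma/N$). "Ungraded" means graded by the trivial group. Let $G$ be a group and let $R$ be $G$-graded. For $\alpha\in G^m,\ \beta\in G^n$ let $M_{m\times n}(R)[\alpha][\beta]$ be the set of $m\times n$ matrices whose $(i,j)$ entry lies in $R_{\alpha_i\beta_j^{-1}}$, and let $\mathfrak M^{G}(R)$ be the set of all square matrices, of any size, lying in some $M_{n\times n}(R)[\alpha][\beta]$. Such an $n\times n$ matrix $A$ is gr-full if $A=PQ$ with $P\in M_{n\times r}(R)[\alpha][\lambda]$, $Q\in M_{r\times n}(R)[\lambda][\beta]$ implies $r\ge n$. A $G$-gr-prime matrix ideal is a set $\mathcal P\subseteq\mathfrak M^{G}(R)$ such that: $\mathcal P$ contains every matrix of $\mathfrak M^G(R)$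 that is not gr-full; if $A,B\in\mathcal P$ lie in a common $M_{n\times n}(R)[\alpha][\beta]$ and differ at most in one column (row), then the matrix obtained by adding these columns (rows) and keeping the others is in $\mathcal P$; if $A\in\mathcal P$ and $B\in\mathfrak M^G(R)$ then $A\oplus B\in\mathcal P$; if $A,B\in\mathfrak M^G(R)$ and $A\oplus B\in\mathcal P$ then $A\in\mathcal P$ or $B\in\mathcal P$; the $1\times1$ matrix $(1)$ is not in $\mathcal P$; and $EAF\in\mathcal P$ for $A\in\mathcal P$ and permutation matrices $E,F$. Write $\operatorname{Spec}_{G}(R)$ for the set of these ideals, and $\operatorname{Spec}(R)$ in the ungraded case. A $G$-graded division ring is a nonzero $G$-graded ring whose nonzero homogeneous elements are invertible. A $G$-graded epic $R$-division ring is a pair $(K,\varphi)$ of a $G$-graded division ring $K$ and a homomorphism of $G$-graded rings $\varphi\colon R\to K$ such that no proper subring of $K$ contains $\varphi(R)$ and is closed under inverses of its nonzero homogeneous elements; it is one of fractions if $\varphi$ is injective. Its singular kernel is the set of $A\in\mathfrak M^G(R)$ whose image $A^\varphi$ is not invertible over $K$. Given two of them, $(K,\varphi)$ and $(L,\psi)$,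 let $\Sigma$ be the set of $A\in\mathfrak M^G(R)$ with $A^\psi$ invertible. A gr-specialization from $K$ to $L$ exists if $A^\varphi$ is invertible for every $A\in\Sigma$ and there is a homomorphism of $G$-graded rings $f$ with $f\varphi=\psi$ from the core $\mathfrak C_L(K)$ to $L$, where the core is the subring of $K$ generated by $\varphi(R)$ and the entries of the matrices $(A^\varphi)^{-1}$, $A\in\Sigma$ (the image in $K$ of the universal localization $R_\Sigma$). $(K,\varphi)$ is universal if there is a gr-specialization from it to every $G$-graded epic $R$-division ring. Theorem. (0) $\mathcal Q'\mapsto\mathcal Q'\cap\mathfrak M^{\Gamma/\Omega}(R)$ defines maps $\operatorname{Spec}_{\Gamma/\Omega'}(R)\to\operatorname{Spec}_{\Gamma/\Omega}(R)$ and $\operatorname{Spec}(R)\to\operatorname{Spec}_{\Gamma/\Omega}(R)$, and $\mathcal Q\mapsto\mathcal Q\cap\mathfrak M^{\Gamma}(R)$ defines a map $\operatorname{Spec}_{\Gamma/\Omega}(R)\to\operatorname{Spec}_{\Gamma}(R)$. (1) If there is no $\Gamma/\Omega$-graded epic $R$-division ring, then there is no $\Gamma/\Omega'$-graded one; the same holds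 with "of fractions" added on both sides. In particular, if for some normal subgroup $\Omega$ of $\Gamma$ there is no $\Gamma/\Omega$-graded epic $R$-division ring (of fractions), then there is no ungraded epic $R$-division ring (of fractions). (2) For each $\Gamma/\Omega'$-graded epic $R$-division ring $K'$ with singular kernel $\mathcal P'$ there is a corresponding $\Gamma/\Omega$-graded epic $R$-division ring, that is, one with singular kernel $\mathcal P'\cap\mathfrak M^{\Gamma/\Omega}(R)$. If there is a gr-specialization from $K'$ to $L'$ ($\Gamma/\Omega'$-graded epic $R$-division rings), and $K$, $L$ are $\Gamma/\Omega$-graded epic $R$-division rings corresponding to $K'$, $L'$, then there is a gr-specialization from $K$ to $L$. (3) If the map $\operatorname{Spec}_{\Gamma/\Omega'}(R)\to\operatorname{Spec}_{\Gamma/\Omega}(R)$ of (0) is surjective and there is a universal $\Gamma/\Omega'$-graded epic $R$-division ring (of fractions), then there is a universal $\Gamma/\Omega$-graded epic $R$-division ring (of fractions). In particular, if $\operatorname{Spec}(R)\to\operatorname{Spec}_{\Gamma/\Omega}(R)$ is surjective and there is a universal ungraded epic $R$-division ring (of fractions), then there is a universal $\Gamma/\Omega$-graded epic $R$-division ring (of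 fractions). (4) If every $\Gamma$-graded epic $R$-division ring admits a ring homomorphism to some division ring, then $\operatorname{Spec}_{\Gamma/\Omega}(R)\to\operatorname{Spec}_\Gamma(R)$ is surjective. This applies when $\Gamma$ admits a total order invariant under left and right multiplication: then every $\Gamma$-graded division ring admits a ring homomorphism to a division ring, and $\operatorname{Spec}_{\Gamma/\Omega}(R)\to\operatorname{Spec}_\Gamma(R)$ is surjective. -/

import Mathlib

universe u v w

/-- A grading of the ring `R` by the (multiplicative, possibly noncommutative) group `G`:
`R = ⨁ g, 𝒜 g` with `1 ∈ 𝒜 1` and `𝒜 g * 𝒜 h ⊆ 𝒜 (g * h)`. -/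
structure IsGrading {G : Type v} [Group G] {R : Type u} [Ring R]
    (𝒜 : G → AddSubgroup R) : Prop where
  one_mem : (1 : R) ∈ 𝒜 1
  mul_mem : ∀ {g h : G} {x y : R}, x ∈ 𝒜 g → y ∈ 𝒜 h → x * y ∈ 𝒜 (g * h)
  isInternal : @DirectSum.IsInternal G R (AddSubgroup R) (Classical.decEq G) _ _ _ 𝒜

/-- The `Γ ⧸ Ω`-grading induced by a `Γ`-grading: the component of a coset is the sum of the
components of its elements. -/
def coarsen {Γ : Type v} [Group Γ] {R : Type u} [Ring R] (𝒜 : Γ → AddSubgroup R)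
    (Ω : Subgroup Γ) : Γ ⧸ Ω → AddSubgroup R :=
  fun a => ⨆ g : {g : Γ // (QuotientGroup.mk g : Γ ⧸ Ω) = a}, 𝒜 g

/-- The grading by the trivial group, that is, the ungraded case. -/
def trivialGrading (R : Type u) [Ring R] : Unit → AddSubgroup R := fun _ => ⊤

section Matrices

variable {G : Type v} [Group G] {R : Type u} [Ring R]

/-- The set `M_{m×n}(R)[α][β]` of matrices whose `(i,j)` entry lies in `𝒜 (α i * (β j)⁻¹)`. -/
def HomMatrix (𝒜 : G → AddSubgroup R) {m n : ℕ} (α : Fin m → G) (β : Fin n → G) :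
    Set (Matrix (Fin m) (Fin n) R) :=
  {A | ∀ i j, A i j ∈ 𝒜 (α i * (β j)⁻¹)}

/-- Square matrices of arbitrary size. -/
abbrev SqMatrix (R : Type u) : Type u := Σ n : ℕ, Matrix (Fin n) (Fin n) R

/-- The set `𝔐(R)` of homogeneous square matrices. -/
def homSqMatrices (𝒜 : G → AddSubgroup R) : Set (SqMatrix R) :=
  {A | ∃ α β : Fin A.1 → G, A.2 ∈ HomMatrix 𝒜 α β}

/-- A square matrix is gr-full if it has no homogeneous factorization (with compatible degrees)
through a smaller size. -/
def IsGrFull (𝒜 : G → AddSubgroup R) (A : SqMatrix R) : Prop :=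
  ∀ (r : ℕ) (α β : Fin A.1 → G) (l : Fin r → G) (P : Matrix (Fin A.1) (Fin r) R)
    (Q : Matrix (Fin r) (Fin A.1) R),
    P ∈ HomMatrix 𝒜 α l → Q ∈ HomMatrix 𝒜 l β → A.2 = P * Q → A.1 ≤ r

/-- The diagonal sum `A ⊕ B`. -/
def diagSum (A B : SqMatrix R) : SqMatrix R :=
  ⟨A.1 + B.1, Matrix.reindex finSumFinEquiv finSumFinEquiv (Matrix.fromBlocks A.2 0 0 B.2)⟩

/-- A gr-prime matrix ideal of the graded ring `(R, 𝒜)`. -/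
structure IsGrPrimeMatrixIdeal (𝒜 : G → AddSubgroup R) (P : Set (SqMatrix R)) : Prop where
  subset_hom : P ⊆ homSqMatrices 𝒜
  not_full : ∀ A ∈ homSqMatrices 𝒜, ¬ IsGrFull 𝒜 A → A ∈ P
  /-- closure under determinantal sums with respect to a column -/
  col_sum : ∀ (n : ℕ) (α β : Fin n → G) (A B : Matrix (Fin n) (Fin n) R) (j : Fin n),
    A ∈ HomMatrix 𝒜 α β → B ∈ HomMatrix 𝒜 α β → (∀ i k, k ≠ j → A i k = B i k) →
    (⟨n, A⟩ : SqMatrix R) ∈ P → (⟨n, B⟩ : SqMatrix R) ∈ P →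
    (⟨n, A.updateCol j (fun i => A i j + B i j)⟩ : SqMatrix R) ∈ P
  /-- closure under determinantal sums with respect to a row -/
  row_sum : ∀ (n : ℕ) (α β : Fin n → G) (A B : Matrix (Fin n) (Fin n) R) (i : Fin n),
    A ∈ HomMatrix 𝒜 α β → B ∈ HomMatrix 𝒜 α β → (∀ k j, k ≠ i → A k j = B k j) →
    (⟨n, A⟩ : SqMatrix R) ∈ P → (⟨n, B⟩ : SqMatrix R) ∈ P →
    (⟨n, A.updateRow i (fun j => A i j + B i j)⟩ : SqMatrix R) ∈ P
  diagSum_mem : ∀ A ∈ P, ∀ B ∈ homSqMatrices 𝒜, diagSum A B ∈ P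
  mem_or_mem : ∀ A ∈ homSqMatrices 𝒜, ∀ B ∈ homSqMatrices 𝒜, diagSum A B ∈ P → A ∈ P ∨ B ∈ P
  one_notMem : (⟨1, 1⟩ : SqMatrix R) ∉ P
  perm_mem : ∀ (n : ℕ) (A : Matrix (Fin n) (Fin n) R) (σ τ : Equiv.Perm (Fin n)),
    (⟨n, A⟩ : SqMatrix R) ∈ P → (⟨n, σ.permMatrix R * A * τ.permMatrix R⟩ : SqMatrix R) ∈ P

/-- The gr-prime spectrum: the set of gr-prime matrix ideals of `(R, 𝒜)`. -/
def grSpec (𝒜 : G → AddSubgroup R) : Set (Set (SqMatrix R)) :=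
  {P | IsGrPrimeMatrixIdeal 𝒜 P}

/-- The map `P ↦ P ∩ 𝔐(R)`, where `𝔐(R)` is formed with respect to the grading `𝒜`. -/
def restrictTo (𝒜 : G → AddSubgroup R) (P : Set (SqMatrix R)) : Set (SqMatrix R) :=
  P ∩ homSqMatrices 𝒜

end Matrices

/-- A graded division ring: a nonzero graded ring in which every nonzero homogeneous element
is invertible. -/
structure IsGrDivisionRing {G : Type v} [Group G] {K : Type u} [Ring K]
    (𝒦 : G → AddSubgroup K) : Prop extends IsGrading 𝒦 where
  nontrivial : Nontrivial K
  isUnit_of_mem : ∀ (g : G) (x : K), x ∈ 𝒦 g → x ≠ 0 → IsUnit x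

/-- The graded division closure of `φ : R →+* K`: the least subring of `K` that contains the image
of `φ` and the inverses of its invertible homogeneous elements. -/
noncomputable def grDivisionClosure {G : Type v} {R : Type u} [Ring R] {K : Type w} [Ring K]
    (𝒦 : G → AddSubgroup K) (φ : R →+* K) : Subring K :=
  sInf {S | φ.range ≤ S ∧ ∀ (g : G) (x : K), x ∈ 𝒦 g → x ∈ S → IsUnit x → Ring.inverse x ∈ S}

/-- A graded epic `R`-division ring `(K, φ)`: a graded division ring `K` with a homomorphism of
graded rings `φ : R → K` such that `K` is generated, as a graded division ring, by the image. -/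
structure GrEpicDivisionRing {G : Type v} [Group G] {R : Type u} [Ring R]
    (𝒜 : G → AddSubgroup R) where
  carrier : Type u
  [ring : Ring carrier]
  grading : G → AddSubgroup carrier
  isGrDivisionRing : IsGrDivisionRing grading
  hom : R →+* carrier
  hom_mem : ∀ (g : G) (r : R), r ∈ 𝒜 g → hom r ∈ grading g
  closure_eq_top : grDivisionClosure grading hom = ⊤

attribute [instance] GrEpicDivisionRing.ring

/-- An (ungraded) epic `R`-division ring. -/
abbrev EpicDivisionRing (R : Type u) [Ring R] := GrEpicDivisionRing (trivialGrading R)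

namespace GrEpicDivisionRing

variable {G : Type v} [Group G] {R : Type u} [Ring R] {𝒜 : G → AddSubgroup R}

/-- `(K, φ)` is a graded epic `R`-division ring of fractions if `φ` is injective. -/
def IsOfFractions (K : GrEpicDivisionRing 𝒜) : Prop := Function.Injective K.hom

/-- The image `A ^ φ` of a square matrix `A` over `R` is invertible over `K`. -/
def Inverts (K : GrEpicDivisionRing 𝒜) (A : SqMatrix R) : Prop := IsUnit (A.2.map K.hom)

/-- The gr-singular kernel: the homogeneous square matrices that do not become invertible. -/
def singularKernel (K : GrEpicDivisionRing 𝒜) : Set (SqMatrix R) :=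
  {A | A ∈ homSqMatrices 𝒜 ∧ ¬ K.Inverts A}

/-- The core of `L` in `K`. Let `Σ` be the set of homogeneous square matrices that become
invertible over `L`. When the matrices in `Σ` become invertible over `K`, the core is the image in
`K` of the universal localization of `R` at `Σ`, that is, the subring of `K` generated by the image
of `R` and the entries of the inverses of the images of the matrices in `Σ`. -/
def core (K L : GrEpicDivisionRing 𝒜) : Subring K.carrier :=
  Subring.closure (Set.range K.hom ∪
    {x | ∃ A ∈ homSqMatrices 𝒜, L.Inverts A ∧
      ∃ B : Matrix (Fin A.1) (Fin A.1) K.carrier,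
        A.2.map K.hom * B = 1 ∧ B * A.2.map K.hom = 1 ∧ ∃ i j, x = B i j})

theorem hom_mem_core (K L : GrEpicDivisionRing 𝒜) (r : R) : K.hom r ∈ core K L :=
  Subring.subset_closure (Or.inl ⟨r, rfl⟩)

/-- A gr-specialization from `K` to `L`: the core of `L` in `K` exists (the universal localization
of `R` at the homogeneous matrices invertible over `L` maps to `K`, that is, these matrices become
invertible over `K`), together with a homomorphism of graded `R`-rings from the core to `L`. -/
structure GrSpecialization (K L : GrEpicDivisionRing 𝒜) where
  inverts : ∀ A ∈ homSqMatrices 𝒜, L.Inverts A → K.Inverts A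
  toHom : core K L →+* L.carrier
  map_hom : ∀ r : R, toHom ⟨K.hom r, hom_mem_core K L r⟩ = L.hom r
  map_mem : ∀ (g : G) (x : core K L), (x : K.carrier) ∈ K.grading g → toHom x ∈ L.grading g

/-- A universal graded epic `R`-division ring: it has a gr-specialization to every graded epic
`R`-division ring. -/
def IsUniversal (U : GrEpicDivisionRing 𝒜) : Prop :=
  ∀ L : GrEpicDivisionRing 𝒜, Nonempty (GrSpecialization U L)

end GrEpicDivisionRing

/-- The group `Γ` admits a total order invariant under left and right multiplication. -/
def IsOrderableGroup (Γ : Type v) [Group Γ] : Prop :=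
  ∃ _ : LinearOrder Γ, MulLeftMono Γ ∧ MulRightMono Γ

/-! The theorem rests on a graded form of Cohn's dictionary between prime matrix ideals and epic
division rings. Over a graded division ring, homogeneous matrices obey ordinary linear algebra, so
the matrices that a graded homomorphism fails to invert form a gr-prime matrix ideal
(`isGrPrimeMatrixIdeal_of_hom`). Conversely every gr-prime matrix ideal `P` is a singular kernel
(`exists_singularKernel_eq`): one builds a localization whose homogeneous elements are the formal
expressions `c + f A⁻¹ x` with `A ∉ P`. Such an expression is zero when its bordered matrix lies in
`P`, and primeness of `P` makes every nonzero homogeneous class invertible. Specializations are also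
visible on matrices: one exists from `K` to `L` as soon as `K` inverts every homogeneous matrix that
`L` inverts (`nonempty_grSpecialization`).

Given this dictionary, all the gradings are treated at once: `π` is a homomorphism of groups with `𝒜
g ≤ ℬ (π g)`, which covers the passage to a coarser quotient and to the trivial group. A `ℬ`-graded
epic division ring `K'` is regraded as the direct sum over `g` of the components of `K'` of degree
`π g`. This is a graded division ring for the finer group which maps to `K'` by summation. A
homogeneous matrix over a graded division ring is invertible if and only if its image over some
nonzero ring is (`HasHomogInverses.isUnit_map_iff`), so the regraded ring inverts the same
`𝒜`-homogeneous matrices as `K'`. This is `exists_corresponding`; it gives (1) and (2), and together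
with surjectivity on spectra it gives (3).

For (4), a homomorphism from a graded epic division ring `D` to a division ring `E` makes `R → D →
E` an ungraded homomorphism whose singular kernel restricts to that of `D`, again by
`HasHomogInverses.isUnit_map_iff` (`surjOn_restrictTo`). When the group is ordered, `E` is the ring
of Malcev–Neumann series with homogeneous coefficients (`exists_divisionRing_hom`). -/

set_option linter.unusedSectionVars false

/-! ### Homogeneous components and induced gradings. -/

section Grading

variable {G : Type v} [Group G] {R : Type u} [Ring R] {𝒜 : G → AddSubgroup R}

-- Projections that fix one component and kill the others recover the coordinates of an element of
-- the external direct sum from its image, whence injectivity. Every grading below is verified by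
-- exhibiting such projections.
open DirectSum in
theorem isInternal_of_proj (p : G → R →+ R) (hp : ∀ g, ∀ x ∈ 𝒜 g, p g x = x)
    (hp' : ∀ g h, g ≠ h → ∀ x ∈ 𝒜 g, p h x = 0) (htop : ⨆ g, 𝒜 g = ⊤) :
    @DirectSum.IsInternal G R (AddSubgroup R) (Classical.decEq G) _ _ _ 𝒜 := by
  classical
  have key : ∀ (x : ⨁ g, 𝒜 g) (g : G), ((x g : 𝒜 g) : R) = p g (DirectSum.coeAddMonoidHom 𝒜 x) := by
    intro x g
    induction x using DirectSum.induction_on with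
    | zero => simp
    | of h x =>
      rw [DirectSum.coeAddMonoidHom_of]
      by_cases hgh : h = g
      · subst hgh; rw [DirectSum.of_eq_same, hp _ _ x.2]
      · rw [DirectSum.of_eq_of_ne _ _ _ (Ne.symm hgh), hp' _ _ hgh _ x.2]; rfl
    | add x y hx hy => rw [DirectSum.add_apply, AddSubgroup.coe_add, hx, hy, map_add, map_add]
  have goal : DirectSum.IsInternal 𝒜 := by
    constructor
    · rw [injective_iff_map_eq_zero]
      intro x hx
      refine DFinsupp.ext fun g => Subtype.ext ?_
      have := key x g
      rw [hx, map_zero] at this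
      exact this
    · intro x
      have : (⊤ : AddSubgroup R) ≤ (DirectSum.coeAddMonoidHom 𝒜).range := by
        rw [← htop, iSup_le_iff]
        intro g y hy
        exact ⟨DirectSum.of (fun g => 𝒜 g) g ⟨y, hy⟩, DirectSum.coeAddMonoidHom_of _ _ _⟩
      exact this (AddSubgroup.mem_top x)
  convert goal

namespace IsGrading

open Classical in
/-- The projection of a graded ring to a homogeneous component. -/
noncomputable def proj (h : IsGrading 𝒜) (g : G) : R →+ R :=
  (𝒜 g).subtype.comp
    ((DFinsupp.evalAddMonoidHom g).comp
      (AddEquiv.ofBijective _ h.isInternal).symm.toAddMonoidHom)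

open Classical in
theorem proj_mem (h : IsGrading 𝒜) (g : G) (x : R) : h.proj g x ∈ 𝒜 g :=
  (((AddEquiv.ofBijective _ h.isInternal).symm x : DirectSum G fun g => 𝒜 g) g).2

open Classical in
theorem proj_apply_of_mem (h : IsGrading 𝒜) {g : G} {x : R} (hx : x ∈ 𝒜 g) (k : G) :
    h.proj k x = if g = k then x else 0 := by
  have e : (AddEquiv.ofBijective _ h.isInternal).symm x
      = DirectSum.of (fun g => 𝒜 g) g ⟨x, hx⟩ := by
    rw [AddEquiv.symm_apply_eq]
    exact (DirectSum.coeAddMonoidHom_of 𝒜 g ⟨x, hx⟩).symm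
  change (((AddEquiv.ofBijective _ h.isInternal).symm x) k : R) = _
  rw [e]
  split_ifs with hg
  · subst hg; rw [DirectSum.of_eq_same]
  · rw [DirectSum.of_eq_of_ne _ _ _ (Ne.symm hg)]; rfl

theorem proj_same (h : IsGrading 𝒜) {g : G} {x : R} (hx : x ∈ 𝒜 g) : h.proj g x = x := by
  rw [h.proj_apply_of_mem hx, if_pos rfl]

theorem proj_ne (h : IsGrading 𝒜) {g k : G} (hg : g ≠ k) {x : R} (hx : x ∈ 𝒜 g) :
    h.proj k x = 0 := by
  rw [h.proj_apply_of_mem hx, if_neg hg]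

theorem iSup_eq_top (h : IsGrading 𝒜) : ⨆ g, 𝒜 g = ⊤ := by
  classical
  rw [eq_top_iff]
  intro x _
  obtain ⟨y, rfl⟩ := h.isInternal.2 x
  induction y using DirectSum.induction_on with
  | zero => simp
  | of g y =>
    rw [DirectSum.coeAddMonoidHom_of]
    exact AddSubgroup.mem_iSup_of_mem g y.2
  | add x y hx hy => rw [map_add]; exact add_mem (hx trivial) (hy trivial)

theorem induction (h : IsGrading 𝒜) {p : R → Prop} (hom : ∀ g, ∀ x ∈ 𝒜 g, p x)
    (add : ∀ x y, p x → p y → p (x + y)) (x : R) : p x := by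
  have hx : x ∈ ⨆ g, 𝒜 g := by rw [h.iSup_eq_top]; trivial
  exact AddSubgroup.iSup_induction 𝒜 (C := p) hx hom (hom 1 0 (zero_mem _)) add

theorem eq_zero_of_proj (h : IsGrading 𝒜) {x : R} (hx : ∀ g, h.proj g x = 0) : x = 0 := by
  classical
  have : (AddEquiv.ofBijective _ h.isInternal).symm x = 0 :=
    DFinsupp.ext fun g => Subtype.ext (hx g)
  simpa using this

theorem ext_proj (h : IsGrading 𝒜) {x y : R} (hx : ∀ g, h.proj g x = h.proj g y) : x = y := by
  rw [← sub_eq_zero]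
  exact h.eq_zero_of_proj fun g => by rw [map_sub, hx, sub_self]

/-- Left multiplication by an element of degree `g` moves the components along the injection `k ↦ g
* k`, so no two of them mix. -/
theorem proj_mul_left (h : IsGrading 𝒜) {g : G} {x : R} (hx : x ∈ 𝒜 g) (k : G) (y : R) :
    h.proj (g * k) (x * y) = x * h.proj k y := by
  induction y using h.induction with
  | hom l y hy =>
    by_cases hl : l = k
    · subst hl; rw [h.proj_same hy, h.proj_same (h.mul_mem hx hy)]
    · rw [h.proj_ne hl hy, mul_zero, h.proj_ne _ (h.mul_mem hx hy)]
      simpa using hl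
  | add y z hy hz => rw [mul_add, map_add, hy, hz, map_add, mul_add]

/-- The homogeneous components of an element are almost all zero and sum to the element. -/
theorem exists_finset_sum (h : IsGrading 𝒜) (x : R) :
    ∃ s : Finset G, x = ∑ g ∈ s, h.proj g x ∧ ∀ g ∉ s, h.proj g x = 0 := by
  classical
  suffices H : ∃ s : Finset G, ∀ g ∉ s, h.proj g x = 0 by
    obtain ⟨s, hs⟩ := H
    refine ⟨s, h.ext_proj fun k => ?_, hs⟩
    rw [map_sum]
    simp_rw [h.proj_apply_of_mem (h.proj_mem _ x)]
    rw [Finset.sum_ite_eq' s k]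
    split_ifs with hk
    · rfl
    · exact hs k hk
  induction x using h.induction with
  | hom l y hy => exact ⟨{l}, fun g hg => h.proj_ne (by simpa [eq_comm] using hg) hy⟩
  | add y z hy hz =>
    obtain ⟨s, hs⟩ := hy
    obtain ⟨t, ht⟩ := hz
    refine ⟨s ∪ t, fun g hg => ?_⟩
    rw [Finset.notMem_union] at hg
    rw [map_add, hs g hg.1, ht g hg.2, add_zero]

/-- A unit which is homogeneous has a homogeneous inverse. -/
theorem exists_inv (h : IsGrading 𝒜) {g : G} {x : R} (hx : x ∈ 𝒜 g) (hu : IsUnit x) :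
    ∃ y ∈ 𝒜 g⁻¹, x * y = 1 ∧ y * x = 1 := by
  obtain ⟨a, rfl⟩ := hu
  -- Taking the component of degree `1` in `a * a⁻¹ = 1` shows that the component of `a⁻¹` in degree
  -- `g⁻¹` is already a right inverse, hence equals `a⁻¹`.
  have e : (a : R) * h.proj g⁻¹ (↑a⁻¹ : R) = 1 := by
    rw [← h.proj_mul_left hx, mul_inv_cancel, Units.mul_inv, h.proj_same h.one_mem]
  have e' : h.proj g⁻¹ (↑a⁻¹ : R) = ↑a⁻¹ := by
    rw [← Units.inv_mul_cancel_left a (h.proj g⁻¹ (↑a⁻¹ : R)), e, mul_one]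
  exact ⟨↑a⁻¹, e' ▸ h.proj_mem _ _, Units.mul_inv a, Units.inv_mul a⟩

/-- The grading induced on a quotient group is a grading. -/
theorem coarsen (h : IsGrading 𝒜) (Ω : Subgroup G) [Ω.Normal] : IsGrading (coarsen 𝒜 Ω) := by
  classical
  have hle : ∀ g : G, 𝒜 g ≤ _root_.coarsen 𝒜 Ω (QuotientGroup.mk g) := fun g =>
    le_iSup (fun k : {k : G // (QuotientGroup.mk k : G ⧸ Ω) = QuotientGroup.mk g} => 𝒜 k)
      ⟨g, rfl⟩
  refine ⟨hle 1 h.one_mem, ?_, ?_⟩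
  · intro a b x y hx hy
    refine AddSubgroup.iSup_induction _
      (C := fun x => x * y ∈ _root_.coarsen 𝒜 Ω (a * b)) hx ?_ ?_ ?_
    · rintro ⟨g, rfl⟩ x hx
      refine AddSubgroup.iSup_induction _
        (C := fun y => x * y ∈ _root_.coarsen 𝒜 Ω (_ * b)) hy ?_ ?_ ?_
      · rintro ⟨k, rfl⟩ y hy
        exact hle (g * k) (h.mul_mem hx hy)
      · rw [mul_zero]; exact zero_mem _
      · intro y z hy hz; rw [mul_add]; exact add_mem hy hz
    · rw [zero_mul]; exact zero_mem _
    · intro y z hy hz; rw [add_mul]; exact add_mem hy hz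
  -- The projection to a coset keeps exactly the components whose degree lies in that coset.
  · let p : G ⧸ Ω → R →+ R := fun a =>
      (DirectSum.toAddMonoid fun g : G =>
        if (QuotientGroup.mk g : G ⧸ Ω) = a then (𝒜 g).subtype else 0).comp
        (AddEquiv.ofBijective _ h.isInternal).symm.toAddMonoidHom
    have hp : ∀ (g : G) (a : G ⧸ Ω), ∀ x ∈ 𝒜 g,
        p a x = if (QuotientGroup.mk g : G ⧸ Ω) = a then x else 0 := by
      intro g a x hx
      have e : (AddEquiv.ofBijective _ h.isInternal).symm x
          = DirectSum.of (fun g => 𝒜 g) g ⟨x, hx⟩ := by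
        rw [AddEquiv.symm_apply_eq]
        exact (DirectSum.coeAddMonoidHom_of 𝒜 g ⟨x, hx⟩).symm
      change DirectSum.toAddMonoid _ ((AddEquiv.ofBijective _ h.isInternal).symm x) = _
      rw [e, DirectSum.toAddMonoid_of]
      split_ifs <;> rfl
    refine isInternal_of_proj p ?_ ?_ ?_
    · intro a x hx
      refine AddSubgroup.iSup_induction _ (C := fun x => p a x = x) hx ?_ (map_zero _) ?_
      · rintro ⟨g, rfl⟩ x hx
        rw [hp g _ x hx, if_pos rfl]
      · intro y z hy hz; rw [map_add, hy, hz]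
    · intro a b hab x hx
      refine AddSubgroup.iSup_induction _ (C := fun x => p b x = 0) hx ?_ (map_zero _) ?_
      · rintro ⟨g, rfl⟩ x hx
        rw [hp g _ x hx, if_neg hab]
      · intro y z hy hz; rw [map_add, hy, hz, add_zero]
    · rw [eq_top_iff, ← h.iSup_eq_top, iSup_le_iff]
      exact fun g => (hle g).trans (le_iSup _ _)

end IsGrading

theorem isGrading_trivialGrading (R : Type u) [Ring R] : IsGrading (trivialGrading R) := by
  refine ⟨trivial, fun _ _ => trivial, isInternal_of_proj (fun _ => AddMonoidHom.id R)
    (fun _ _ _ => rfl) (fun g h hgh => (hgh rfl).elim) ?_⟩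
  rw [eq_top_iff]
  exact le_iSup (trivialGrading R) ()

theorem le_coarsen (𝒜 : G → AddSubgroup R) (Ω : Subgroup G) [Ω.Normal] (g : G) :
    𝒜 g ≤ coarsen 𝒜 Ω (QuotientGroup.mk' Ω g) :=
  le_iSup (fun k : {k : G // (QuotientGroup.mk k : G ⧸ Ω) = QuotientGroup.mk g} => 𝒜 k) ⟨g, rfl⟩

theorem coarsen_le_coarsen (𝒜 : G → AddSubgroup R) {Ω Ω' : Subgroup G} [Ω.Normal] [Ω'.Normal]
    (h : Ω ≤ Ω') (a : G ⧸ Ω) :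
    coarsen 𝒜 Ω a ≤ coarsen 𝒜 Ω' (QuotientGroup.map Ω Ω' (MonoidHom.id G) h a) := by
  refine iSup_le ?_
  rintro ⟨g, rfl⟩
  exact le_coarsen 𝒜 Ω' g

end Grading

/-! ### Homogeneous matrices with arbitrary index types. -/

section Homog

variable {G : Type v} [Group G] {R : Type u} [Ring R] {𝒜 : G → AddSubgroup R}
variable {ι κ μ ν : Type*}

/-- The matrices, with arbitrary index types, whose `(i, j)` entry lies in `𝒜 (α i * (β j)⁻¹)`. -/
def Homog (𝒜 : G → AddSubgroup R) (α : ι → G) (β : κ → G) (A : Matrix ι κ R) : Prop :=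
  ∀ i j, A i j ∈ 𝒜 (α i * (β j)⁻¹)

namespace Homog

variable {α : ι → G} {β : κ → G} {γ : μ → G} {δ : ν → G}

theorem add {A B : Matrix ι κ R} (hA : Homog 𝒜 α β A) (hB : Homog 𝒜 α β B) :
    Homog 𝒜 α β (A + B) := fun i j => add_mem (hA i j) (hB i j)

theorem neg {A : Matrix ι κ R} (hA : Homog 𝒜 α β A) : Homog 𝒜 α β (-A) :=
  fun i j => neg_mem (hA i j)

theorem zero : Homog 𝒜 α β (0 : Matrix ι κ R) := fun _ _ => zero_mem _

theorem one [DecidableEq ι] (h : (1 : R) ∈ 𝒜 1) : Homog 𝒜 α α (1 : Matrix ι ι R) := by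
  intro i j
  by_cases hij : i = j
  · subst hij; simpa using h
  · rw [Matrix.one_apply_ne hij]; exact zero_mem _

theorem mul [Fintype κ] (hm : ∀ {g h : G} {x y : R}, x ∈ 𝒜 g → y ∈ 𝒜 h → x * y ∈ 𝒜 (g * h))
    {A : Matrix ι κ R} {B : Matrix κ μ R}
    (hA : Homog 𝒜 α β A) (hB : Homog 𝒜 β γ B) : Homog 𝒜 α γ (A * B) := by
  intro i j
  rw [Matrix.mul_apply]
  refine sum_mem fun k _ => ?_
  simpa [mul_assoc] using hm (hA i k) (hB k j)

theorem submatrix {A : Matrix ι κ R} (hA : Homog 𝒜 α β A) (e : μ → ι) (f : ν → κ) :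
    Homog 𝒜 (α ∘ e) (β ∘ f) (A.submatrix e f) := fun i j => hA (e i) (f j)

theorem fromBlocks {A : Matrix ι κ R} {B : Matrix ι ν R} {C : Matrix μ κ R} {D : Matrix μ ν R}
    (hA : Homog 𝒜 α β A) (hB : Homog 𝒜 α δ B) (hC : Homog 𝒜 γ β C) (hD : Homog 𝒜 γ δ D) :
    Homog 𝒜 (Sum.elim α γ) (Sum.elim β δ) (Matrix.fromBlocks A B C D) := by
  rintro (i | i) (j | j)
  exacts [hA i j, hB i j, hC i j, hD i j]

theorem fromRows {A : Matrix ι κ R} {B : Matrix μ κ R}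
    (hA : Homog 𝒜 α β A) (hB : Homog 𝒜 γ β B) :
    Homog 𝒜 (Sum.elim α γ) β (Matrix.fromRows A B) := by
  rintro (i | i) j
  exacts [hA i j, hB i j]

theorem fromCols {A : Matrix ι κ R} {B : Matrix ι ν R}
    (hA : Homog 𝒜 α β A) (hB : Homog 𝒜 α δ B) :
    Homog 𝒜 α (Sum.elim β δ) (Matrix.fromCols A B) := by
  rintro i (j | j)
  exacts [hA i j, hB i j]

theorem map {S : Type*} [Ring S] {ℬ : G → AddSubgroup S} {φ : R →+* S}
    (hφ : ∀ g, ∀ r ∈ 𝒜 g, φ r ∈ ℬ g) {A : Matrix ι κ R} (hA : Homog 𝒜 α β A) :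
    Homog ℬ α β (A.map φ) := fun i j => hφ _ _ (hA i j)

theorem mono {G' : Type*} [Group G'] {ℬ : G' → AddSubgroup R} {π : G →* G'}
    (h : ∀ g, 𝒜 g ≤ ℬ (π g)) {A : Matrix ι κ R} (hA : Homog 𝒜 α β A) :
    Homog ℬ (π ∘ α) (π ∘ β) A := fun i j => by
  simpa using h _ (hA i j)

/-- Only the products `α i * (β j)⁻¹` matter. This freedom allows a right degree to be normalized to
`1`, and the degrees of two factors to be matched. -/
theorem of_right_mul {A : Matrix ι κ R} (hA : Homog 𝒜 α β A) (g : G) :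
    Homog 𝒜 (fun i => α i * g) (fun j => β j * g) A := fun i j => by
  simpa [mul_assoc] using hA i j

end Homog

theorem homog_updateCol [DecidableEq κ] {α : ι → G} {β : κ → G} {A : Matrix ι κ R}
    (hA : Homog 𝒜 α β A) {j : κ} {c : ι → R} (hc : ∀ i, c i ∈ 𝒜 (α i * (β j)⁻¹)) :
    Homog 𝒜 α β (A.updateCol j c) := by
  intro i k
  rw [Matrix.updateCol_apply]
  split_ifs with h
  · subst h; exact hc i
  · exact hA i k

theorem homog_updateRow [DecidableEq ι] {α : ι → G} {β : κ → G} {A : Matrix ι κ R}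
    (hA : Homog 𝒜 α β A) {i : ι} {c : κ → R} (hc : ∀ j, c j ∈ 𝒜 (α i * (β j)⁻¹)) :
    Homog 𝒜 α β (A.updateRow i c) := by
  intro k j
  rw [Matrix.updateRow_apply]
  split_ifs with h
  · subst h; exact hc j
  · exact hA k j

theorem homog_perm_mul_mul [Fintype ι] [DecidableEq ι] {α β : ι → G} {A : Matrix ι ι R}
    (hA : Homog 𝒜 α β A) (σ τ : Equiv.Perm ι) :
    Homog 𝒜 (α ∘ σ) (β ∘ τ.symm) (σ.permMatrix R * A * τ.permMatrix R) := by
  rw [PEquiv.toMatrix_toPEquiv_mul, PEquiv.mul_toMatrix_toPEquiv]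
  exact fun i j => hA (σ i) (τ.symm j)

end Homog

/-! ### Invertible matrices over a noncommutative ring. -/

section MatrixUnits

variable {S : Type*} [Ring S] {ι κ μ : Type*} [Fintype ι] [Fintype κ] [DecidableEq ι] [DecidableEq κ]

theorem isUnit_matrix_iff {A : Matrix ι ι S} :
    IsUnit A ↔ ∃ B : Matrix ι ι S, A * B = 1 ∧ B * A = 1 :=
  ⟨fun ⟨a, ha⟩ => ⟨(a⁻¹ : (Matrix ι ι S)ˣ), ha ▸ a.mul_inv, ha ▸ a.inv_mul⟩,
    fun ⟨B, h, h'⟩ => ⟨⟨A, B, h, h'⟩, rfl⟩⟩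

theorem isUnit_submatrix_of_equiv {A : Matrix ι ι S} (hA : IsUnit A) (e f : κ ≃ ι) :
    IsUnit (A.submatrix e f) := by
  obtain ⟨B, h, h'⟩ := isUnit_matrix_iff.1 hA
  refine isUnit_matrix_iff.2 ⟨B.submatrix f e, ?_, ?_⟩
  · rw [Matrix.submatrix_mul_equiv, h, Matrix.submatrix_one_equiv]
  · rw [Matrix.submatrix_mul_equiv, h', Matrix.submatrix_one_equiv]

theorem isUnit_submatrix_iff {A : Matrix ι ι S} (e f : κ ≃ ι) :
    IsUnit (A.submatrix e f) ↔ IsUnit A := by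
  refine ⟨fun h => ?_, fun h => isUnit_submatrix_of_equiv h e f⟩
  simpa using isUnit_submatrix_of_equiv h e.symm f.symm

theorem isUnit_fromBlocks_diagonal_iff {A : Matrix ι ι S} {B : Matrix κ κ S} :
    IsUnit (Matrix.fromBlocks A 0 0 B) ↔ IsUnit A ∧ IsUnit B := by
  constructor
  · intro h
    obtain ⟨N, h, h'⟩ := isUnit_matrix_iff.1 h
    rw [← N.fromBlocks_toBlocks, Matrix.fromBlocks_multiply, ← Matrix.fromBlocks_one,
      Matrix.fromBlocks_inj] at h h'
    simp only [Matrix.zero_mul, Matrix.mul_zero, add_zero, zero_add] at h h'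
    exact ⟨isUnit_matrix_iff.2 ⟨_, h.1, h'.1⟩, isUnit_matrix_iff.2 ⟨_, h.2.2.2, h'.2.2.2⟩⟩
  · rintro ⟨hA, hB⟩
    obtain ⟨A', h, h'⟩ := isUnit_matrix_iff.1 hA
    obtain ⟨B', k, k'⟩ := isUnit_matrix_iff.1 hB
    refine isUnit_matrix_iff.2 ⟨Matrix.fromBlocks A' 0 0 B', ?_, ?_⟩ <;>
      simp [Matrix.fromBlocks_multiply, h, h', k, k']

theorem eq_zero_of_isUnit_of_mulVec {A : Matrix ι ι S} (hA : IsUnit A) {v : ι → S}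
    (h : A.mulVec v = 0) : v = 0 := by
  obtain ⟨B, -, h'⟩ := isUnit_matrix_iff.1 hA
  rw [← Matrix.one_mulVec v, ← h', ← Matrix.mulVec_mulVec, h, Matrix.mulVec_zero]

theorem eq_zero_of_isUnit_of_vecMul {A : Matrix ι ι S} (hA : IsUnit A) {v : ι → S}
    (h : Matrix.vecMul v A = 0) : v = 0 := by
  obtain ⟨B, h', -⟩ := isUnit_matrix_iff.1 hA
  rw [← Matrix.vecMul_one v, ← h', ← Matrix.vecMul_vecMul, h, Matrix.zero_vecMul]

end MatrixUnits

/-! ### Linear algebra over a graded division ring. -/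

/-- The properties of the homogeneous components of a graded division ring that linear algebra
needs. -/
structure HasHomogInverses {G : Type v} [Group G] {D : Type u} [Ring D]
    (𝒟 : G → AddSubgroup D) : Prop where
  nontrivial : Nontrivial D
  one_mem : (1 : D) ∈ 𝒟 1
  mul_mem : ∀ {g h : G} {x y : D}, x ∈ 𝒟 g → y ∈ 𝒟 h → x * y ∈ 𝒟 (g * h)
  exists_inv : ∀ {g : G} {x : D}, x ∈ 𝒟 g → x ≠ 0 → ∃ y ∈ 𝒟 g⁻¹, x * y = 1 ∧ y * x = 1

theorem IsGrDivisionRing.hasHomogInverses {G : Type v} [Group G] {D : Type u} [Ring D]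
    {𝒟 : G → AddSubgroup D} (h : IsGrDivisionRing 𝒟) : HasHomogInverses 𝒟 :=
  ⟨h.nontrivial, h.one_mem, h.mul_mem,
    fun {_ _} hx hx0 => h.toIsGrading.exists_inv hx (h.isUnit_of_mem _ _ hx hx0)⟩

namespace HasHomogInverses

variable {G : Type v} [Group G] {D : Type u} [Ring D] {𝒟 : G → AddSubgroup D}

/-- The opposite ring, graded by inverting degrees. -/
theorem op (h : HasHomogInverses 𝒟) : HasHomogInverses (D := Dᵐᵒᵖ)
    fun g => (𝒟 g⁻¹).comap (MulOpposite.opAddEquiv (α := D)).symm.toAddMonoidHom := by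
  have := h.nontrivial
  refine ⟨inferInstance, ?_, ?_, ?_⟩
  · simpa using h.one_mem
  · intro a b x y hx hy
    simpa using h.mul_mem hy hx
  · intro g x hx hx0
    obtain ⟨y, hy, h1, h2⟩ := h.exists_inv hx (by simpa using hx0)
    exact ⟨MulOpposite.op y, hy, MulOpposite.unop_injective (by simpa using h2),
      MulOpposite.unop_injective (by simpa using h1)⟩

/-- Gaussian elimination on the number of equations: a nonzero entry is homogeneous, hence can serve
as a pivot, and elimination preserves the degrees. The condition on `v` says that it is a
homogeneous column with column degree `γ`. -/
theorem exists_mulVec_eq_zero_fin (h : HasHomogInverses 𝒟) : ∀ (r : ℕ) {κ : Type w} [Fintype κ]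
    (_ : r < Fintype.card κ) (l : Fin r → G) (β : κ → G) (Q : Matrix (Fin r) κ D),
    Homog 𝒟 l β Q →
    ∃ (γ : G) (v : κ → D), v ≠ 0 ∧ (∀ k, v k ∈ 𝒟 (β k * γ⁻¹)) ∧ Q.mulVec v = 0 := by
  classical
  have := h.nontrivial
  intro r
  induction r with
  | zero =>
    intro κ _ hr l β Q _
    obtain ⟨k⟩ := Fintype.card_pos_iff.1 hr
    refine ⟨β k, Pi.single k 1, fun h => one_ne_zero (α := D) (by simpa using congrFun h k), ?_,
      Subsingleton.elim _ _⟩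
    intro j
    by_cases hj : j = k
    · subst hj; simpa using h.one_mem
    · rw [Pi.single_eq_of_ne hj]; exact zero_mem _
  | succ r ih =>
    intro κ _ hr l β Q hQ
    by_cases hz : ∀ k, Q 0 k = 0
    · obtain ⟨γ, v, hv, hv', hv''⟩ := ih (by omega) (l ∘ Fin.succ) β (Q.submatrix Fin.succ id)
        (hQ.submatrix _ _)
      refine ⟨γ, v, hv, hv', funext fun i => ?_⟩
      refine Fin.cases ?_ (fun i => congrFun hv'' i) i
      simp [Matrix.mulVec, dotProduct, hz]
    push Not at hz
    obtain ⟨k, hk⟩ := hz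
    obtain ⟨p, hp, hp1, hp2⟩ := h.exists_inv (hQ 0 k) hk
    -- The system left after eliminating unknown `k` with equation `0`; a solution extends by the
    -- value at `k` which equation `0` forces.
    let Q' : Matrix (Fin r) {j // j ≠ k} D := fun i j => Q i.succ j - Q i.succ k * p * Q 0 j
    have hQ' : Homog 𝒟 (l ∘ Fin.succ) (fun j : {j // j ≠ k} => β j) Q' := by
      intro i j
      refine sub_mem (hQ _ _) ?_
      have := h.mul_mem (h.mul_mem (hQ i.succ k) hp) (hQ 0 j)
      simpa [mul_assoc] using this
    obtain ⟨γ, v, hv, hv', hv''⟩ := ih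
      (by rw [Fintype.card_subtype_compl, Fintype.card_subtype_eq]; omega) _ _ Q' hQ'
    set s : D := ∑ j : {j // j ≠ k}, Q 0 j * v j with hs
    let v1 : κ → D := fun j => if hj : j ≠ k then v ⟨j, hj⟩ else -(p * s)
    have hv1k : v1 k = -(p * s) := by simp [v1]
    have hv1 : ∀ j : {j // j ≠ k}, v1 j = v j := fun j => by simp [v1, j.2]
    refine ⟨γ, v1, ?_, ?_, ?_⟩
    · intro h0
      exact hv (funext fun j => by rw [← hv1 j, h0]; rfl)
    · intro j
      by_cases hj : j = k
      · subst hj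
        rw [hv1k]
        refine neg_mem ?_
        rw [hs, Finset.mul_sum]
        refine sum_mem fun i _ => ?_
        have := h.mul_mem hp (h.mul_mem (hQ 0 i) (hv' i))
        simpa [mul_assoc] using this
      · rw [hv1 ⟨j, hj⟩]; exact hv' ⟨j, hj⟩
    · have e : ∀ i, Q.mulVec v1 i = Q i k * v1 k + ∑ j : {j // j ≠ k}, Q i j * v j := by
        intro i
        simp only [Matrix.mulVec, dotProduct]
        rw [Fintype.sum_eq_add_sum_subtype_ne _ k]
        simp_rw [hv1]
      funext i
      rw [e, hv1k]
      refine Fin.cases ?_ (fun i => ?_) i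
      · rw [mul_neg, ← mul_assoc, hp1, one_mul, ← hs, neg_add_cancel]; rfl
      · have := congrFun hv'' i
        simp only [Matrix.mulVec, dotProduct, Q', sub_mul, Finset.sum_sub_distrib, mul_assoc,
          ← Finset.mul_sum] at this
        rw [mul_neg, neg_add_eq_sub]
        exact this

/-- A homogeneous linear system with more unknowns than equations has a nonzero homogeneous
solution. -/
theorem exists_mulVec_eq_zero (h : HasHomogInverses 𝒟) {ρ κ : Type*} [Fintype ρ] [Fintype κ]
    (hr : Fintype.card ρ < Fintype.card κ) {l : ρ → G} {β : κ → G} {Q : Matrix ρ κ D}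
    (hQ : Homog 𝒟 l β Q) :
    ∃ (γ : G) (v : κ → D), v ≠ 0 ∧ (∀ k, v k ∈ 𝒟 (β k * γ⁻¹)) ∧ Q.mulVec v = 0 := by
  let e := Fintype.equivFin ρ
  obtain ⟨γ, v, hv, hv', hv''⟩ := h.exists_mulVec_eq_zero_fin _ hr (l ∘ e.symm) β
    (Q.submatrix e.symm id) (hQ.submatrix _ _)
  refine ⟨γ, v, hv, hv', funext fun i => ?_⟩
  have := congrFun hv'' (e i)
  simpa [Matrix.mulVec, Matrix.submatrix] using this

/-- Column `i` of the inverse solves `A b = eᵢ`. Adjoining `eᵢ` to `A` as an extra column `none`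
gives more unknowns than equations, hence a nonzero homogeneous solution. Its coordinate at `none`
cannot vanish because `A` has no homogeneous kernel, and dividing by it gives `b`. -/
theorem exists_right_inverse (h : HasHomogInverses 𝒟) {ι : Type*} [Fintype ι] [DecidableEq ι]
    {α β : ι → G} {A : Matrix ι ι D} (hA : Homog 𝒟 α β A)
    (hker : ∀ (γ : G) (v : ι → D), (∀ k, v k ∈ 𝒟 (β k * γ⁻¹)) → A.mulVec v = 0 → v = 0) :
    ∃ B, Homog 𝒟 β α B ∧ A * B = 1 := by
  have col : ∀ i, ∃ b : ι → D, (∀ j, b j ∈ 𝒟 (β j * (α i)⁻¹)) ∧ A.mulVec b = Pi.single i 1 := by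
    intro i
    let Q : Matrix ι (Option ι) D := fun i' j => j.elim ((Pi.single i 1 : ι → D) i') (A i')
    have hQ : Homog 𝒟 α (fun j : Option ι => j.elim (α i) β) Q := by
      rintro i' (_ | j)
      · by_cases hi : i' = i
        · subst hi; simpa [Q] using h.one_mem
        · simp [Q, hi]
      · exact hA i' j
    obtain ⟨γ, v, hv, hv', hv''⟩ := h.exists_mulVec_eq_zero (by simp) hQ
    have e : ∀ i', (Pi.single i 1 : ι → D) i' * v none + A.mulVec (fun j => v (some j)) i' = 0 := by
      intro i'
      have := congrFun hv'' i'
      simpa [Matrix.mulVec, dotProduct, Fintype.sum_option, Q] using this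
    have hn : v none ≠ 0 := by
      intro h0
      have hs : (fun j => v (some j)) = 0 :=
        hker γ _ (fun k => hv' (some k)) (funext fun i' => by simpa [h0] using e i')
      exact hv (funext fun j => by
        cases j with
        | none => exact h0
        | some j => exact congrFun hs j)
    obtain ⟨p, hp, hp1, hp2⟩ := h.exists_inv (hv' none) hn
    refine ⟨fun j => -(v (some j) * p), fun j => neg_mem ?_, funext fun i' => ?_⟩
    · have := h.mul_mem (hv' (some j)) hp
      simpa [mul_assoc] using this
    · have := e i'
      have e2 : A.mulVec (fun j => -(v (some j) * p)) i'
          = -(A.mulVec (fun j => v (some j)) i' * p) := by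
        simp [Matrix.mulVec, dotProduct, Finset.sum_mul, mul_assoc]
      rw [e2, eq_neg_of_add_eq_zero_right this, neg_mul, neg_neg, mul_assoc, hp1, mul_one]
  choose b hb hb' using col
  refine ⟨Matrix.of fun j i => b i j, fun j i => hb i j, ?_⟩
  ext i' i
  have := congrFun (hb' i) i'
  rw [Matrix.one_apply, Matrix.mul_apply]
  simpa [Matrix.mulVec, dotProduct, Pi.single_apply] using this

/-- A right inverse `B` has zero kernel since `A * B = 1`, so `B` has a right inverse too, and this
can only be `A`. -/
theorem isUnit_of_mulVec (h : HasHomogInverses 𝒟) {ι : Type*} [Fintype ι] [DecidableEq ι]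
    {α β : ι → G} {A : Matrix ι ι D} (hA : Homog 𝒟 α β A)
    (hker : ∀ (γ : G) (v : ι → D), (∀ k, v k ∈ 𝒟 (β k * γ⁻¹)) → A.mulVec v = 0 → v = 0) :
    IsUnit A := by
  obtain ⟨B, hB, hAB⟩ := h.exists_right_inverse hA hker
  obtain ⟨C, hC, hBC⟩ := h.exists_right_inverse hB fun γ v _ hv => by
    rw [← Matrix.one_mulVec v, ← hAB, ← Matrix.mulVec_mulVec, hv, Matrix.mulVec_zero]
  have : A = C := by rw [← mul_one A, ← hBC, ← mul_assoc, hAB, one_mul]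
  exact isUnit_matrix_iff.2 ⟨B, hAB, this ▸ hBC⟩

/-- Transposing into the opposite ring turns the left kernel into a right kernel, so `A` has a left
inverse; then its right kernel vanishes. -/
theorem isUnit_of_vecMul (h : HasHomogInverses 𝒟) {ι : Type*} [Fintype ι] [DecidableEq ι]
    {α β : ι → G} {A : Matrix ι ι D} (hA : Homog 𝒟 α β A)
    (hker : ∀ (γ : G) (w : ι → D), (∀ k, w k ∈ 𝒟 (γ * (α k)⁻¹)) → Matrix.vecMul w A = 0 → w = 0) :
    IsUnit A := by
  obtain ⟨N, -, hN⟩ := h.op.exists_right_inverse (α := β) (β := α)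
    (A := Matrix.of fun i j => MulOpposite.op (A j i)) (fun i j => by simpa using hA j i)
    (fun γ v hv hv' => by
      have : (fun k => (v k).unop) = 0 := hker γ _ (fun k => by simpa using hv k) (by
        funext i
        have := congrArg MulOpposite.unop (congrFun hv' i)
        simpa [Matrix.mulVec, Matrix.vecMul, dotProduct] using this)
      exact funext fun k => MulOpposite.unop_injective (congrFun this k))
  refine h.isUnit_of_mulVec hA fun γ v _ hv => ?_
  have hB : Matrix.of (fun i j => MulOpposite.unop (N j i)) * A = 1 := by
    ext k i
    have := congrArg MulOpposite.unop (congrFun (congrFun hN i) k)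
    rw [Matrix.mul_apply] at this
    simp only [MulOpposite.unop_mul, Finset.unop_sum, Matrix.of_apply, MulOpposite.unop_op] at this
    rw [Matrix.mul_apply]
    simp only [Matrix.of_apply]
    rw [this, Matrix.one_apply, Matrix.one_apply]
    by_cases hik : i = k
    · subst hik; simp
    · rw [if_neg hik, if_neg (Ne.symm hik)]; rfl
  rw [← Matrix.one_mulVec v, ← hB, ← Matrix.mulVec_mulVec, hv, Matrix.mulVec_zero]

/-- A homogeneous matrix over a graded division ring is invertible if it becomes invertible over
some nonzero ring. -/
theorem isUnit_map_iff (h : HasHomogInverses 𝒟) {E : Type*} [Ring E] [Nontrivial E] (η : D →+* E)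
    {ι : Type*} [Fintype ι] [DecidableEq ι] {α β : ι → G} {A : Matrix ι ι D}
    (hA : Homog 𝒟 α β A) : IsUnit (A.map η) ↔ IsUnit A := by
  refine ⟨fun hu => h.isUnit_of_mulVec hA fun γ v hv hv' => ?_, fun hu => hu.map η.mapMatrix⟩
  -- A nonzero homogeneous element is a unit, so `η` cannot kill it: a nonzero homogeneous kernel
  -- vector would survive in `E`.
  have h0 : (fun k => η (v k)) = 0 := eq_zero_of_isUnit_of_mulVec hu (funext fun i => by
    have := congrArg η (congrFun hv' i)
    simpa [Matrix.mulVec, dotProduct] using this)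
  by_contra hne
  obtain ⟨k, hk⟩ := Function.ne_iff.1 hne
  obtain ⟨y, -, hy, -⟩ := h.exists_inv (hv k) hk
  have := congrArg η hy
  rw [map_mul, show η (v k) = 0 from congrFun h0 k, zero_mul, map_one] at this
  exact zero_ne_one this

/-- A homogeneous kernel vector is rescaled on the right by the inverse of its coordinate `j` when
that is nonzero. Normalized kernel vectors of two matrices can then be combined. -/
theorem exists_normalized_mulVec (h : HasHomogInverses 𝒟) {ι : Type*} [Fintype ι] [DecidableEq ι]
    {α β : ι → G} {A : Matrix ι ι D} (hA : Homog 𝒟 α β A) (hu : ¬ IsUnit A) (j : ι) :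
    ∃ v : ι → D, v ≠ 0 ∧ A.mulVec v = 0 ∧ (v j = 0 ∨ v j = 1) := by
  have := h.nontrivial
  by_contra! hcon
  refine hu (h.isUnit_of_mulVec hA fun γ v hv hv' => ?_)
  by_contra hne
  have hj := (hcon v hne hv').1
  obtain ⟨p, -, hp, -⟩ := h.exists_inv (hv j) hj
  refine (hcon (fun k => v k * p) (fun h0 => one_ne_zero (α := D) ?_) ?_).2 hp
  · rw [← hp]; exact congrFun h0 j
  · funext i
    have := congrFun hv' i
    simp only [Matrix.mulVec, dotProduct, ← mul_assoc, ← Finset.sum_mul] at this ⊢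
    rw [this]; simp

theorem exists_normalized_vecMul (h : HasHomogInverses 𝒟) {ι : Type*} [Fintype ι] [DecidableEq ι]
    {α β : ι → G} {A : Matrix ι ι D} (hA : Homog 𝒟 α β A) (hu : ¬ IsUnit A) (j : ι) :
    ∃ v : ι → D, v ≠ 0 ∧ Matrix.vecMul v A = 0 ∧ (v j = 0 ∨ v j = 1) := by
  have := h.nontrivial
  by_contra! hcon
  refine hu (h.isUnit_of_vecMul hA fun γ v hv hv' => ?_)
  by_contra hne
  have hj := (hcon v hne hv').1
  obtain ⟨p, -, -, hp⟩ := h.exists_inv (hv j) hj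
  refine (hcon (fun k => p * v k) (fun h0 => one_ne_zero (α := D) ?_) ?_).2 hp
  · rw [← hp]; exact congrFun h0 j
  · funext i
    have := congrFun hv' i
    simp only [Matrix.vecMul, dotProduct, mul_assoc, ← Finset.mul_sum] at this ⊢
    rw [this]; simp

/-- A kernel vector of `A` or `B` that vanishes at `j` does not see column `j` and is still a kernel
vector of the sum. Otherwise both have coordinate `1` at `j`, and the vector equal to `1` at `j` and
to `v + w` elsewhere is killed. -/
theorem not_isUnit_of_col_sum (h : HasHomogInverses 𝒟) {ι : Type*} [Fintype ι] [DecidableEq ι]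
    {α β : ι → G} {A B : Matrix ι ι D} (hA : Homog 𝒟 α β A) (hB : Homog 𝒟 α β B) (j : ι)
    (hAB : ∀ i k, k ≠ j → A i k = B i k) (hA' : ¬ IsUnit A) (hB' : ¬ IsUnit B) :
    ¬ IsUnit (A.updateCol j fun i => A i j + B i j) := by
  intro hu
  have := h.nontrivial
  obtain ⟨v, hv, hv', hvj⟩ := h.exists_normalized_mulVec hA hA' j
  obtain ⟨w, hw, hw', hwj⟩ := h.exists_normalized_mulVec hB hB' j
  have split : ∀ (C : Matrix ι ι D) (u : ι → D) (i : ι),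
      C.mulVec u i = C i j * u j + ∑ k : {k // k ≠ j}, C i k * u k := fun C u i =>
    Fintype.sum_eq_add_sum_subtype_ne (fun k => C i k * u k) j
  have hC : ∀ (i : ι) (k : {k // k ≠ j}),
      (A.updateCol j fun i => A i j + B i j) i k = A i k := fun i k => by
    rw [Matrix.updateCol_ne k.2]
  have hC' : ∀ (i : ι) (k : {k // k ≠ j}),
      (A.updateCol j fun i => A i j + B i j) i k = B i k := fun i k => by
    rw [Matrix.updateCol_ne k.2, hAB i k k.2]
  rcases hvj with hvj | hvj
  · refine hv (eq_zero_of_isUnit_of_mulVec hu (funext fun i => ?_))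
    rw [split, ← congrFun hv' i, split A]
    simp_rw [hC, hvj, mul_zero]
  rcases hwj with hwj | hwj
  · refine hw (eq_zero_of_isUnit_of_mulVec hu (funext fun i => ?_))
    rw [split, ← congrFun hw' i, split B]
    simp_rw [hC', hwj, mul_zero]
  let z : ι → D := fun k => if k = j then 1 else v k + w k
  have hzj : z j = 1 := if_pos rfl
  have hz : ∀ k : {k // k ≠ j}, z k = v k + w k := fun k => if_neg k.2
  have hz0 : z = 0 := eq_zero_of_isUnit_of_mulVec hu (funext fun i => by
    have h1 := congrFun hv' i
    have h2 := congrFun hw' i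
    rw [split, hvj, mul_one] at h1
    rw [split, hwj, mul_one] at h2
    rw [split, hzj, mul_one, Matrix.updateCol_self]
    simp_rw [hz, mul_add, Finset.sum_add_distrib]
    have e : ∑ k : {k // k ≠ j}, (A.updateCol j fun i => A i j + B i j) i k * w k
        = ∑ k : {k // k ≠ j}, B i k * w k := by simp_rw [hC']
    rw [e]
    simp_rw [hC]
    rw [add_add_add_comm, h1, h2, Pi.zero_apply, add_zero])
  exact one_ne_zero (hzj.symm.trans (congrFun hz0 j))

theorem not_isUnit_of_row_sum (h : HasHomogInverses 𝒟) {ι : Type*} [Fintype ι] [DecidableEq ι]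
    {α β : ι → G} {A B : Matrix ι ι D} (hA : Homog 𝒟 α β A) (hB : Homog 𝒟 α β B) (j : ι)
    (hAB : ∀ k i, k ≠ j → A k i = B k i) (hA' : ¬ IsUnit A) (hB' : ¬ IsUnit B) :
    ¬ IsUnit (A.updateRow j fun i => A j i + B j i) := by
  intro hu
  have := h.nontrivial
  obtain ⟨v, hv, hv', hvj⟩ := h.exists_normalized_vecMul hA hA' j
  obtain ⟨w, hw, hw', hwj⟩ := h.exists_normalized_vecMul hB hB' j
  have split : ∀ (C : Matrix ι ι D) (u : ι → D) (i : ι),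
      Matrix.vecMul u C i = u j * C j i + ∑ k : {k // k ≠ j}, u k * C k i := fun C u i =>
    Fintype.sum_eq_add_sum_subtype_ne (fun k => u k * C k i) j
  have hC : ∀ (i : ι) (k : {k // k ≠ j}),
      (A.updateRow j fun i => A j i + B j i) k i = A k i := fun i k => by
    rw [Matrix.updateRow_ne k.2]
  have hC' : ∀ (i : ι) (k : {k // k ≠ j}),
      (A.updateRow j fun i => A j i + B j i) k i = B k i := fun i k => by
    rw [Matrix.updateRow_ne k.2, hAB k i k.2]
  rcases hvj with hvj | hvj
  · refine hv (eq_zero_of_isUnit_of_vecMul hu (funext fun i => ?_))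
    rw [split, ← congrFun hv' i, split A]
    simp_rw [hC, hvj, zero_mul]
  rcases hwj with hwj | hwj
  · refine hw (eq_zero_of_isUnit_of_vecMul hu (funext fun i => ?_))
    rw [split, ← congrFun hw' i, split B]
    simp_rw [hC', hwj, zero_mul]
  let z : ι → D := fun k => if k = j then 1 else v k + w k
  have hzj : z j = 1 := if_pos rfl
  have hz : ∀ k : {k // k ≠ j}, z k = v k + w k := fun k => if_neg k.2
  have hz0 : z = 0 := eq_zero_of_isUnit_of_vecMul hu (funext fun i => by
    have h1 := congrFun hv' i
    have h2 := congrFun hw' i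
    rw [split, hvj, one_mul] at h1
    rw [split, hwj, one_mul] at h2
    rw [split, hzj, one_mul, Matrix.updateRow_self]
    simp_rw [hz, add_mul, Finset.sum_add_distrib]
    have e : ∑ k : {k // k ≠ j}, w k * (A.updateRow j fun i => A j i + B j i) k i
        = ∑ k : {k // k ≠ j}, w k * B k i := by simp_rw [hC']
    rw [e]
    simp_rw [hC]
    rw [add_add_add_comm, h1, h2, Pi.zero_apply, add_zero])
  exact one_ne_zero (hzj.symm.trans (congrFun hz0 j))

end HasHomogInverses

/-! ### Singular kernels are gr-prime matrix ideals, and gr-prime matrix ideals restrict. -/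

section SingularKernel

variable {G : Type v} [Group G] {R : Type u} [Ring R] {𝒜 : G → AddSubgroup R}

theorem permMatrix_mul_mul_permMatrix {n : ℕ} (A : Matrix (Fin n) (Fin n) R)
    (σ τ : Equiv.Perm (Fin n)) :
    σ.permMatrix R * A * τ.permMatrix R = A.submatrix σ τ.symm := by
  rw [PEquiv.toMatrix_toPEquiv_mul, PEquiv.mul_toMatrix_toPEquiv]; rfl

theorem diagSum_mem_homSqMatrices {A B : SqMatrix R} (hA : A ∈ homSqMatrices 𝒜)
    (hB : B ∈ homSqMatrices 𝒜) : diagSum A B ∈ homSqMatrices 𝒜 := by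
  obtain ⟨α, β, hA⟩ := hA
  obtain ⟨α', β', hB⟩ := hB
  exact ⟨Sum.elim α α' ∘ finSumFinEquiv.symm, Sum.elim β β' ∘ finSumFinEquiv.symm,
    (Homog.fromBlocks hA Homog.zero Homog.zero hB).submatrix _ _⟩

theorem perm_mem_homSqMatrices {n : ℕ} {A : Matrix (Fin n) (Fin n) R}
    (hA : (⟨n, A⟩ : SqMatrix R) ∈ homSqMatrices 𝒜) (σ τ : Equiv.Perm (Fin n)) :
    (⟨n, σ.permMatrix R * A * τ.permMatrix R⟩ : SqMatrix R) ∈ homSqMatrices 𝒜 := by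
  obtain ⟨α, β, hA⟩ := hA
  exact ⟨_, _, homog_perm_mul_mul (𝒜 := 𝒜) hA σ τ⟩

/-- The homogeneous matrices that do not become invertible over a graded division ring form a
gr-prime matrix ideal. -/
theorem isGrPrimeMatrixIdeal_of_hom {D : Type w} [Ring D] {𝒟 : G → AddSubgroup D}
    (h : HasHomogInverses 𝒟) (φ : R →+* D) (hφ : ∀ g, ∀ r ∈ 𝒜 g, φ r ∈ 𝒟 g) :
    IsGrPrimeMatrixIdeal 𝒜 {A | A ∈ homSqMatrices 𝒜 ∧ ¬ IsUnit (A.2.map φ)} := by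
  have := h.nontrivial
  refine ⟨fun A hA => hA.1, ?_, ?_, ?_, ?_, ?_, ?_, ?_⟩
  · rintro ⟨n, A⟩ hA hf
    refine ⟨hA, fun hu => hf fun r α β l P Q hP hQ hPQ => ?_⟩
    by_contra! hlt
    -- The right factor has fewer rows than columns; a vector in its kernel is also killed by the
    -- product.
    obtain ⟨γ, v, hv, -, hv'⟩ := h.exists_mulVec_eq_zero (by simpa using hlt)
      (Homog.map hφ (𝒜 := 𝒜) (α := l) (β := β) hQ)
    refine hv (eq_zero_of_isUnit_of_mulVec hu ?_)
    dsimp only at hPQ ⊢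
    rw [hPQ, Matrix.map_mul, ← Matrix.mulVec_mulVec, hv', Matrix.mulVec_zero]
  · intro n α β A B j hA hB hAB hA' hB'
    refine ⟨⟨α, β, homog_updateCol (𝒜 := 𝒜) hA fun i => add_mem (hA i j) (hB i j)⟩, ?_⟩
    have := h.not_isUnit_of_col_sum (Homog.map hφ (𝒜 := 𝒜) hA) (Homog.map hφ (𝒜 := 𝒜) hB) j
      (fun i k hk => by simp [hAB i k hk]) hA'.2 hB'.2
    dsimp only
    rw [Matrix.map_updateCol]
    convert this using 3
    funext i
    simp
  · intro n α β A B j hA hB hAB hA' hB'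
    refine ⟨⟨α, β, homog_updateRow (𝒜 := 𝒜) hA fun i => add_mem (hA j i) (hB j i)⟩, ?_⟩
    have := h.not_isUnit_of_row_sum (Homog.map hφ (𝒜 := 𝒜) hA) (Homog.map hφ (𝒜 := 𝒜) hB) j
      (fun i k hk => by simp [hAB i k hk]) hA'.2 hB'.2
    dsimp only
    rw [Matrix.map_updateRow]
    convert this using 3
    funext i
    simp
  · rintro A ⟨hA, hA'⟩ B hB
    refine ⟨diagSum_mem_homSqMatrices hA hB, fun hu => hA' ?_⟩
    rw [diagSum, Matrix.reindex_apply, ← Matrix.submatrix_map, isUnit_submatrix_iff,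
      Matrix.fromBlocks_map, Matrix.map_zero _ (map_zero φ), Matrix.map_zero _ (map_zero φ),
      isUnit_fromBlocks_diagonal_iff] at hu
    exact hu.1
  · rintro A hA B hB ⟨-, hu⟩
    by_contra! hcon
    refine hu ?_
    rw [diagSum, Matrix.reindex_apply, ← Matrix.submatrix_map, isUnit_submatrix_iff,
      Matrix.fromBlocks_map, Matrix.map_zero _ (map_zero φ), Matrix.map_zero _ (map_zero φ),
      isUnit_fromBlocks_diagonal_iff]
    exact ⟨not_not.1 fun h => hcon.1 ⟨hA, h⟩, not_not.1 fun h => hcon.2 ⟨hB, h⟩⟩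
  · rintro ⟨-, hu⟩
    refine hu ?_
    simp
  · rintro n A σ τ ⟨hA, hA'⟩
    refine ⟨perm_mem_homSqMatrices hA σ τ, fun hu => hA' ?_⟩
    dsimp only at hu
    rwa [permMatrix_mul_mul_permMatrix, ← Matrix.submatrix_map, isUnit_submatrix_iff] at hu

theorem GrEpicDivisionRing.isGrPrimeMatrixIdeal_singularKernel (K : GrEpicDivisionRing 𝒜) :
    IsGrPrimeMatrixIdeal 𝒜 K.singularKernel :=
  isGrPrimeMatrixIdeal_of_hom K.isGrDivisionRing.hasHomogInverses K.hom K.hom_mem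

section Restriction

variable {G' : Type w} [Group G'] {ℬ : G' → AddSubgroup R} {π : G →* G'}

theorem homSqMatrices_mono (h : ∀ g, 𝒜 g ≤ ℬ (π g)) : homSqMatrices 𝒜 ⊆ homSqMatrices ℬ :=
  fun _ ⟨_, _, hA⟩ => ⟨_, _, Homog.mono h hA⟩

/-- Applying `π` to degrees turns an `𝒜`-homogeneous factorization into a `ℬ`-homogeneous one, so a
matrix that is not full for `𝒜` is not full for `ℬ`. The other axioms restrict directly. -/
theorem restrictTo_mem_grSpec (h : ∀ g, 𝒜 g ≤ ℬ (π g)) {P : Set (SqMatrix R)}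
    (hP : P ∈ grSpec ℬ) : restrictTo 𝒜 P ∈ grSpec 𝒜 := by
  have hP : IsGrPrimeMatrixIdeal ℬ P := hP
  have hs := homSqMatrices_mono h
  refine ⟨fun A hA => hA.2, ?_, ?_, ?_, ?_, ?_, ?_, ?_⟩
  · refine fun A hA hf => ⟨hP.not_full A (hs hA) fun hf' => hf ?_, hA⟩
    intro r α β l P Q hP hQ e
    exact hf' r _ _ _ P Q (Homog.mono h hP) (Homog.mono h hQ) e
  · intro n α β A B j hA hB hAB hA' hB'
    exact ⟨hP.col_sum n _ _ A B j (Homog.mono h hA) (Homog.mono h hB) hAB hA'.1 hB'.1,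
      α, β, homog_updateCol (𝒜 := 𝒜) hA fun i => add_mem (hA i j) (hB i j)⟩
  · intro n α β A B j hA hB hAB hA' hB'
    exact ⟨hP.row_sum n _ _ A B j (Homog.mono h hA) (Homog.mono h hB) hAB hA'.1 hB'.1,
      α, β, homog_updateRow (𝒜 := 𝒜) hA fun i => add_mem (hA j i) (hB j i)⟩
  · exact fun A hA B hB => ⟨hP.diagSum_mem A hA.1 B (hs hB), diagSum_mem_homSqMatrices hA.2 hB⟩
  · exact fun A hA B hB hAB => (hP.mem_or_mem A (hs hA) B (hs hB) hAB.1).imp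
      (fun h => ⟨h, hA⟩) fun h => ⟨h, hB⟩
  · exact fun h => hP.one_notMem h.1
  · exact fun n A σ τ hA => ⟨hP.perm_mem n A σ τ hA.1, perm_mem_homSqMatrices hA.2 σ τ⟩

end Restriction

end SingularKernel

/-! ### Matrix calculus modulo a gr-prime matrix ideal. -/

section Sing

variable {G : Type v} [Group G] {R : Type u} [Ring R] {𝒜 : G → AddSubgroup R}
  {P : Set (SqMatrix R)}

/-- A matrix with arbitrary index types of equal cardinality belongs to the set `P` of square
matrices, after some enumeration of its rows and of its columns. -/
def Sing (P : Set (SqMatrix R)) {ι κ : Type*} (A : Matrix ι κ R) : Prop :=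
  ∃ (n : ℕ) (e : ι ≃ Fin n) (f : κ ≃ Fin n), (⟨n, A.submatrix e.symm f.symm⟩ : SqMatrix R) ∈ P

theorem sing_submatrix {ι κ ι' κ' : Type*} {A : Matrix ι κ R} (e : ι' ≃ ι) (f : κ' ≃ κ) :
    Sing P (A.submatrix e f) ↔ Sing P A := by
  constructor
  · rintro ⟨n, e', f', h⟩
    exact ⟨n, e.symm.trans e', f.symm.trans f', by simpa using h⟩
  · rintro ⟨n, e', f', h⟩
    refine ⟨n, e.trans e', f.trans f', ?_⟩
    convert h using 2
    ext i j
    simp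

theorem Sing.of_submatrix_eq {ι κ ι' κ' : Type*} {A : Matrix ι κ R} {B : Matrix ι' κ' R}
    (e : ι' ≃ ι) (f : κ' ≃ κ) (h : ∀ i j, B i j = A (e i) (f j)) : Sing P B ↔ Sing P A := by
  rw [← sing_submatrix e f]
  exact iff_of_eq (congrArg _ (Matrix.ext h))

namespace IsGrPrimeMatrixIdeal

/-- Two enumerations differ by permutations of rows and columns, under which `P` is stable, so one
enumeration decides membership. -/
theorem sing_iff (hP : IsGrPrimeMatrixIdeal 𝒜 P) {ι κ : Type*} {A : Matrix ι κ R} {n : ℕ}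
    (e : ι ≃ Fin n) (f : κ ≃ Fin n) :
    Sing P A ↔ (⟨n, A.submatrix e.symm f.symm⟩ : SqMatrix R) ∈ P := by
  refine ⟨?_, fun h => ⟨n, e, f, h⟩⟩
  rintro ⟨m, e', f', h⟩
  obtain rfl : m = n := by
    have := Fintype.card_congr (e'.symm.trans e)
    simpa using this
  have := hP.perm_mem m _ (e.symm.trans e') (f'.symm.trans f) h
  rw [permMatrix_mul_mul_permMatrix] at this
  convert this using 2
  ext i j
  simp

theorem sing_mk_iff (hP : IsGrPrimeMatrixIdeal 𝒜 P) {n : ℕ} {A : Matrix (Fin n) (Fin n) R} :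
    Sing P A ↔ (⟨n, A⟩ : SqMatrix R) ∈ P := by
  rw [hP.sing_iff (Equiv.refl _) (Equiv.refl _)]; rfl

variable {ι κ μ ν : Type*} [Fintype ι] [Fintype κ] [Fintype μ] [Fintype ν]

theorem sing_of_factor (hP : IsGrPrimeMatrixIdeal 𝒜 P) {ρ : Type*} [Fintype ρ]
    {α : ι → G} {β : κ → G} {l : ρ → G} {X : Matrix ι ρ R} {Y : Matrix ρ κ R}
    (hX : Homog 𝒜 α l X) (hY : Homog 𝒜 l β Y) (hXY : Homog 𝒜 α β (X * Y))
    (hc : Fintype.card ι = Fintype.card κ) (hρ : Fintype.card ρ < Fintype.card ι) :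
    Sing P (X * Y) := by
  let e := Fintype.equivFin ι
  let f := Fintype.equivFinOfCardEq hc.symm
  let k := Fintype.equivFin ρ
  refine ⟨_, e, f, hP.not_full _ ⟨_, _, hXY.submatrix _ _⟩ fun hf => ?_⟩
  have := hf _ (α ∘ e.symm) (β ∘ f.symm) (l ∘ k.symm) (X.submatrix e.symm k.symm)
    (Y.submatrix k.symm f.symm) (hX.submatrix _ _) (hY.submatrix _ _)
    (by rw [Matrix.submatrix_mul_equiv])
  exact absurd this (not_le.2 hρ)

theorem sing_of_col_sum [DecidableEq κ] (hP : IsGrPrimeMatrixIdeal 𝒜 P)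
    {α : ι → G} {β : κ → G} {A B C : Matrix ι κ R} (hA : Homog 𝒜 α β A) (hB : Homog 𝒜 α β B) (j : κ)
    (hBA : ∀ i k, k ≠ j → B i k = A i k) (hCA : ∀ i k, k ≠ j → C i k = A i k)
    (hC : ∀ i, C i j = A i j + B i j) (hA' : Sing P A) (hB' : Sing P B) : Sing P C := by
  obtain ⟨n, e, f, h⟩ := hA'
  rw [hP.sing_iff e f] at hB' ⊢
  have := hP.col_sum n _ _ _ _ (f j) (hA.submatrix e.symm f.symm) (hB.submatrix e.symm f.symm)
    (fun i k hk => (hBA _ _ (fun h => hk (by rw [← h, Equiv.apply_symm_apply]))).symm) h hB'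
  convert this using 2
  ext i k
  by_cases hk : k = f j
  · subst hk; simp [hC]
  · rw [Matrix.updateCol_ne hk]
    exact hCA _ _ fun h => hk (by rw [← h, Equiv.apply_symm_apply])

/-- Changing the columns of a matrix one at a time, each time by adding to it a column that makes
the matrix singular. -/
theorem sing_add_of_cols [DecidableEq κ] (hP : IsGrPrimeMatrixIdeal 𝒜 P)
    {α : ι → G} {β : κ → G} {M E : Matrix ι κ R} (hM : Homog 𝒜 α β M) (hE : Homog 𝒜 α β E)
    (hs : ∀ (N : Matrix ι κ R) (j : κ), Homog 𝒜 α β N →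
      (∀ k, k ≠ j → (∀ i, N i k = M i k) ∨ ∀ i, N i k = M i k + E i k) →
      (∀ i, N i j = E i j) → (∃ i, E i j ≠ 0) → Sing P N) (h : Sing P M) : Sing P (M + E) := by
  suffices H : ∀ s : Finset κ, Sing P (Matrix.of fun i k => if k ∈ s then M i k + E i k else M i k) by
    convert H Finset.univ using 1
    ext i k
    simp
  intro s
  have hom : ∀ s : Finset κ,
      Homog 𝒜 α β (Matrix.of fun i k => if k ∈ s then M i k + E i k else M i k) := by
    intro s i k
    rw [Matrix.of_apply]
    split_ifs
    exacts [add_mem (hM i k) (hE i k), hM i k]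
  induction s using Finset.induction_on with
  | empty => convert h using 1; ext i k; simp
  | insert j s hj ih =>
    by_cases hz : ∃ i, E i j ≠ 0
    swap
    · push Not at hz
      convert ih using 1
      ext i k
      simp only [Matrix.of_apply, Finset.mem_insert]
      by_cases hk : k = j
      · subst hk; simp [hz]
      · simp [hk]
    refine hP.sing_of_col_sum (hom s) (B := Matrix.of fun i k => if k = j then E i k else
      if k ∈ s then M i k + E i k else M i k) ?_ j ?_ ?_ ?_ ih ?_
    · intro i k
      rw [Matrix.of_apply]
      split_ifs
      exacts [hE i k, add_mem (hM i k) (hE i k), hM i k]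
    · intro i k hk; simp [hk]
    · intro i k hk; simp [hk]
    · intro i; simp [hj]
    · refine hs _ j ?_ ?_ ?_ hz
      · intro i k
        rw [Matrix.of_apply]
        split_ifs
        exacts [hE i k, add_mem (hM i k) (hE i k), hM i k]
      · intro k hk
        by_cases hks : k ∈ s
        · right; intro i; simp [hk, hks]
        · left; intro i; simp [hk, hks]
      · intro i; simp

variable [DecidableEq ι] [DecidableEq κ]

/-- If column `j` is a homogeneous combination of the others, then `N` factors through the index set
without `j` and is not full. -/
theorem sing_of_col_comb (hP : IsGrPrimeMatrixIdeal 𝒜 P) (h𝒜 : IsGrading 𝒜)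
    {α : ι → G} {β : κ → G} {N : Matrix ι κ R} (hN : Homog 𝒜 α β N)
    (hc : Fintype.card ι = Fintype.card κ) (j : κ) (c : κ → R) (hcj : c j = 0)
    (hcm : ∀ k, c k ∈ 𝒜 (β k * (β j)⁻¹)) (h : ∀ i, N i j = ∑ k, N i k * c k) : Sing P N := by
  let X : Matrix ι {k // k ≠ j} R := Matrix.of fun i k => N i k
  let Y : Matrix {k // k ≠ j} κ R := Matrix.of fun k k' =>
    if k' = j then c k else if (k : κ) = k' then 1 else 0
  have e : X * Y = N := by
    ext i k
    rw [Matrix.mul_apply]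
    simp only [X, Y, Matrix.of_apply]
    by_cases hk : k = j
    · subst hk
      rw [h, Fintype.sum_eq_add_sum_subtype_ne _ k, hcj, mul_zero, zero_add]
      simp
    · simp only [if_neg hk]
      rw [Finset.sum_eq_single ⟨k, hk⟩]
      · simp
      · rintro ⟨k', hk'⟩ - hne
        rw [if_neg (fun h => hne (Subtype.ext h)), mul_zero]
      · simp
  rw [← e]
  refine hP.sing_of_factor (X := X) (Y := Y) (α := α) (β := β) (l := fun k : {k // k ≠ j} => β k) (fun i k => hN i k) ?_
    (by rw [e]; exact hN) hc ?_
  · intro k k'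
    simp only [Y, Matrix.of_apply]
    split_ifs with h1 h2
    · subst h1; exact hcm k
    · subst h2; simpa using h𝒜.one_mem
    · exact zero_mem _
  · rw [Fintype.card_subtype_compl, Fintype.card_subtype_eq, hc]
    exact Nat.sub_lt (Fintype.card_pos_iff.2 ⟨j⟩) one_pos

/-- The rows `κ` meet the columns `ι` and `j` in a zero block whose dimensions add up to more than
the size of `N`. Such a hollow matrix factors through `ι ⊕ (κ \ {j})`, so it is not full. -/
theorem sing_of_hollow (hP : IsGrPrimeMatrixIdeal 𝒜 P) (h𝒜 : IsGrading 𝒜)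
    {α β : ι ⊕ κ → G} {N : Matrix (ι ⊕ κ) (ι ⊕ κ) R} (hN : Homog 𝒜 α β N) (j : κ)
    (h0 : ∀ i k, N (Sum.inr i) (Sum.inl k) = 0) (hj : ∀ i, N (Sum.inr i) (Sum.inr j) = 0) :
    Sing P N := by
  let X : Matrix (ι ⊕ κ) (ι ⊕ {k // k ≠ j}) R := Matrix.of fun i r =>
    r.elim (fun r => if i = Sum.inl r then 1 else 0) fun k => N i (Sum.inr k.1)
  let Y : Matrix (ι ⊕ {k // k ≠ j}) (ι ⊕ κ) R := Matrix.of fun r k =>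
    r.elim (fun r => k.elim (fun k => N (Sum.inl r) (Sum.inl k))
      fun k => if k = j then N (Sum.inl r) (Sum.inr k) else 0)
      fun r => if k = Sum.inr r.1 then 1 else 0
  have e : X * Y = N := by
    ext i k
    rw [Matrix.mul_apply, Fintype.sum_sum_type]
    simp only [X, Y, Matrix.of_apply, Sum.elim_inl, Sum.elim_inr]
    rcases k with k | k
    · rcases i with i | i
      · simp
      · simp [h0]
    · by_cases hk : k = j
      · subst hk
        have : ∀ r : {k' // k' ≠ k}, k ≠ r := fun r h => r.2 h.symm
        rcases i with i | i
        · simp [this]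
        · simp [this, hj]
      · simp only [Sum.elim_inr, if_neg hk, mul_zero, Finset.sum_const_zero, zero_add]
        rw [Finset.sum_eq_single ⟨k, hk⟩]
        · simp
        · rintro ⟨k', hk'⟩ - hne
          rw [if_neg (fun h => hne (Subtype.ext (Sum.inr_injective h).symm)), mul_zero]
        · simp
  rw [← e]
  refine hP.sing_of_factor (X := X) (Y := Y) (α := α) (β := β)
    (l := Sum.elim (fun i => α (Sum.inl i)) fun k => β (Sum.inr k.1)) ?_ ?_
    (by rw [e]; exact hN) rfl ?_
  · rintro i (r | r)
    · simp only [X, Matrix.of_apply, Sum.elim_inl]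
      split_ifs with h
      · subst h; simpa using h𝒜.one_mem
      · exact zero_mem _
    · exact hN _ _
  · rintro (r | r) k
    · rcases k with k | k
      · exact hN _ _
      · simp only [Y, Matrix.of_apply, Sum.elim_inl, Sum.elim_inr]
        split_ifs
        exacts [hN _ _, zero_mem _]
    · simp only [Y, Matrix.of_apply, Sum.elim_inr]
      split_ifs with h
      · subst h; simpa using h𝒜.one_mem
      · exact zero_mem _
  · rw [Fintype.card_sum, Fintype.card_sum, Fintype.card_subtype_compl, Fintype.card_subtype_eq]
    have := Fintype.card_pos_iff.2 ⟨j⟩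
    omega

variable {α β : ι → G} {γ δ : κ → G} {A : Matrix ι ι R} {B : Matrix κ κ R} {C : Matrix ι κ R}

theorem sing_fromBlocks_diagonal_left (hP : IsGrPrimeMatrixIdeal 𝒜 P) (hB : Homog 𝒜 γ δ B)
    (h : Sing P A) : Sing P (Matrix.fromBlocks A 0 0 B) := by
  obtain ⟨n, e, f, h⟩ := h
  let k := Fintype.equivFin κ
  have := hP.diagSum_mem _ h ⟨_, B.submatrix k.symm k.symm⟩ ⟨_, _, hB.submatrix _ _⟩
  refine ⟨_, (Equiv.sumCongr e k).trans finSumFinEquiv, (Equiv.sumCongr f k).trans finSumFinEquiv,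
    ?_⟩
  convert this using 1
  rw [diagSum]
  congr 1
  rw [Matrix.reindex_apply]
  ext i j
  obtain ⟨i, rfl⟩ := finSumFinEquiv.surjective i
  obtain ⟨j, rfl⟩ := finSumFinEquiv.surjective j
  rcases i with i | i <;> rcases j with j | j <;> simp

theorem sing_fromBlocks_diagonal (hP : IsGrPrimeMatrixIdeal 𝒜 P) (hA : Homog 𝒜 α β A)
    (hB : Homog 𝒜 γ δ B) : Sing P (Matrix.fromBlocks A 0 0 B) ↔ Sing P A ∨ Sing P B := by
  constructor
  · intro h
    let e := Fintype.equivFin ι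
    let k := Fintype.equivFin κ
    rw [hP.sing_iff ((Equiv.sumCongr e k).trans finSumFinEquiv)
      ((Equiv.sumCongr e k).trans finSumFinEquiv)] at h
    refine (hP.mem_or_mem ⟨_, A.submatrix e.symm e.symm⟩ ⟨_, _, hA.submatrix _ _⟩
      ⟨_, B.submatrix k.symm k.symm⟩ ⟨_, _, hB.submatrix _ _⟩ ?_).imp
      (fun h => ⟨_, e, e, h⟩) fun h => ⟨_, k, k, h⟩
    convert h using 1
    rw [diagSum]
    congr 1
    rw [Matrix.reindex_apply]
    ext i j
    obtain ⟨i, rfl⟩ := finSumFinEquiv.surjective i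
    obtain ⟨j, rfl⟩ := finSumFinEquiv.surjective j
    rcases i with i | i <;> rcases j with j | j <;> simp
  · rintro (h | h)
    · exact hP.sing_fromBlocks_diagonal_left hB h
    · have := hP.sing_fromBlocks_diagonal_left (B := A) hA h
      rw [← sing_submatrix (Equiv.sumComm _ _) (Equiv.sumComm _ _)] at this
      convert this using 1
      ext i j
      rcases i with i | i <;> rcases j with j | j <;> simp

/-- The block `F` is added one column at a time. Each time the matrix being added has a column with
zero lower part next to the zero lower-left block, so it is hollow. -/
theorem sing_fromBlocks_upper_add (hP : IsGrPrimeMatrixIdeal 𝒜 P) (h𝒜 : IsGrading 𝒜)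
    (hA : Homog 𝒜 α β A) (hB : Homog 𝒜 γ δ B) (hC : Homog 𝒜 α δ C) {F : Matrix ι κ R}
    (hF : Homog 𝒜 α δ F) (h : Sing P (Matrix.fromBlocks A C 0 B)) :
    Sing P (Matrix.fromBlocks A (C + F) 0 B) := by
  have hM := Homog.fromBlocks (𝒜 := 𝒜) hA hC (Homog.zero (α := γ) (β := β)) hB
  have hE := Homog.fromBlocks (𝒜 := 𝒜) (Homog.zero (α := α) (β := β)) hF
    (Homog.zero (α := γ) (β := β)) (Homog.zero (α := γ) (β := δ))
  have := hP.sing_add_of_cols hM hE ?_ h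
  · rw [Matrix.fromBlocks_add] at this
    simpa using this
  · rintro N (j | j) hN hk hj ⟨i, hi⟩
    · rcases i with i | i <;> exact (hi rfl).elim
    · refine hP.sing_of_hollow h𝒜 hN j (fun i k => ?_) (fun i => hj _)
      rcases hk (Sum.inl k) (by simp) with h | h <;> simp [h]

theorem sing_fromBlocks_upper (hP : IsGrPrimeMatrixIdeal 𝒜 P) (h𝒜 : IsGrading 𝒜)
    (hA : Homog 𝒜 α β A) (hB : Homog 𝒜 γ δ B) (hC : Homog 𝒜 α δ C) :
    Sing P (Matrix.fromBlocks A C 0 B) ↔ Sing P A ∨ Sing P B := by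
  rw [← hP.sing_fromBlocks_diagonal hA hB]
  constructor <;> intro h
  · simpa using hP.sing_fromBlocks_upper_add h𝒜 hA hB hC hC.neg h
  · simpa using hP.sing_fromBlocks_upper_add h𝒜 hA hB Homog.zero hC h

/-- Identity matrices are diagonal sums of copies of `(1)`. The empty matrix is excluded as well,
because its diagonal sum with `(1)` is `(1)`. -/
theorem not_sing_one_fin (hP : IsGrPrimeMatrixIdeal 𝒜 P) (h𝒜 : IsGrading 𝒜) (n : ℕ) :
    ¬ Sing P (1 : Matrix (Fin n) (Fin n) R) := by
  have h1 : ¬ Sing P (1 : Matrix (Fin 1) (Fin 1) R) := by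
    rw [hP.sing_mk_iff]; exact hP.one_notMem
  have hone : ∀ n, Homog 𝒜 (fun _ => 1) (fun _ => 1) (1 : Matrix (Fin n) (Fin n) R) := fun n =>
    Homog.one h𝒜.one_mem
  have hsum : ∀ m n, Sing P (1 : Matrix (Fin (m + n)) (Fin (m + n)) R) ↔
      Sing P (1 : Matrix (Fin m) (Fin m) R) ∨ Sing P (1 : Matrix (Fin n) (Fin n) R) := by
    intro m n
    rw [← hP.sing_fromBlocks_diagonal (hone m) (hone n), Matrix.fromBlocks_one,
      ← sing_submatrix finSumFinEquiv finSumFinEquiv, Matrix.submatrix_one_equiv]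
  induction n with
  | zero => exact fun h => h1 ((hsum 0 1).2 (Or.inl h))
  | succ n ih => rw [hsum]; exact not_or.2 ⟨ih, h1⟩

theorem not_sing_one (hP : IsGrPrimeMatrixIdeal 𝒜 P) (h𝒜 : IsGrading 𝒜) :
    ¬ Sing P (1 : Matrix ι ι R) := by
  let e := Fintype.equivFin ι
  rw [← sing_submatrix e.symm e.symm, Matrix.submatrix_one_equiv]
  exact hP.not_sing_one_fin h𝒜 _

theorem not_sing_of_isEmpty [IsEmpty ι] (hP : IsGrPrimeMatrixIdeal 𝒜 P) (h𝒜 : IsGrading 𝒜)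
    (A : Matrix ι ι R) : ¬ Sing P A := by
  rw [Subsingleton.elim A 1]; exact hP.not_sing_one h𝒜

/-- Block column operations link `[X, 0; 1, Y]` with `[X, -XY; 1, 0]`. Up to swapping blocks both
are triangular, the first with diagonal `X`, `Y` and the second with diagonal `-XY`, `1`. The case
`Y = 1` then allows the sign to be dropped. -/
theorem sing_neg_mul (hP : IsGrPrimeMatrixIdeal 𝒜 P) (h𝒜 : IsGrading 𝒜) {l : ι → G}
    {X Y : Matrix ι ι R} (hX : Homog 𝒜 α l X) (hY : Homog 𝒜 l β Y) :
    Sing P (-(X * Y)) ↔ Sing P X ∨ Sing P Y := by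
  have h1 : Homog 𝒜 l l (1 : Matrix ι ι R) := Homog.one h𝒜.one_mem
  have hXY : Homog 𝒜 α β (X * Y) := hX.mul h𝒜.mul_mem hY
  have e1 : Sing P (Matrix.fromBlocks X 0 (1 : Matrix ι ι R) Y) ↔ Sing P X ∨ Sing P Y := by
    rw [or_comm, ← hP.sing_fromBlocks_upper h𝒜 hY hX h1,
      ← sing_submatrix (Equiv.sumComm _ _) (Equiv.sumComm _ _)]
    exact iff_of_eq (congrArg _ (Matrix.fromBlocks_submatrix_sum_swap_sum_swap ..))
  have e2 : Sing P (Matrix.fromBlocks X (-(X * Y)) (1 : Matrix ι ι R) 0) ↔ Sing P (-(X * Y)) := by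
    rw [← (hP.sing_fromBlocks_upper h𝒜 hXY.neg h1 hX).trans
      (or_iff_left (hP.not_sing_one h𝒜)), ← sing_submatrix (Equiv.refl _) (Equiv.sumComm _ _)]
    exact iff_of_eq (congrArg _ (Matrix.fromBlocks_submatrix_sum_swap_right ..))
  rw [← e1, ← e2]
  -- Adding the first block column times `Z` to the second: each added column is a combination of
  -- the columns of the first block, so `sing_of_col_comb` applies.
  have step : ∀ (B : Matrix ι ι R) (C : Matrix ι ι R) (Z : Matrix ι ι R), Homog 𝒜 α β B →
      Homog 𝒜 l β C → Homog 𝒜 l β Z → Sing P (Matrix.fromBlocks X B 1 C) →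
      Sing P (Matrix.fromBlocks X (B + X * Z) 1 (C + Z)) := by
    intro B C Z hB hC hZ h
    have hM := Homog.fromBlocks (𝒜 := 𝒜) hX hB h1 hC
    have hE := Homog.fromBlocks (𝒜 := 𝒜) (Homog.zero (α := α) (β := l)) (hX.mul h𝒜.mul_mem hZ)
      (Homog.zero (α := l) (β := l)) hZ
    have := hP.sing_add_of_cols hM hE ?_ h
    · rw [Matrix.fromBlocks_add] at this
      simpa using this
    · rintro N (j | j) hN hk hj ⟨i, hi⟩
      · rcases i with i | i <;> exact (hi rfl).elim
      · have hN' : ∀ i k, N i (Sum.inl k) = Matrix.fromBlocks X B 1 C i (Sum.inl k) := by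
          intro i k
          rcases hk (Sum.inl k) (by simp) with h | h
          · exact h i
          · rw [h i]; rcases i with i | i <;> simp
        refine hP.sing_of_col_comb h𝒜 hN rfl (Sum.inr j) (Sum.elim (fun k => Z k j) 0) rfl ?_ ?_
        · rintro (k | k)
          · exact hZ k j
          · exact zero_mem _
        · intro i
          rw [hj, Fintype.sum_sum_type]
          simp only [hN', Sum.elim_inl, Sum.elim_inr, Pi.zero_apply, mul_zero,
            Finset.sum_const_zero, add_zero]
          rcases i with i | i
          · simp [Matrix.mul_apply]
          · simp [Matrix.one_apply]
  constructor <;> intro h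
  · simpa using step _ _ _ hXY.neg Homog.zero hY h
  · simpa using step _ _ _ Homog.zero hY hY.neg h

theorem sing_neg (hP : IsGrPrimeMatrixIdeal 𝒜 P) (h𝒜 : IsGrading 𝒜)
    {X : Matrix ι ι R} (hX : Homog 𝒜 α β X) : Sing P (-X) ↔ Sing P X := by
  have h1 : Homog 𝒜 β β (1 : Matrix ι ι R) := Homog.one h𝒜.one_mem
  have := hP.sing_neg_mul h𝒜 hX h1
  rwa [mul_one, or_iff_left (hP.not_sing_one h𝒜)] at this

/-- A product of homogeneous square matrices lies in a gr-prime matrix ideal if and only if one of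
the factors does. -/
theorem sing_mul (hP : IsGrPrimeMatrixIdeal 𝒜 P) (h𝒜 : IsGrading 𝒜) {l : ι → G}
    {X Y : Matrix ι ι R} (hX : Homog 𝒜 α l X) (hY : Homog 𝒜 l β Y) :
    Sing P (X * Y) ↔ Sing P X ∨ Sing P Y := by
  rw [← hP.sing_neg_mul h𝒜 hX hY, hP.sing_neg h𝒜 (hX.mul h𝒜.mul_mem hY)]

end IsGrPrimeMatrixIdeal

end Sing

/-! ### Elements of the localization as Schur complements. -/

/-- Data representing the element `c + f A⁻¹ x` of a localization: the entries of a row `f`, a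
square matrix `A`, a column `x` and a scalar `c`, together with degrees for the rows and columns
of `A`. -/
structure SchurDatum (G : Type v) (R : Type u) where
  index : Type
  [fintype : Fintype index]
  [decEq : DecidableEq index]
  rowDeg : index → G
  colDeg : index → G
  A : Matrix index index R
  x : Matrix index Unit R
  f : Matrix Unit index R
  c : Matrix Unit Unit R

namespace SchurDatum

attribute [instance] SchurDatum.fintype SchurDatum.decEq

variable {G : Type v} {R : Type u} [Ring R]

/-- The bordered matrix, whose Schur complement is the opposite of the represented element. -/
def mat (t : SchurDatum G R) : Matrix (t.index ⊕ Unit) (t.index ⊕ Unit) R :=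
  Matrix.fromBlocks t.A t.x t.f (-t.c)

/-- The datum represents zero modulo the matrix ideal `P`. -/
def IsNull (P : Set (SqMatrix R)) (t : SchurDatum G R) : Prop := Sing P t.mat

protected def add (t u : SchurDatum G R) : SchurDatum G R where
  index := t.index ⊕ u.index
  rowDeg := Sum.elim t.rowDeg u.rowDeg
  colDeg := Sum.elim t.colDeg u.colDeg
  A := Matrix.fromBlocks t.A 0 0 u.A
  x := Matrix.fromRows t.x u.x
  f := Matrix.fromCols t.f u.f
  c := t.c + u.c

protected def neg (t : SchurDatum G R) : SchurDatum G R where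
  index := t.index
  rowDeg := t.rowDeg
  colDeg := t.colDeg
  A := t.A
  x := -t.x
  f := t.f
  c := -t.c

/-- The upper right block `-(t.x * u.f)` contributes the cross term `t.A⁻¹ t.x u.f u.A⁻¹` to the
inverse, which completes the expansion of `(c + f A⁻¹ x) * (c' + f' A'⁻¹ x')`. -/
protected def mul (t u : SchurDatum G R) : SchurDatum G R where
  index := t.index ⊕ u.index
  rowDeg := Sum.elim t.rowDeg u.rowDeg
  colDeg := Sum.elim t.colDeg u.colDeg
  A := Matrix.fromBlocks t.A (-(t.x * u.f)) 0 u.A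
  x := Matrix.fromRows (t.x * u.c) u.x
  f := Matrix.fromCols t.f (t.c * u.f)
  c := t.c * u.c

/-- The datum of an element of the ring. -/
def const (r : R) : SchurDatum G R where
  index := Empty
  rowDeg := Empty.elim
  colDeg := Empty.elim
  A := 0
  x := 0
  f := 0
  c := Matrix.of fun _ _ => r

/-- The same datum, with all degrees multiplied on the right. -/
def shift [Group G] (t : SchurDatum G R) (g : G) : SchurDatum G R where
  index := t.index
  rowDeg := fun i => t.rowDeg i * g
  colDeg := fun i => t.colDeg i * g
  A := t.A
  x := t.x
  f := t.f
  c := t.c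

/-- The datum of the inverse of a represented element. -/
def inv (t : SchurDatum G R) (a b : G) : SchurDatum G R where
  index := t.index ⊕ Unit
  rowDeg := Sum.elim t.rowDeg fun _ => a
  colDeg := Sum.elim t.colDeg fun _ => b
  A := t.mat
  x := Matrix.fromRows 0 1
  -- The last diagonal entry of the inverse of `t.mat` is the inverse of the Schur complement, which
  -- is the opposite of the element; hence the sign.
  f := Matrix.fromCols 0 (-1)
  c := 0

@[simp] theorem neg_neg (t : SchurDatum G R) : t.neg.neg = t := by
  change SchurDatum.mk t.index t.rowDeg t.colDeg t.A (- -t.x) t.f (- -t.c) = t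
  rw [_root_.neg_neg, _root_.neg_neg]

theorem neg_add (t u : SchurDatum G R) : (t.add u).neg = t.neg.add u.neg := by
  have hx : -Matrix.fromRows t.x u.x = Matrix.fromRows (-t.x) (-u.x) := by
    ext (i | i) j <;> simp
  change SchurDatum.mk (t.index ⊕ u.index) _ _ _ (-Matrix.fromRows t.x u.x) _ (-(t.c + u.c)) = _
  rw [hx, _root_.neg_add]
  rfl

theorem isNull_add_iff {P : Set (SqMatrix R)} {t u : SchurDatum G R} : (t.add u).IsNull P ↔
    Sing P (Matrix.fromBlocks (Matrix.fromBlocks t.A 0 0 u.A) (Matrix.fromRows t.x u.x)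
      (Matrix.fromCols t.f u.f) (-(t.c + u.c))) := Iff.rfl

theorem isNull_sub_iff {P : Set (SqMatrix R)} {t u : SchurDatum G R} : (t.add u.neg).IsNull P ↔
    Sing P (Matrix.fromBlocks (Matrix.fromBlocks t.A 0 0 u.A) (Matrix.fromRows t.x (-u.x))
      (Matrix.fromCols t.f u.f) (-(t.c + -u.c))) := Iff.rfl

theorem isNull_mul_iff {P : Set (SqMatrix R)} {t u : SchurDatum G R} : (t.mul u).IsNull P ↔
    Sing P (Matrix.fromBlocks (Matrix.fromBlocks t.A (-(t.x * u.f)) 0 u.A)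
      (Matrix.fromRows (t.x * u.c) u.x) (Matrix.fromCols t.f (t.c * u.f)) (-(t.c * u.c))) :=
  Iff.rfl

theorem isNull_add_add_iff {P : Set (SqMatrix R)} {t u s r : SchurDatum G R} :
    ((t.add u).add (s.add r)).IsNull P ↔
    Sing P (Matrix.fromBlocks
      (Matrix.fromBlocks (Matrix.fromBlocks t.A 0 0 u.A) 0 0 (Matrix.fromBlocks s.A 0 0 r.A))
      (Matrix.fromRows (Matrix.fromRows t.x u.x) (Matrix.fromRows s.x r.x))
      (Matrix.fromCols (Matrix.fromCols t.f u.f) (Matrix.fromCols s.f r.f))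
      (-((t.c + u.c) + (s.c + r.c)))) := Iff.rfl

section

variable [Group G] {𝒜 : G → AddSubgroup R} {P : Set (SqMatrix R)} {a b d : G}

/-- The represented element is homogeneous of degree `a * b⁻¹`. -/
structure IsHomog (𝒜 : G → AddSubgroup R) (a b : G) (t : SchurDatum G R) : Prop where
  A : Homog 𝒜 t.rowDeg t.colDeg t.A
  x : Homog 𝒜 t.rowDeg (fun _ => b) t.x
  f : Homog 𝒜 (fun _ => a) t.colDeg t.f
  c : Homog 𝒜 (fun _ => a) (fun _ => b) t.c

namespace IsHomog

variable {t u : SchurDatum G R}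

theorem mat (ht : t.IsHomog 𝒜 a b) :
    Homog 𝒜 (Sum.elim t.rowDeg fun _ => a) (Sum.elim t.colDeg fun _ => b) t.mat :=
  Homog.fromBlocks ht.A ht.x ht.f ht.c.neg

theorem add (ht : t.IsHomog 𝒜 a b) (hu : u.IsHomog 𝒜 a b) : (t.add u).IsHomog 𝒜 a b :=
  ⟨Homog.fromBlocks ht.A Homog.zero Homog.zero hu.A, Homog.fromRows ht.x hu.x,
    Homog.fromCols ht.f hu.f, ht.c.add hu.c⟩

theorem neg (ht : t.IsHomog 𝒜 a b) : t.neg.IsHomog 𝒜 a b :=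
  ⟨ht.A, ht.x.neg, ht.f, ht.c.neg⟩

theorem mul (h𝒜 : IsGrading 𝒜) (ht : t.IsHomog 𝒜 a b) (hu : u.IsHomog 𝒜 b d) :
    (t.mul u).IsHomog 𝒜 a d :=
  ⟨Homog.fromBlocks ht.A (ht.x.mul h𝒜.mul_mem hu.f).neg Homog.zero hu.A,
    Homog.fromRows (ht.x.mul h𝒜.mul_mem hu.c) hu.x,
    Homog.fromCols ht.f (ht.c.mul h𝒜.mul_mem hu.f), ht.c.mul h𝒜.mul_mem hu.c⟩

theorem const {r : R} (hr : r ∈ 𝒜 (a * b⁻¹)) : (SchurDatum.const r).IsHomog 𝒜 a b :=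
  ⟨Homog.zero, Homog.zero, Homog.zero, fun _ _ => hr⟩

theorem shift (ht : t.IsHomog 𝒜 a b) (g : G) : (t.shift g).IsHomog 𝒜 (a * g) (b * g) :=
  ⟨ht.A.of_right_mul g, ht.x.of_right_mul g, ht.f.of_right_mul g, ht.c.of_right_mul g⟩

theorem inv (h𝒜 : IsGrading 𝒜) (ht : t.IsHomog 𝒜 a b) : (t.inv a b).IsHomog 𝒜 b a :=
  ⟨ht.mat, Homog.fromRows Homog.zero (Homog.one (α := fun _ => a) h𝒜.one_mem),
    Homog.fromCols Homog.zero (Homog.one (α := fun _ => b) h𝒜.one_mem).neg, Homog.zero⟩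

end IsHomog

/-- The equivalence that exchanges the second and third summands. -/
def sumRightComm (ι κ μ : Type*) : (ι ⊕ κ) ⊕ μ ≃ (ι ⊕ μ) ⊕ κ :=
  (Equiv.sumAssoc ι κ μ).trans
    ((Equiv.sumCongr (Equiv.refl ι) (Equiv.sumComm κ μ)).trans (Equiv.sumAssoc ι μ κ).symm)

section Bordered

variable {ι κ : Type} [Fintype ι] [Fintype κ] [DecidableEq ι] [DecidableEq κ]
  {α β : ι → G} {γ δ : κ → G} {A : Matrix ι ι R} {B : Matrix κ κ R}
  {f : Matrix Unit ι R} {g : Matrix Unit κ R} {e : Matrix Unit Unit R}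

/-- Moving `B` to the end makes the matrix block triangular, with the bordered matrix of `A` and `B`
on the diagonal. -/
theorem sing_bordered_left (hP : IsGrPrimeMatrixIdeal 𝒜 P) (h𝒜 : IsGrading 𝒜)
    {x : Matrix ι Unit R} (hA : Homog 𝒜 α β A) (hB : Homog 𝒜 γ δ B)
    (hx : Homog 𝒜 α (fun _ => b) x) (hf : Homog 𝒜 (fun _ => a) β f)
    (hg : Homog 𝒜 (fun _ => a) δ g) (he : Homog 𝒜 (fun _ => a) (fun _ => b) e) :
    Sing P (Matrix.fromBlocks (Matrix.fromBlocks A 0 0 B) (Matrix.fromRows x 0)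
      (Matrix.fromCols f g) e) ↔ Sing P (Matrix.fromBlocks A x f e) ∨ Sing P B := by
  rw [← hP.sing_fromBlocks_upper h𝒜 (Homog.fromBlocks hA hx hf he) hB
    (Homog.fromRows Homog.zero hg)]
  refine Sing.of_submatrix_eq (sumRightComm _ _ _) (sumRightComm _ _ _) ?_
  rintro ((i | i) | i) ((j | j) | j) <;> simp [sumRightComm]

theorem sing_bordered_right (hP : IsGrPrimeMatrixIdeal 𝒜 P) (h𝒜 : IsGrading 𝒜)
    {y : Matrix κ Unit R} (hA : Homog 𝒜 α β A) (hB : Homog 𝒜 γ δ B)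
    (hy : Homog 𝒜 γ (fun _ => b) y) (hf : Homog 𝒜 (fun _ => a) β f)
    (hg : Homog 𝒜 (fun _ => a) δ g) (he : Homog 𝒜 (fun _ => a) (fun _ => b) e) :
    Sing P (Matrix.fromBlocks (Matrix.fromBlocks A 0 0 B) (Matrix.fromRows 0 y)
      (Matrix.fromCols f g) e) ↔ Sing P (Matrix.fromBlocks B y g e) ∨ Sing P A := by
  rw [← sing_bordered_left hP h𝒜 hB hA hy hg hf he]
  refine Sing.of_submatrix_eq (Equiv.sumCongr (Equiv.sumComm _ _) (Equiv.refl _))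
    (Equiv.sumCongr (Equiv.sumComm _ _) (Equiv.refl _)) ?_
  rintro ((i | i) | i) ((j | j) | j) <;> simp

end Bordered

variable {t u s t' u' : SchurDatum G R}

theorem isNull_neg (hP : IsGrPrimeMatrixIdeal 𝒜 P) (h𝒜 : IsGrading 𝒜)
    (ht : t.IsHomog 𝒜 a b) : t.neg.IsNull P ↔ t.IsNull P := by
  have h1 : Homog 𝒜 (Sum.elim t.colDeg fun _ => b) (Sum.elim t.colDeg fun _ => b)
      (Matrix.fromBlocks 1 0 0 (-1) : Matrix (t.index ⊕ Unit) (t.index ⊕ Unit) R) :=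
    Homog.fromBlocks (Homog.one h𝒜.one_mem) Homog.zero Homog.zero
      (Homog.one (α := fun _ => b) h𝒜.one_mem).neg
  have e : Matrix.fromBlocks t.A (-t.x) t.f (- -t.c) = t.mat * Matrix.fromBlocks 1 0 0 (-1) := by
    simp [mat, Matrix.fromBlocks_multiply]
  have hne : ¬ Sing P (Matrix.fromBlocks 1 0 0 (-1) :
      Matrix (t.index ⊕ Unit) (t.index ⊕ Unit) R) := by
    rw [hP.sing_fromBlocks_diagonal (Homog.one (α := t.colDeg) h𝒜.one_mem)
      (Homog.one (α := fun _ => b) h𝒜.one_mem).neg,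
      hP.sing_neg h𝒜 (Homog.one (α := fun _ => b) h𝒜.one_mem)]
    simp [hP.not_sing_one h𝒜]
  change Sing P (Matrix.fromBlocks t.A (-t.x) t.f (- -t.c)) ↔ Sing P t.mat
  rw [e]
  exact (hP.sing_mul h𝒜 ht.mat h1).trans (or_iff_left hne)

theorem isNull_add_comm : (t.add u).IsNull P ↔ (u.add t).IsNull P := by
  rw [isNull_add_iff, isNull_add_iff]
  refine Sing.of_submatrix_eq (Equiv.sumCongr (Equiv.sumComm _ _) (Equiv.refl _))
    (Equiv.sumCongr (Equiv.sumComm _ _) (Equiv.refl _)) ?_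
  rintro ((i | i) | i) ((j | j) | j) <;> simp [add_comm]

theorem isNull_add_add_add_comm {t u s r : SchurDatum G R} :
    ((t.add u).add (s.add r)).IsNull P ↔ ((t.add s).add (u.add r)).IsNull P := by
  rw [isNull_add_add_iff, isNull_add_add_iff]
  refine Sing.of_submatrix_eq (Equiv.sumCongr (Equiv.sumSumSumComm _ _ _ _) (Equiv.refl _))
    (Equiv.sumCongr (Equiv.sumSumSumComm _ _ _ _) (Equiv.refl _)) ?_
  rintro (((i | i) | (i | i)) | i) (((j | j) | (j | j)) | j) <;>
    simp; try abel

/-- The bordered matrix of the sum is a determinantal sum in its last column: one summand carries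
only `t.x` and `t.c`, the other only `u.x` and `u.c`. -/
theorem IsNull.add (hP : IsGrPrimeMatrixIdeal 𝒜 P) (h𝒜 : IsGrading 𝒜)
    (ht : t.IsHomog 𝒜 a b) (hu : u.IsHomog 𝒜 a b) (ht0 : t.IsNull P) (hu0 : u.IsNull P) :
    (t.add u).IsNull P := by
  rw [isNull_add_iff]
  have hD := Homog.fromBlocks (𝒜 := 𝒜) ht.A Homog.zero Homog.zero hu.A
  have hF := Homog.fromCols ht.f hu.f
  refine hP.sing_of_col_sum
    (Homog.fromBlocks hD (Homog.fromRows ht.x Homog.zero) hF ht.c.neg)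
    (Homog.fromBlocks hD (Homog.fromRows Homog.zero hu.x) hF hu.c.neg) (Sum.inr ()) ?_ ?_ ?_
    ((sing_bordered_left hP h𝒜 ht.A hu.A ht.x ht.f hu.f ht.c.neg).2 (Or.inl ht0))
    ((sing_bordered_right hP h𝒜 ht.A hu.A hu.x ht.f hu.f hu.c.neg).2 (Or.inl hu0))
  · rintro ((i | i) | i) ((j | j) | j) h <;> simp at h ⊢
  · rintro ((i | i) | i) ((j | j) | j) h <;> simp at h ⊢
  · rintro ((i | i) | i) <;> simp [add_comm]

/-- Cancellation: a determinantal sum removes the contribution of `u` from the last column, leaving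
a triangular matrix with `t.mat` and `u.A` on the diagonal; since `u.A` is not in `P`, primeness
puts `t.mat` there. -/
theorem IsNull.of_add (hP : IsGrPrimeMatrixIdeal 𝒜 P) (h𝒜 : IsGrading 𝒜)
    (ht : t.IsHomog 𝒜 a b) (hu : u.IsHomog 𝒜 a b) (huA : ¬ Sing P u.A)
    (h : (t.add u).IsNull P) (hu0 : u.IsNull P) : t.IsNull P := by
  rw [isNull_add_iff] at h
  have hD := Homog.fromBlocks (𝒜 := 𝒜) ht.A Homog.zero Homog.zero hu.A
  have hF := Homog.fromCols ht.f hu.f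
  refine ((sing_bordered_left hP h𝒜 ht.A hu.A ht.x ht.f hu.f ht.c.neg).1 ?_).resolve_right huA
  refine hP.sing_of_col_sum
    (Homog.fromBlocks hD (Homog.fromRows ht.x hu.x) hF (ht.c.add hu.c).neg)
    (Homog.fromBlocks hD (Homog.fromRows Homog.zero hu.x.neg) hF hu.c.neg.neg) (Sum.inr ()) ?_ ?_ ?_
    h ((sing_bordered_right hP h𝒜 ht.A hu.A hu.x.neg ht.f hu.f hu.c.neg.neg).2
      (Or.inl ((isNull_neg hP h𝒜 hu).2 hu0)))
  · rintro ((i | i) | i) ((j | j) | j) h <;> simp at h ⊢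
  · rintro ((i | i) | i) ((j | j) | j) h <;> simp at h ⊢
  · rintro ((i | i) | i) <;> simp

/-- The bordered matrix of the product is the product of the two bordered matrices, enlarged by
identity blocks and up to sign. By primeness, homogeneous elements have no zero divisors. -/
theorem isNull_mul (hP : IsGrPrimeMatrixIdeal 𝒜 P) (h𝒜 : IsGrading 𝒜)
    (ht : t.IsHomog 𝒜 a b) (hu : u.IsHomog 𝒜 b d) :
    (t.mul u).IsNull P ↔ t.IsNull P ∨ u.IsNull P := by
  have h1 : Homog 𝒜 u.rowDeg u.rowDeg (1 : Matrix u.index u.index R) := Homog.one h𝒜.one_mem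
  have h1' : Homog 𝒜 t.colDeg t.colDeg (1 : Matrix t.index t.index R) := Homog.one h𝒜.one_mem
  have hb : Homog 𝒜 (fun _ => b) (fun _ => b) (1 : Matrix Unit Unit R) := Homog.one h𝒜.one_mem
  have hN1 : Homog 𝒜 (Sum.elim u.rowDeg fun _ => b) (Sum.elim u.rowDeg fun _ => b)
      (Matrix.fromBlocks 1 0 0 (-1) : Matrix (u.index ⊕ Unit) (u.index ⊕ Unit) R) :=
    Homog.fromBlocks h1 Homog.zero Homog.zero hb.neg
  have e : Matrix.fromBlocks (Matrix.fromBlocks t.A (-(t.x * u.f)) 0 u.A)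
      (Matrix.fromRows (t.x * u.c) u.x) (Matrix.fromCols t.f (t.c * u.f)) (-(t.c * u.c)) =
      Matrix.fromBlocks (Matrix.fromBlocks t.A 0 0 1) (Matrix.fromRows t.x 0)
        (Matrix.fromCols t.f 0) (-t.c) *
      Matrix.fromBlocks (Matrix.fromBlocks 1 0 0 u.A) (Matrix.fromRows 0 u.x)
        (Matrix.fromCols 0 (-u.f)) u.c := by
    rw [Matrix.fromBlocks_multiply, Matrix.fromBlocks_multiply, Matrix.fromRows_mul_fromCols,
      Matrix.fromBlocks_mul_fromRows, Matrix.fromCols_mul_fromBlocks, Matrix.fromRows_mul,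
      Matrix.mul_fromCols, Matrix.fromCols_mul_fromRows, Matrix.fromBlocks_add]
    ext ((i | i) | i) ((j | j) | j) <;> simp
  have e2 : Matrix.fromBlocks u.A u.x (-u.f) u.c = Matrix.fromBlocks 1 0 0 (-1) * u.mat := by
    simp [mat, Matrix.fromBlocks_multiply]
  have hne : ¬ Sing P (Matrix.fromBlocks 1 0 0 (-1) :
      Matrix (u.index ⊕ Unit) (u.index ⊕ Unit) R) := by
    rw [hP.sing_fromBlocks_diagonal h1 hb.neg, hP.sing_neg h𝒜 hb]
    simp [hP.not_sing_one h𝒜]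
  change _ ↔ Sing P t.mat ∨ Sing P u.mat
  rw [isNull_mul_iff, e, hP.sing_mul h𝒜
    (Homog.fromBlocks (Homog.fromBlocks ht.A Homog.zero Homog.zero h1)
      (Homog.fromRows ht.x Homog.zero) (Homog.fromCols ht.f Homog.zero) ht.c.neg)
    (Homog.fromBlocks (Homog.fromBlocks h1' Homog.zero Homog.zero hu.A)
      (Homog.fromRows Homog.zero hu.x) (Homog.fromCols Homog.zero hu.f.neg) hu.c),
    sing_bordered_left hP h𝒜 ht.A h1 ht.x ht.f Homog.zero ht.c.neg,
    sing_bordered_right hP h𝒜 h1' hu.A hu.x Homog.zero hu.f.neg hu.c,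
    or_iff_left (hP.not_sing_one h𝒜), or_iff_left (hP.not_sing_one h𝒜), e2,
    hP.sing_mul h𝒜 hN1 hu.mat, or_iff_right hne]
  rfl

/-- Matrices intertwining two data, up to a homotopy `(p, q)`, show that they represent the same
element. -/
theorem isNull_add_neg_of_intertwine (hP : IsGrPrimeMatrixIdeal 𝒜 P) (h𝒜 : IsGrading 𝒜)
    (ht : t.IsHomog 𝒜 a b) (ht' : t'.IsHomog 𝒜 a b)
    {X Y : Matrix t'.index t.index R} {p : Matrix Unit t.index R} {q : Matrix t'.index Unit R}
    (hX : Homog 𝒜 t'.rowDeg t.rowDeg X) (hY : Homog 𝒜 t'.colDeg t.colDeg Y)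
    (hp : Homog 𝒜 (fun _ => a) t.rowDeg p) (hq : Homog 𝒜 t'.colDeg (fun _ => b) q)
    (hA : X * t.A = t'.A * Y) (hf : t.f = t'.f * Y + p * t.A) (hx : t'.x = X * t.x + t'.A * q)
    (hc : t'.c = t.c + p * t.x - t'.f * q) : (t.add t'.neg).IsNull P := by
  -- The bordered matrix of `t - t'` has size `|t| + |t'| + 1`, but the intertwining relations
  -- factor it through size `|t| + |t'|`.
  have e : Matrix.fromBlocks (Matrix.fromBlocks t.A 0 0 t'.A) (Matrix.fromRows t.x (-t'.x))
      (Matrix.fromCols t.f t'.f) (-(t.c + -t'.c)) =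
      Matrix.fromRows (Matrix.fromBlocks 1 0 (-X) t'.A) (Matrix.fromCols p t'.f) *
      Matrix.fromCols (Matrix.fromBlocks t.A 0 Y 1) (Matrix.fromRows t.x (-q)) := by
    rw [Matrix.fromRows_mul_fromCols, Matrix.fromBlocks_multiply, Matrix.fromBlocks_mul_fromRows,
      Matrix.fromCols_mul_fromBlocks, Matrix.fromCols_mul_fromRows]
    rw [Matrix.fromBlocks_inj]
    refine ⟨?_, ?_, ?_, ?_⟩
    · simp [hA]
    · simp [hx, add_comm]
    · simp [hf, add_comm]
    · rw [hc, Matrix.mul_neg]; abel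
  have hN := Homog.fromBlocks (Homog.fromBlocks ht.A Homog.zero Homog.zero ht'.A)
    (Homog.fromRows ht.x ht'.x.neg) (Homog.fromCols ht.f ht'.f) (ht.c.add ht'.c.neg).neg
  rw [isNull_sub_iff]
  rw [e] at hN ⊢
  refine hP.sing_of_factor (l := Sum.elim t.rowDeg t'.colDeg)
    (Homog.fromRows (Homog.fromBlocks (Homog.one h𝒜.one_mem) Homog.zero hX.neg ht'.A)
      (Homog.fromCols hp ht'.f))
    (Homog.fromCols (Homog.fromBlocks ht.A Homog.zero hY (Homog.one h𝒜.one_mem))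
      (Homog.fromRows ht.x hq.neg)) hN rfl ?_
  rw [Fintype.card_sum, Fintype.card_sum, Fintype.card_sum]
  exact Nat.lt_succ_self _

theorem isNull_add_neg_of_equiv (hP : IsGrPrimeMatrixIdeal 𝒜 P) (h𝒜 : IsGrading 𝒜)
    (ht : t.IsHomog 𝒜 a b) (ht' : t'.IsHomog 𝒜 a b) (e : t.index ≃ t'.index)
    (hrow : ∀ i, t'.rowDeg (e i) = t.rowDeg i) (hcol : ∀ i, t'.colDeg (e i) = t.colDeg i)
    (hA : ∀ i j, t'.A (e i) (e j) = t.A i j) (hf : ∀ i j, t'.f i (e j) = t.f i j)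
    (hx : ∀ i j, t'.x (e i) j = t.x i j) (hc : t'.c = t.c) : (t.add t'.neg).IsNull P := by
  let X : Matrix t'.index t.index R := (1 : Matrix t'.index t'.index R).submatrix id e
  have hX : ∀ d d' : t'.index → G, (∀ i, d i = d' i) → Homog 𝒜 d (d' ∘ e) X := by
    intro d d' h
    obtain rfl : d = d' := funext h
    exact (Homog.one (α := d) h𝒜.one_mem).submatrix id e
  have hrow' : t'.rowDeg ∘ e = t.rowDeg := funext hrow
  have hcol' : t'.colDeg ∘ e = t.colDeg := funext hcol
  refine isNull_add_neg_of_intertwine hP h𝒜 ht ht' (X := X) (Y := X) (p := 0) (q := 0)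
    (hrow' ▸ hX _ _ fun _ => rfl) (hcol' ▸ hX _ _ fun _ => rfl) Homog.zero Homog.zero ?_ ?_ ?_ ?_
  · ext i j
    obtain ⟨i, rfl⟩ := e.surjective i
    simp [X, Matrix.mul_apply, Matrix.one_apply, ← hA]
  · ext i j
    simp [X, Matrix.mul_apply, Matrix.one_apply, ← hf]
  · ext i j
    obtain ⟨i, rfl⟩ := e.surjective i
    simp [X, Matrix.mul_apply, Matrix.one_apply, hx]
  · simp [hc]

end

end SchurDatum

/-! ### Ring identities up to equivalence of data. -/

namespace SchurDatum

variable {G : Type v} {R : Type u} [Ring R] [Group G] {𝒜 : G → AddSubgroup R}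
  {P : Set (SqMatrix R)} {a b d g h : G} {t u s t' u' : SchurDatum G R}

/-- A homogeneous datum whose matrix does not lie in the matrix ideal. -/
structure IsAdmissible (𝒜 : G → AddSubgroup R) (P : Set (SqMatrix R)) (a b : G)
    (t : SchurDatum G R) : Prop extends t.IsHomog 𝒜 a b where
  notSing : ¬ Sing P t.A

namespace IsAdmissible

theorem add (hP : IsGrPrimeMatrixIdeal 𝒜 P) (ht : t.IsAdmissible 𝒜 P a b)
    (hu : u.IsAdmissible 𝒜 P a b) : (t.add u).IsAdmissible 𝒜 P a b := by
  refine ⟨ht.toIsHomog.add hu.toIsHomog, ?_⟩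
  change ¬ Sing P (Matrix.fromBlocks t.A 0 0 u.A)
  rw [hP.sing_fromBlocks_diagonal ht.A hu.A]
  exact not_or.2 ⟨ht.notSing, hu.notSing⟩

theorem neg (ht : t.IsAdmissible 𝒜 P a b) : t.neg.IsAdmissible 𝒜 P a b :=
  ⟨ht.toIsHomog.neg, ht.notSing⟩

theorem mul (hP : IsGrPrimeMatrixIdeal 𝒜 P) (h𝒜 : IsGrading 𝒜) (ht : t.IsAdmissible 𝒜 P a b)
    (hu : u.IsAdmissible 𝒜 P b d) : (t.mul u).IsAdmissible 𝒜 P a d := by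
  refine ⟨ht.toIsHomog.mul h𝒜 hu.toIsHomog, ?_⟩
  change ¬ Sing P (Matrix.fromBlocks t.A (-(t.x * u.f)) 0 u.A)
  rw [hP.sing_fromBlocks_upper h𝒜 ht.A hu.A (ht.x.mul h𝒜.mul_mem hu.f).neg]
  exact not_or.2 ⟨ht.notSing, hu.notSing⟩

theorem const (hP : IsGrPrimeMatrixIdeal 𝒜 P) (h𝒜 : IsGrading 𝒜) {r : R}
    (hr : r ∈ 𝒜 (a * b⁻¹)) : (SchurDatum.const (G := G) r).IsAdmissible 𝒜 P a b :=
  ⟨IsHomog.const hr, hP.not_sing_of_isEmpty (ι := Empty) h𝒜 0⟩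

theorem shift (ht : t.IsAdmissible 𝒜 P a b) (g : G) :
    (t.shift g).IsAdmissible 𝒜 P (a * g) (b * g) :=
  ⟨ht.toIsHomog.shift g, ht.notSing⟩

theorem inv (h𝒜 : IsGrading 𝒜) (ht : t.IsAdmissible 𝒜 P a b) (h0 : ¬ t.IsNull P) :
    (t.inv a b).IsAdmissible 𝒜 P b a :=
  ⟨ht.toIsHomog.inv h𝒜, h0⟩

end IsAdmissible

/-- Two data represent the same element. -/
def Equivalent (P : Set (SqMatrix R)) (t u : SchurDatum G R) : Prop := (t.add u.neg).IsNull P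

section

variable (hP : IsGrPrimeMatrixIdeal 𝒜 P) (h𝒜 : IsGrading 𝒜)

include hP h𝒜

theorem Equivalent.refl (ht : t.IsHomog 𝒜 a b) : Equivalent P t t :=
  isNull_add_neg_of_equiv hP h𝒜 ht ht (Equiv.refl _) (fun _ => rfl) (fun _ => rfl)
    (fun _ _ => rfl) (fun _ _ => rfl) (fun _ _ => rfl) rfl

theorem Equivalent.symm (ht : t.IsHomog 𝒜 a b) (hu : u.IsHomog 𝒜 a b) (h : Equivalent P t u) :
    Equivalent P u t := by
  have := (isNull_neg hP h𝒜 (ht.add hu.neg)).2 h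
  rw [neg_add, neg_neg] at this
  exact isNull_add_comm.1 this

theorem isNull_add_neg_self (ht : t.IsHomog 𝒜 a b) : (t.neg.add t).IsNull P :=
  isNull_add_comm.1 (Equivalent.refl hP h𝒜 ht)

/-- Adding `t - u` and `u - s` and rearranging gives `(t - s) + (-u + u)`; the null summand is
cancelled, which requires `u` to be admissible. -/
theorem Equivalent.trans (ht : t.IsHomog 𝒜 a b) (hu : u.IsAdmissible 𝒜 P a b)
    (hs : s.IsHomog 𝒜 a b) (h : Equivalent P t u) (h' : Equivalent P u s) :
    Equivalent P t s := by
  have h1 : ((t.add u.neg).add (s.neg.add u)).IsNull P :=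
    IsNull.add hP h𝒜 (ht.add hu.neg.toIsHomog) (hs.neg.add hu.toIsHomog) h (isNull_add_comm.1 h')
  exact IsNull.of_add hP h𝒜 (ht.add hs.neg) (hu.neg.add hP hu).toIsHomog
    (hu.neg.add hP hu).notSing (isNull_add_add_add_comm.1 h1)
    (isNull_add_neg_self hP h𝒜 hu.toIsHomog)

theorem Equivalent.add (ht : t.IsHomog 𝒜 a b) (hu : u.IsHomog 𝒜 a b)
    (ht' : t'.IsHomog 𝒜 a b) (hu' : u'.IsHomog 𝒜 a b) (h : Equivalent P t t')
    (h' : Equivalent P u u') : Equivalent P (t.add u) (t'.add u') := by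
  have := IsNull.add hP h𝒜 (ht.add ht'.neg) (hu.add hu'.neg) h h'
  rw [Equivalent, neg_add]
  exact isNull_add_add_add_comm.1 this

theorem Equivalent.neg (ht : t.IsHomog 𝒜 a b) (ht' : t'.IsHomog 𝒜 a b) (h : Equivalent P t t') :
    Equivalent P t.neg t'.neg := by
  rw [Equivalent, ← neg_add]
  exact (isNull_neg hP h𝒜 (ht.add ht'.neg)).2 h

theorem equivalent_of_intertwine (ht : t.IsHomog 𝒜 a b) (ht' : t'.IsHomog 𝒜 a b)
    {X Y : Matrix t'.index t.index R} (hX : Homog 𝒜 t'.rowDeg t.rowDeg X)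
    (hY : Homog 𝒜 t'.colDeg t.colDeg Y) (hA : X * t.A = t'.A * Y) (hf : t.f = t'.f * Y)
    (hx : t'.x = X * t.x) (hc : t'.c = t.c) : Equivalent P t t' :=
  isNull_add_neg_of_intertwine hP h𝒜 ht ht' hX hY Homog.zero Homog.zero hA
    (by rw [hf, Matrix.zero_mul, _root_.add_zero]) (by rw [hx, Matrix.mul_zero, _root_.add_zero])
    (by rw [hc, Matrix.zero_mul, Matrix.mul_zero, _root_.add_zero, sub_zero])

theorem isNull_const_zero : (const (G := G) (0 : R)).IsNull P := by
  have e : (Matrix.fromBlocks 0 0 0 (-Matrix.of fun _ _ => 0) : Matrix (Empty ⊕ Unit)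
      (Empty ⊕ Unit) R) = (0 : Matrix (Empty ⊕ Unit) Empty R) *
        (0 : Matrix Empty (Empty ⊕ Unit) R) := by
    ext (i | i) (j | j) <;> first | exact i.elim | exact j.elim | simp [Matrix.mul_apply]
  change Sing P ((Matrix.fromBlocks 0 0 0 (-Matrix.of fun _ _ => 0) : Matrix (Empty ⊕ Unit)
      (Empty ⊕ Unit) R))
  rw [e]
  exact hP.sing_of_factor (α := fun _ => 1) (β := fun _ => 1) (l := fun _ => 1) Homog.zero
    Homog.zero (by rw [← e]; rintro (i | i) (j | j) <;> simp) rfl (by simp)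

theorem equivalent_const_zero_iff (ht : t.IsHomog 𝒜 a b) :
    Equivalent P t (const 0) ↔ t.IsNull P := by
  have h0 : (const (G := G) (0 : R)).IsAdmissible 𝒜 P a b :=
    IsAdmissible.const hP h𝒜 (zero_mem _)
  have hn := (isNull_neg hP h𝒜 h0.toIsHomog).2 (isNull_const_zero hP h𝒜)
  exact ⟨fun h => IsNull.of_add hP h𝒜 ht h0.neg.toIsHomog h0.neg.notSing h hn,
    fun h => IsNull.add hP h𝒜 ht h0.neg.toIsHomog h hn⟩

theorem equivalent_add_comm (ht : t.IsHomog 𝒜 a b) (hu : u.IsHomog 𝒜 a b) :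
    Equivalent P (t.add u) (u.add t) := by
  refine isNull_add_neg_of_equiv hP h𝒜 (ht.add hu) (hu.add ht) (Equiv.sumComm t.index u.index)
    ?_ ?_ ?_ ?_ ?_ (_root_.add_comm u.c t.c)
  · rintro (i | i) <;> rfl
  · rintro (i | i) <;> rfl
  · rintro (i | i) (j | j) <;> rfl
  · rintro i (j | j) <;> rfl
  · rintro (i | i) j <;> rfl

theorem equivalent_add_assoc (ht : t.IsHomog 𝒜 a b) (hu : u.IsHomog 𝒜 a b)
    (hs : s.IsHomog 𝒜 a b) : Equivalent P ((t.add u).add s) (t.add (u.add s)) := by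
  refine isNull_add_neg_of_equiv hP h𝒜 ((ht.add hu).add hs) (ht.add (hu.add hs))
    (Equiv.sumAssoc t.index u.index s.index) ?_ ?_ ?_ ?_ ?_ (_root_.add_assoc t.c u.c s.c).symm
  · rintro ((i | i) | i) <;> rfl
  · rintro ((i | i) | i) <;> rfl
  · rintro ((i | i) | i) ((j | j) | j) <;> rfl
  · rintro i ((j | j) | j) <;> rfl
  · rintro ((i | i) | i) j <;> rfl

theorem equivalent_zero_add (ht : t.IsHomog 𝒜 a b) : Equivalent P ((const 0).add t) t := by
  refine isNull_add_neg_of_equiv hP h𝒜 ((IsHomog.const (zero_mem _)).add ht) ht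
    (Equiv.emptySum Empty t.index) ?_ ?_ ?_ ?_ ?_ ?_
  · rintro (i | i); exacts [i.elim, rfl]
  · rintro (i | i); exacts [i.elim, rfl]
  · rintro (i | i) (j | j); exacts [i.elim, i.elim, j.elim, rfl]
  · rintro i (j | j); exacts [j.elim, rfl]
  · rintro (i | i) j; exacts [i.elim, rfl]
  · exact (_root_.zero_add t.c).symm

theorem equivalent_neg_add (ht : t.IsHomog 𝒜 a b) : Equivalent P (t.neg.add t) (const 0) :=
  (equivalent_const_zero_iff hP h𝒜 (ht.neg.add ht)).2 (isNull_add_neg_self hP h𝒜 ht)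

theorem equivalent_const_add {r r' : R} (hr : r ∈ 𝒜 (a * b⁻¹)) (hr' : r' ∈ 𝒜 (a * b⁻¹)) :
    Equivalent P ((const (G := G) r).add (const r')) (const (r + r')) := by
  refine isNull_add_neg_of_equiv hP h𝒜 ((IsHomog.const hr).add (IsHomog.const hr'))
    (IsHomog.const (add_mem hr hr')) (Equiv.emptySum Empty Empty) ?_ ?_ ?_ ?_ ?_ rfl
  · rintro (i | i) <;> exact i.elim
  · rintro (i | i) <;> exact i.elim
  · rintro (i | i) <;> exact i.elim
  · rintro i (j | j) <;> exact j.elim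
  · rintro (i | i) <;> exact i.elim

theorem equivalent_const_mul_const {r r' : R} (hr : r ∈ 𝒜 (a * b⁻¹)) (hr' : r' ∈ 𝒜 (b * d⁻¹)) :
    Equivalent P ((const (G := G) r).mul (const r')) (const (r * r')) := by
  refine isNull_add_neg_of_equiv hP h𝒜 ((IsHomog.const hr).mul h𝒜 (IsHomog.const hr'))
    (IsHomog.const (a := a) (b := d) ?_) (Equiv.emptySum Empty Empty) ?_ ?_ ?_ ?_ ?_ ?_
  · simpa [mul_assoc] using h𝒜.mul_mem hr hr'
  · rintro (i | i) <;> exact i.elim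
  · rintro (i | i) <;> exact i.elim
  · rintro (i | i) <;> exact i.elim
  · rintro i (j | j) <;> exact j.elim
  · rintro (i | i) <;> exact i.elim
  · ext i j
    change r * r' = ((Matrix.of fun _ _ => r) * Matrix.of fun _ _ => r' : Matrix Unit Unit R) i j
    simp [Matrix.mul_apply]

theorem equivalent_one_mul (ht : t.IsHomog 𝒜 a b) : Equivalent P ((const 1).mul t) t := by
  have h1 : (Matrix.of fun _ _ => 1 : Matrix Unit Unit R) = 1 := by ext; simp
  have h1' : (const (1 : R) : SchurDatum G R).IsHomog 𝒜 a a :=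
    IsHomog.const (by simpa using h𝒜.one_mem)
  refine isNull_add_neg_of_equiv hP h𝒜 (h1'.mul h𝒜 ht) ht
    (Equiv.emptySum Empty t.index) ?_ ?_ ?_ ?_ ?_ ?_
  · rintro (i | i); exacts [i.elim, rfl]
  · rintro (i | i); exacts [i.elim, rfl]
  · rintro (i | i) (j | j); exacts [i.elim, i.elim, j.elim, rfl]
  · rintro i (j | j)
    · exact j.elim
    · change t.f i j = ((Matrix.of fun _ _ => 1 : Matrix Unit Unit R) * t.f) i j
      rw [h1, Matrix.one_mul]
  · rintro (i | i) j; exacts [i.elim, rfl]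
  · change t.c = (Matrix.of fun _ _ => 1 : Matrix Unit Unit R) * t.c
    rw [h1, Matrix.one_mul]

theorem equivalent_mul_one (ht : t.IsHomog 𝒜 a b) : Equivalent P (t.mul (const 1)) t := by
  have h1 : (Matrix.of fun _ _ => 1 : Matrix Unit Unit R) = 1 := by ext; simp
  have h1' : (const (1 : R) : SchurDatum G R).IsHomog 𝒜 b b :=
    IsHomog.const (by simpa using h𝒜.one_mem)
  refine isNull_add_neg_of_equiv hP h𝒜 (ht.mul h𝒜 h1') ht
    (Equiv.sumEmpty t.index Empty) ?_ ?_ ?_ ?_ ?_ ?_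
  · rintro (i | i); exacts [rfl, i.elim]
  · rintro (i | i); exacts [rfl, i.elim]
  · rintro (i | i) (j | j); exacts [rfl, j.elim, i.elim, i.elim]
  · rintro i (j | j); exacts [rfl, j.elim]
  · rintro (i | i) j
    · change t.x i j = (t.x * (Matrix.of fun _ _ => 1 : Matrix Unit Unit R)) i j
      rw [h1, Matrix.mul_one]
    · exact i.elim
  · change t.c = t.c * (Matrix.of fun _ _ => 1 : Matrix Unit Unit R)
    rw [h1, Matrix.mul_one]

theorem equivalent_mul_assoc {e : G} (ht : t.IsHomog 𝒜 a b) (hu : u.IsHomog 𝒜 b d)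
    (hs : s.IsHomog 𝒜 d e) : Equivalent P ((t.mul u).mul s) (t.mul (u.mul s)) := by
  refine isNull_add_neg_of_equiv hP h𝒜 ((ht.mul h𝒜 hu).mul h𝒜 hs) (ht.mul h𝒜 (hu.mul h𝒜 hs))
    (Equiv.sumAssoc t.index u.index s.index) ?_ ?_ ?_ ?_ ?_ (Matrix.mul_assoc t.c u.c s.c).symm
  · rintro ((i | i) | i) <;> rfl
  · rintro ((i | i) | i) <;> rfl
  · rintro ((i | i) | i) ((j | j) | j)
    any_goals rfl
    change (-(t.x * (u.c * s.f))) i j = (-(t.x * u.c * s.f)) i j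
    rw [Matrix.mul_assoc]
  · rintro i ((j | j) | j)
    any_goals rfl
    change (t.c * (u.c * s.f)) i j = (t.c * u.c * s.f) i j
    rw [Matrix.mul_assoc]
  · rintro ((i | i) | i) j
    any_goals rfl
    change (t.x * (u.c * s.c)) i j = (t.x * u.c * s.c) i j
    rw [Matrix.mul_assoc]

/-- The right side contains two copies of `u`, the left side one; the intertwiner `X` is the
diagonal map on that block. -/
theorem equivalent_add_mul (ht : t.IsHomog 𝒜 a b) (ht' : t'.IsHomog 𝒜 a b)
    (hu : u.IsHomog 𝒜 b d) :
    Equivalent P ((t.add t').mul u) ((t.mul u).add (t'.mul u)) := by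
  let X : Matrix ((t.index ⊕ u.index) ⊕ (t'.index ⊕ u.index))
      ((t.index ⊕ t'.index) ⊕ u.index) R :=
    Matrix.fromRows (Matrix.fromBlocks (Matrix.fromCols 1 0) 0 0 1)
      (Matrix.fromBlocks (Matrix.fromCols 0 1) 0 0 1)
  have hX : ∀ (α : t.index → G) (β : t'.index → G) (γ : u.index → G),
      Homog 𝒜 (Sum.elim (Sum.elim α γ) (Sum.elim β γ)) (Sum.elim (Sum.elim α β) γ) X :=
    fun α β γ => Homog.fromRows
      (Homog.fromBlocks (Homog.fromCols (Homog.one h𝒜.one_mem) Homog.zero) Homog.zero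
        Homog.zero (Homog.one h𝒜.one_mem))
      (Homog.fromBlocks (Homog.fromCols Homog.zero (Homog.one h𝒜.one_mem)) Homog.zero
        Homog.zero (Homog.one h𝒜.one_mem))
  refine equivalent_of_intertwine hP h𝒜 ((ht.add ht').mul h𝒜 hu)
    ((ht.mul h𝒜 hu).add (ht'.mul h𝒜 hu)) (X := X) (Y := X)
    (hX _ _ _) (hX _ _ _) ?_ ?_ ?_ ?_
  · change X * Matrix.fromBlocks (Matrix.fromBlocks t.A 0 0 t'.A)
      (-(Matrix.fromRows t.x t'.x * u.f)) 0 u.A =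
      Matrix.fromBlocks (Matrix.fromBlocks t.A (-(t.x * u.f)) 0 u.A) 0 0
        (Matrix.fromBlocks t'.A (-(t'.x * u.f)) 0 u.A) * X
    ext ((i | i) | (i | i)) ((j | j) | j) <;>
      simp [X, Matrix.mul_apply, Fintype.sum_sum_type, Matrix.one_apply]
  · change Matrix.fromCols (Matrix.fromCols t.f t'.f) ((t.c + t'.c) * u.f) =
      Matrix.fromCols (Matrix.fromCols t.f (t.c * u.f)) (Matrix.fromCols t'.f (t'.c * u.f)) * X
    ext i ((j | j) | j) <;>
      simp [X, Matrix.mul_apply, Fintype.sum_sum_type, Matrix.one_apply, _root_.add_mul]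
  · change Matrix.fromRows (Matrix.fromRows (t.x * u.c) u.x) (Matrix.fromRows (t'.x * u.c) u.x) =
      X * Matrix.fromRows (Matrix.fromRows t.x t'.x * u.c) u.x
    ext ((i | i) | (i | i)) j <;>
      simp [X, Matrix.mul_apply, Fintype.sum_sum_type, Matrix.one_apply]
  · change t.c * u.c + t'.c * u.c = (t.c + t'.c) * u.c
    rw [Matrix.add_mul]

/-- Here two copies of `t` are merged into one, so `X` adds the corresponding coordinates. -/
theorem equivalent_mul_add (ht : t.IsHomog 𝒜 a b) (hu : u.IsHomog 𝒜 b d)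
    (hu' : u'.IsHomog 𝒜 b d) :
    Equivalent P ((t.mul u).add (t.mul u')) (t.mul (u.add u')) := by
  let X : Matrix (t.index ⊕ (u.index ⊕ u'.index))
      ((t.index ⊕ u.index) ⊕ (t.index ⊕ u'.index)) R :=
    Matrix.fromCols (Matrix.fromBlocks 1 0 0 (Matrix.fromRows 1 0))
      (Matrix.fromBlocks 1 0 0 (Matrix.fromRows 0 1))
  have hX : ∀ (α : t.index → G) (β : u.index → G) (γ : u'.index → G),
      Homog 𝒜 (Sum.elim α (Sum.elim β γ)) (Sum.elim (Sum.elim α β) (Sum.elim α γ)) X :=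
    fun α β γ => Homog.fromCols
      (Homog.fromBlocks (Homog.one h𝒜.one_mem) Homog.zero Homog.zero
        (Homog.fromRows (Homog.one h𝒜.one_mem) Homog.zero))
      (Homog.fromBlocks (Homog.one h𝒜.one_mem) Homog.zero Homog.zero
        (Homog.fromRows Homog.zero (Homog.one h𝒜.one_mem)))
  refine equivalent_of_intertwine hP h𝒜 ((ht.mul h𝒜 hu).add (ht.mul h𝒜 hu'))
    (ht.mul h𝒜 (hu.add hu')) (X := X) (Y := X)
    (hX _ _ _) (hX _ _ _) ?_ ?_ ?_ ?_
  · change X * Matrix.fromBlocks (Matrix.fromBlocks t.A (-(t.x * u.f)) 0 u.A) 0 0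
        (Matrix.fromBlocks t.A (-(t.x * u'.f)) 0 u'.A) =
      Matrix.fromBlocks t.A (-(t.x * Matrix.fromCols u.f u'.f)) 0
        (Matrix.fromBlocks u.A 0 0 u'.A) * X
    ext (i | (i | i)) ((j | j) | (j | j)) <;>
      simp [X, Matrix.mul_apply, Fintype.sum_sum_type, Matrix.one_apply]
  · change Matrix.fromCols (Matrix.fromCols t.f (t.c * u.f)) (Matrix.fromCols t.f (t.c * u'.f)) =
      Matrix.fromCols t.f (t.c * Matrix.fromCols u.f u'.f) * X
    ext i ((j | j) | (j | j)) <;>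
      simp [X, Matrix.mul_apply, Fintype.sum_sum_type, Matrix.one_apply]
  · change Matrix.fromRows (t.x * (u.c + u'.c)) (Matrix.fromRows u.x u'.x) =
      X * Matrix.fromRows (Matrix.fromRows (t.x * u.c) u.x) (Matrix.fromRows (t.x * u'.c) u'.x)
    ext (i | (i | i)) j <;>
      simp [X, Matrix.mul_apply, Fintype.sum_sum_type, Matrix.one_apply, _root_.mul_add]
  · change t.c * (u.c + u'.c) = t.c * u.c + t.c * u'.c
    rw [Matrix.mul_add]

/-- The intermediate datum `m` stands for the last row of `t.mat` times the last column of its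
inverse. It embeds into the datum of the product by repeating the coordinates of `t`, and it equals
`1` through the homotopy `p = (0, 1)`, because its row is `p * t.mat`. -/
theorem equivalent_mul_inv (ht : t.IsAdmissible 𝒜 P a b) (h0 : ¬ t.IsNull P) :
    Equivalent P (t.mul (t.inv a b)) (const 1) := by
  let m : SchurDatum G R :=
    { index := t.index ⊕ Unit
      rowDeg := Sum.elim t.rowDeg fun _ => a
      colDeg := Sum.elim t.colDeg fun _ => b
      A := t.mat
      x := Matrix.fromRows 0 1
      f := Matrix.fromCols t.f (-t.c)
      c := 0 }
  have h1 : Homog 𝒜 (fun _ => a) (fun _ => a) (1 : Matrix Unit Unit R) :=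
    Homog.one h𝒜.one_mem
  have hm : m.IsAdmissible 𝒜 P a a :=
    ⟨⟨ht.mat, Homog.fromRows Homog.zero h1, Homog.fromCols ht.f ht.c.neg, Homog.zero⟩, h0⟩
  have hmul := ht.toIsHomog.mul h𝒜 (ht.toIsHomog.inv h𝒜)
  have hc : (const (G := G) (1 : R)).IsHomog 𝒜 a a := IsHomog.const (by simpa using h𝒜.one_mem)
  refine Equivalent.trans hP h𝒜 hmul hm hc (Equivalent.symm hP h𝒜 hm.toIsHomog hmul ?_) ?_
  · let X : Matrix (t.index ⊕ (t.index ⊕ Unit)) (t.index ⊕ Unit) R :=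
      Matrix.fromRows (Matrix.fromCols 1 0) 1
    have hX : ∀ (α : t.index → G) (d : G),
        Homog 𝒜 (Sum.elim α (Sum.elim α fun _ => d)) (Sum.elim α fun _ => d) X := fun α d =>
      Homog.fromRows (Homog.fromCols (Homog.one h𝒜.one_mem) Homog.zero) (Homog.one h𝒜.one_mem)
    refine equivalent_of_intertwine hP h𝒜 hm.toIsHomog hmul (X := X) (Y := X)
      (hX _ _) (hX _ _) ?_ ?_ ?_ ?_
    · change X * Matrix.fromBlocks t.A t.x t.f (-t.c) = Matrix.fromBlocks t.A
        (-(t.x * (Matrix.fromCols 0 (-1) : Matrix Unit (t.index ⊕ Unit) R))) 0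
        (Matrix.fromBlocks t.A t.x t.f (-t.c)) * X
      ext (i | (i | i)) (j | j) <;>
        simp [X, Matrix.mul_apply, Fintype.sum_sum_type, Matrix.one_apply]
    · change Matrix.fromCols t.f (-t.c) = (Matrix.fromCols t.f
        (t.c * (Matrix.fromCols 0 (-1) : Matrix Unit (t.index ⊕ Unit) R)) :
          Matrix Unit (t.index ⊕ (t.index ⊕ Unit)) R) * X
      ext i (j | j) <;>
        simp [X, Matrix.mul_apply, Fintype.sum_sum_type, Matrix.one_apply]
    · change Matrix.fromRows (t.x * (0 : Matrix Unit Unit R))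
          (Matrix.fromRows (0 : Matrix t.index Unit R) (1 : Matrix Unit Unit R)) =
        X * Matrix.fromRows (0 : Matrix t.index Unit R) (1 : Matrix Unit Unit R)
      ext (i | (i | i)) j <;>
        simp [X, Matrix.mul_apply, Fintype.sum_sum_type, Matrix.one_apply]
    · exact Matrix.mul_zero t.c
  · refine isNull_add_neg_of_intertwine hP h𝒜 hm.toIsHomog hc (X := (0 : Matrix Empty _ R))
      (Y := (0 : Matrix Empty _ R)) (p := Matrix.fromCols 0 1) (q := (0 : Matrix Empty Unit R))
      Homog.zero Homog.zero (Homog.fromCols Homog.zero h1) Homog.zero ?_ ?_ ?_ ?_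
    · ext i; exact i.elim
    · change Matrix.fromCols t.f (-t.c) = (0 : Matrix Unit Empty R) * (0 : Matrix Empty (t.index ⊕ Unit) R) +
        Matrix.fromCols (0 : Matrix Unit t.index R) (1 : Matrix Unit Unit R) *
          Matrix.fromBlocks t.A t.x t.f (-t.c)
      rw [Matrix.fromCols_mul_fromBlocks]
      simp
    · ext i; exact i.elim
    · change (Matrix.of fun _ _ => 1 : Matrix Unit Unit R) =
        0 + Matrix.fromCols 0 1 * Matrix.fromRows 0 1 -
          (0 : Matrix Unit Empty R) * (0 : Matrix Empty Unit R)
      rw [Matrix.fromCols_mul_fromRows]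
      ext i j
      simp

end

end SchurDatum

/-! ### Homomorphisms out of a graded ring. -/

namespace IsGrading

variable {G : Type v} [Group G] {R : Type u} [Ring R] {𝒜 : G → AddSubgroup R}

open Classical in
/-- The additive map on a graded ring with given restrictions to the homogeneous components. -/
noncomputable def liftAdd {M : Type*} [AddCommMonoid M] (h : IsGrading 𝒜) (f : ∀ g, 𝒜 g →+ M) :
    R →+ M :=
  (DirectSum.toAddMonoid f).comp (AddEquiv.ofBijective _ h.isInternal).symm.toAddMonoidHom

open Classical in
theorem liftAdd_of_mem {M : Type*} [AddCommMonoid M] (h : IsGrading 𝒜) (f : ∀ g, 𝒜 g →+ M) {g : G}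
    {x : R} (hx : x ∈ 𝒜 g) : h.liftAdd f x = f g ⟨x, hx⟩ := by
  have e : (AddEquiv.ofBijective _ h.isInternal).symm x
      = DirectSum.of (fun g => 𝒜 g) g ⟨x, hx⟩ := by
    rw [AddEquiv.symm_apply_eq]
    exact (DirectSum.coeAddMonoidHom_of 𝒜 g ⟨x, hx⟩).symm
  change DirectSum.toAddMonoid _ ((AddEquiv.ofBijective _ h.isInternal).symm x) = _
  rw [e, DirectSum.toAddMonoid_of]

/-- The ring homomorphism on a graded ring with given restrictions to the homogeneous
components. -/
noncomputable def liftRing {S : Type*} [Ring S] (h : IsGrading 𝒜) (f : ∀ g, 𝒜 g →+ S)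
    (hone : f 1 ⟨1, h.one_mem⟩ = 1)
    (hmul : ∀ g k (x : 𝒜 g) (y : 𝒜 k), f (g * k) ⟨x * y, h.mul_mem x.2 y.2⟩ = f g x * f k y) :
    R →+* S :=
  { h.liftAdd f with
    map_one' := (h.liftAdd_of_mem f h.one_mem).trans hone
    map_mul' := fun x y => by
      change h.liftAdd f (x * y) = h.liftAdd f x * h.liftAdd f y
      induction x using h.induction with
      | add x z hx hz => rw [add_mul, map_add, map_add, hx, hz, add_mul]
      | hom g x hx =>
        induction y using h.induction with
        | add y z hy hz => rw [mul_add, map_add, map_add, hy, hz, mul_add]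
        | hom k y hy =>
          rw [h.liftAdd_of_mem f hx, h.liftAdd_of_mem f hy, h.liftAdd_of_mem f (h.mul_mem hx hy)]
          exact hmul g k ⟨x, hx⟩ ⟨y, hy⟩ }

theorem liftRing_of_mem {S : Type*} [Ring S] (h : IsGrading 𝒜) (f : ∀ g, 𝒜 g →+ S)
    (hone : f 1 ⟨1, h.one_mem⟩ = 1)
    (hmul : ∀ g k (x : 𝒜 g) (y : 𝒜 k), f (g * k) ⟨x * y, h.mul_mem x.2 y.2⟩ = f g x * f k y)
    {g : G} {x : R} (hx : x ∈ 𝒜 g) : h.liftRing f hone hmul x = f g ⟨x, hx⟩ :=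
  h.liftAdd_of_mem f hx

end IsGrading

/-! ### Compatibility of products with equivalence. -/

namespace SchurDatum

variable {G : Type v} {R : Type u} [Ring R] [Group G] {𝒜 : G → AddSubgroup R}
  {P : Set (SqMatrix R)} {a b d : G} {t u s t' u' : SchurDatum G R}

section

variable (hP : IsGrPrimeMatrixIdeal 𝒜 P) (h𝒜 : IsGrading 𝒜)

include hP h𝒜

theorem Equivalent.isNull_iff (ht : t.IsAdmissible 𝒜 P a b) (hu : u.IsAdmissible 𝒜 P a b)
    (h : Equivalent P t u) : t.IsNull P ↔ u.IsNull P := by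
  refine ⟨fun h0 => ?_, fun h0 => ?_⟩
  · exact IsNull.of_add hP h𝒜 hu.toIsHomog ht.neg.toIsHomog ht.neg.notSing
      (Equivalent.symm hP h𝒜 ht.toIsHomog hu.toIsHomog h)
      ((isNull_neg hP h𝒜 ht.toIsHomog).2 h0)
  · exact IsNull.of_add hP h𝒜 ht.toIsHomog hu.neg.toIsHomog hu.neg.notSing h
      ((isNull_neg hP h𝒜 hu.toIsHomog).2 h0)

theorem equivalent_of_add_right (ht : t.IsHomog 𝒜 a b) (hu : u.IsHomog 𝒜 a b)
    (hs : s.IsAdmissible 𝒜 P a b) (h : (t.add s).IsNull P) (h' : (u.add s).IsNull P) :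
    Equivalent P t u := by
  have h1 := (isNull_neg hP h𝒜 (hu.add hs.toIsHomog)).2 h'
  rw [neg_add] at h1
  have h2 := IsNull.add hP h𝒜 (ht.add hs.toIsHomog) (hu.neg.add hs.neg.toIsHomog) h h1
  exact IsNull.of_add hP h𝒜 (ht.add hu.neg) (hs.add hP hs.neg).toIsHomog (hs.add hP hs.neg).notSing
    (isNull_add_add_add_comm.1 h2) (Equivalent.refl hP h𝒜 hs.toIsHomog)

/-- By distributivity and `isNull_mul`, both `t u + (-t') u` and `t' u + (-t') u` are null;
cancelling the common summand avoids comparing `(-t') u` with `-(t' u)`. -/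
theorem Equivalent.mul_right (ht : t.IsAdmissible 𝒜 P a b) (ht' : t'.IsAdmissible 𝒜 P a b)
    (hu : u.IsAdmissible 𝒜 P b d) (h : Equivalent P t t') : Equivalent P (t.mul u) (t'.mul u) := by
  have key : ∀ {s : SchurDatum G R}, s.IsAdmissible 𝒜 P a b → Equivalent P s t' →
      ((s.mul u).add (t'.neg.mul u)).IsNull P := fun {s} hs h =>
    (Equivalent.isNull_iff hP h𝒜 ((hs.add hP ht'.neg).mul hP h𝒜 hu)
      ((hs.mul hP h𝒜 hu).add hP (ht'.neg.mul hP h𝒜 hu))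
      (equivalent_add_mul hP h𝒜 hs.toIsHomog ht'.neg.toIsHomog hu.toIsHomog)).1
      ((isNull_mul hP h𝒜 (hs.add hP ht'.neg).toIsHomog hu.toIsHomog).2 (Or.inl h))
  exact equivalent_of_add_right hP h𝒜 (ht.mul hP h𝒜 hu).toIsHomog (ht'.mul hP h𝒜 hu).toIsHomog
    (ht'.neg.mul hP h𝒜 hu) (key ht h) (key ht' (Equivalent.refl hP h𝒜 ht'.toIsHomog))

theorem Equivalent.mul_left (ht : t.IsAdmissible 𝒜 P a b) (hu : u.IsAdmissible 𝒜 P b d)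
    (hu' : u'.IsAdmissible 𝒜 P b d) (h : Equivalent P u u') :
    Equivalent P (t.mul u) (t.mul u') := by
  have key : ∀ {s : SchurDatum G R}, s.IsAdmissible 𝒜 P b d → Equivalent P s u' →
      ((t.mul s).add (t.mul u'.neg)).IsNull P := fun {s} hs h =>
    (Equivalent.isNull_iff hP h𝒜 ((ht.mul hP h𝒜 hs).add hP (ht.mul hP h𝒜 hu'.neg))
      (ht.mul hP h𝒜 (hs.add hP hu'.neg))
      (equivalent_mul_add hP h𝒜 ht.toIsHomog hs.toIsHomog hu'.neg.toIsHomog)).2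
      ((isNull_mul hP h𝒜 ht.toIsHomog (hs.add hP hu'.neg).toIsHomog).2 (Or.inr h))
  exact equivalent_of_add_right hP h𝒜 (ht.mul hP h𝒜 hu).toIsHomog (ht.mul hP h𝒜 hu').toIsHomog
    (ht.mul hP h𝒜 hu'.neg) (key hu h) (key hu' (Equivalent.refl hP h𝒜 hu'.toIsHomog))

end

theorem IsAdmissible.shift_mul {g h : G} (ht : t.IsAdmissible 𝒜 P g 1) :
    (t.shift h).IsAdmissible 𝒜 P (g * h) h := by
  simpa using ht.shift h

end SchurDatum

/-! ### The graded ring of equivalence classes. -/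

section

open SchurDatum

section Component

variable {G : Type v} {R : Type u} [Ring R] [Group G] {𝒜 : G → AddSubgroup R}
  {P : Set (SqMatrix R)}

/-- Equivalence of admissible data of degree `g`. -/
def componentSetoid (hP : IsGrPrimeMatrixIdeal 𝒜 P) (h𝒜 : IsGrading 𝒜) (g : G) :
    Setoid {t : SchurDatum G R // t.IsAdmissible 𝒜 P g 1} where
  r t u := Equivalent P t.1 u.1
  iseqv := ⟨fun t => Equivalent.refl hP h𝒜 t.2.toIsHomog,
    fun {t u} h => Equivalent.symm hP h𝒜 t.2.toIsHomog u.2.toIsHomog h,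
    fun {t u s} h h' => Equivalent.trans hP h𝒜 t.2.toIsHomog u.2 s.2.toIsHomog h h'⟩

/-- The homogeneous component of the localization at a graded prime matrix ideal. -/
def Component (hP : IsGrPrimeMatrixIdeal 𝒜 P) (h𝒜 : IsGrading 𝒜) (g : Additive G) :=
  Quotient (componentSetoid hP h𝒜 g.toMul)

namespace Component

variable {hP : IsGrPrimeMatrixIdeal 𝒜 P} {h𝒜 : IsGrading 𝒜} {g k l : Additive G}

/-- The class of an admissible datum. -/
def mk (hP : IsGrPrimeMatrixIdeal 𝒜 P) (h𝒜 : IsGrading 𝒜) (g : Additive G) (t : SchurDatum G R)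
    (ht : t.IsAdmissible 𝒜 P g.toMul 1) : Component hP h𝒜 g :=
  Quotient.mk (componentSetoid hP h𝒜 g.toMul) ⟨t, ht⟩

theorem mk_eq_iff {t u : SchurDatum G R} {ht : t.IsAdmissible 𝒜 P g.toMul 1}
    {hu : u.IsAdmissible 𝒜 P g.toMul 1} :
    mk hP h𝒜 g t ht = mk hP h𝒜 g u hu ↔ Equivalent P t u :=
  ⟨fun h => Quotient.exact h, fun h => Quotient.sound h⟩

theorem ind {p : Component hP h𝒜 g → Prop}
    (h : ∀ t (ht : t.IsAdmissible 𝒜 P g.toMul 1), p (mk hP h𝒜 g t ht)) (x) : p x :=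
  Quotient.inductionOn x fun t => h t.1 t.2

instance : Add (Component hP h𝒜 g) where
  add := Quotient.map₂ (fun t u => ⟨t.1.add u.1, t.2.add hP u.2⟩)
    fun t t' h u u' h' => Equivalent.add hP h𝒜 t.2.toIsHomog u.2.toIsHomog t'.2.toIsHomog
      u'.2.toIsHomog h h'

instance : Neg (Component hP h𝒜 g) where
  neg := Quotient.map (fun t => ⟨t.1.neg, t.2.neg⟩)
    fun t t' h => Equivalent.neg hP h𝒜 t.2.toIsHomog t'.2.toIsHomog h

instance : Zero (Component hP h𝒜 g) where
  zero := mk hP h𝒜 g (const 0) (IsAdmissible.const hP h𝒜 (zero_mem _))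

instance : AddCommGroup (Component hP h𝒜 g) where
  add_assoc := by
    refine ind fun t ht => ind fun u hu => ind fun s hs => Quotient.sound ?_
    exact equivalent_add_assoc hP h𝒜 ht.toIsHomog hu.toIsHomog hs.toIsHomog
  add_comm := by
    refine ind fun t ht => ind fun u hu => Quotient.sound ?_
    exact equivalent_add_comm hP h𝒜 ht.toIsHomog hu.toIsHomog
  zero_add := by
    refine ind fun t ht => Quotient.sound ?_
    exact equivalent_zero_add hP h𝒜 ht.toIsHomog
  add_zero := by
    refine ind fun t ht => Quotient.sound ?_
    have h0 : (const (0 : R)).IsAdmissible 𝒜 P g.toMul 1 :=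
      IsAdmissible.const hP h𝒜 (zero_mem _)
    exact Equivalent.trans hP h𝒜 (ht.add hP h0).toIsHomog (h0.add hP ht) ht.toIsHomog
      (equivalent_add_comm hP h𝒜 ht.toIsHomog h0.toIsHomog)
      (equivalent_zero_add hP h𝒜 ht.toIsHomog)
  neg_add_cancel := by
    refine ind fun t ht => Quotient.sound ?_
    exact equivalent_neg_add hP h𝒜 ht.toIsHomog
  nsmul := nsmulRec
  zsmul := zsmulRec

theorem mk_eq_zero_iff {t : SchurDatum G R} (ht : t.IsAdmissible 𝒜 P g.toMul 1) :
    mk hP h𝒜 g t ht = 0 ↔ t.IsNull P :=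
  mk_eq_iff.trans (equivalent_const_zero_iff hP h𝒜 ht.toIsHomog)

/-- Representatives in a component have right degree `1`, whereas a product needs the right degree
of `t` to equal the left degree `k` of `u`; shifting `t` by `k` achieves this without changing its
matrices. -/
instance : GradedMonoid.GMul (Component hP h𝒜) where
  mul {_ k} := Quotient.map₂ (fun t u => ⟨(t.1.shift k.toMul).mul u.1, t.2.shift_mul.mul hP h𝒜 u.2⟩)
    fun t t' h u u' h' => by
      have ht := t.2.shift_mul (h := k.toMul)
      have ht' := t'.2.shift_mul (h := k.toMul)
      exact Equivalent.trans hP h𝒜 (ht.mul hP h𝒜 u.2).toIsHomog (ht'.mul hP h𝒜 u.2)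
        (ht'.mul hP h𝒜 u'.2).toIsHomog (Equivalent.mul_right hP h𝒜 ht ht' u.2 h)
        (Equivalent.mul_left hP h𝒜 ht' u.2 u'.2 h')

instance : GradedMonoid.GOne (Component hP h𝒜) where
  one := mk hP h𝒜 0 (const 1) (IsAdmissible.const hP h𝒜 (by simpa using h𝒜.one_mem))

theorem gradedMonoid_mk_eq {t u : SchurDatum G R} {ht : t.IsAdmissible 𝒜 P g.toMul 1}
    {hu : u.IsAdmissible 𝒜 P k.toMul 1} (hgk : g = k) (h : Equivalent P t u) :
    GradedMonoid.mk g (mk hP h𝒜 g t ht) = GradedMonoid.mk k (mk hP h𝒜 k u hu) := by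
  subst hgk
  rw [mk_eq_iff.2 h]

theorem mul_add' (x : Component hP h𝒜 g) (y z : Component hP h𝒜 k) :
    GradedMonoid.GMul.mul x (y + z) = GradedMonoid.GMul.mul x y + GradedMonoid.GMul.mul x z := by
  revert x y z
  refine ind fun t ht => ind fun u hu => ind fun s hs => Eq.symm (Quotient.sound ?_)
  exact equivalent_mul_add hP h𝒜 (ht.shift_mul (h := k.toMul)).toIsHomog hu.toIsHomog
    hs.toIsHomog

theorem add_mul' (x y : Component hP h𝒜 g) (z : Component hP h𝒜 k) :
    GradedMonoid.GMul.mul (x + y) z = GradedMonoid.GMul.mul x z + GradedMonoid.GMul.mul y z := by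
  revert x y z
  refine ind fun t ht => ind fun u hu => ind fun s hs => Quotient.sound ?_
  have h := equivalent_add_mul hP h𝒜 (ht.shift_mul (h := k.toMul)).toIsHomog
    (hu.shift_mul (h := k.toMul)).toIsHomog hs.toIsHomog
  exact h

instance : DirectSum.GRing (Component hP h𝒜) where
  mul_zero {_ k} x := by
    have := mul_add' x (0 : Component hP h𝒜 k) 0
    rwa [add_zero, left_eq_add] at this
  zero_mul {g _} x := by
    have := add_mul' (0 : Component hP h𝒜 g) 0 x
    rwa [add_zero, left_eq_add] at this
  mul_add := mul_add'
  add_mul := add_mul'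
  one_mul := by
    rintro ⟨g, x⟩
    revert x
    refine ind fun t ht => gradedMonoid_mk_eq (zero_add g) ?_
    exact equivalent_one_mul hP h𝒜 ht.toIsHomog
  mul_one := by
    rintro ⟨g, x⟩
    revert x
    refine ind fun t ht => gradedMonoid_mk_eq (add_zero g) ?_
    have h := equivalent_mul_one hP h𝒜 (ht.shift_mul (h := 1)).toIsHomog
    exact h
  mul_assoc := by
    rintro ⟨g, x⟩ ⟨k, y⟩ ⟨l, z⟩
    revert x y z
    refine ind fun t ht => ind fun u hu => ind fun s hs => gradedMonoid_mk_eq (add_assoc g k l) ?_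
    have h1 : (t.shift (k.toMul * l.toMul)).IsAdmissible 𝒜 P (g.toMul * (k.toMul * l.toMul))
      (k.toMul * l.toMul) := ht.shift_mul
    have h := equivalent_mul_assoc hP h𝒜 h1.toIsHomog (hu.shift_mul (h := l.toMul)).toIsHomog
      hs.toIsHomog
    exact h
  natCast n := n • GradedMonoid.GOne.one
  natCast_zero := zero_nsmul _
  natCast_succ n := succ_nsmul _ n
  intCast n := n • GradedMonoid.GOne.one
  intCast_ofNat n := natCast_zsmul _ n
  intCast_negSucc_ofNat n := negSucc_zsmul _ n

end Component

end Component

end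

/-! ### The localization as a graded division ring. -/

section

open SchurDatum DirectSum

/-- The direct sum of the components of a graded ring is graded by the images of the components. -/
theorem isGrading_range_of {G : Type v} [Group G] [DecidableEq G] (C : Additive G → Type*)
    [∀ g, AddCommGroup (C g)] [GRing C] :
    IsGrading fun g : G => (DirectSum.of C (Additive.ofMul g)).range := by
  refine ⟨⟨_, rfl⟩, ?_, isInternal_of_proj
    (fun g => (DirectSum.of C (Additive.ofMul g)).comp
      (DFinsupp.evalAddMonoidHom (Additive.ofMul g))) ?_ ?_ ?_⟩
  · rintro g k _ _ ⟨x, rfl⟩ ⟨y, rfl⟩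
    rw [DirectSum.of_mul_of]
    exact ⟨_, rfl⟩
  · rintro g _ ⟨x, rfl⟩
    change DirectSum.of _ _ ((DirectSum.of C (Additive.ofMul g) x) _) = _
    rw [DirectSum.of_eq_same]
  · rintro g k hgk _ ⟨x, rfl⟩
    change DirectSum.of _ _ ((DirectSum.of C (Additive.ofMul g) x) _) = _
    rw [DirectSum.of_eq_of_ne, map_zero]
    exact fun h => hgk (Additive.ofMul.injective h).symm
  · rw [eq_top_iff]
    intro x _
    induction x using DirectSum.induction_on with
    | zero => exact zero_mem _
    | of g x =>
      exact AddSubgroup.mem_iSup_of_mem (S := fun g : G => (of C (Additive.ofMul g)).range)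
        g.toMul ⟨x, rfl⟩
    | add x y hx hy => exact add_mem (hx trivial) (hy trivial)

section Localization

variable {G : Type v} {R : Type u} [Ring R] [Group G] {𝒜 : G → AddSubgroup R}
  {P : Set (SqMatrix R)}

/-- The localization of a graded ring at a graded prime matrix ideal. -/
abbrev GrLocalization (hP : IsGrPrimeMatrixIdeal 𝒜 P) (h𝒜 : IsGrading 𝒜) :=
  ⨁ g : Additive G, Component hP h𝒜 g

namespace GrLocalization

variable [DecidableEq G] (hP : IsGrPrimeMatrixIdeal 𝒜 P) (h𝒜 : IsGrading 𝒜)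

/-- The grading of the localization. -/
def grading (g : G) : AddSubgroup (GrLocalization hP h𝒜) :=
  (DirectSum.of (Component hP h𝒜) (Additive.ofMul g)).range

/-- The element represented by an admissible datum. -/
def elem {a b : G} (t : SchurDatum G R) (ht : t.IsAdmissible 𝒜 P a b) : GrLocalization hP h𝒜 :=
  DirectSum.of (Component hP h𝒜) (Additive.ofMul (a * b⁻¹))
    (Component.mk hP h𝒜 (Additive.ofMul (a * b⁻¹)) (t.shift b⁻¹) (by simpa using ht.shift b⁻¹))

variable {a b d a' b' : G} {t u t' : SchurDatum G R}

theorem elem_mem (ht : t.IsAdmissible 𝒜 P a b) : elem hP h𝒜 t ht ∈ grading hP h𝒜 (a * b⁻¹) :=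
  ⟨_, rfl⟩

variable {hP h𝒜}

theorem of_mk_congr {g k : Additive G} {ht : t.IsAdmissible 𝒜 P g.toMul 1}
    {hu : u.IsAdmissible 𝒜 P k.toMul 1} (hgk : g = k) (h : Equivalent P t u) :
    DirectSum.of (Component hP h𝒜) g (Component.mk hP h𝒜 g t ht) =
      DirectSum.of (Component hP h𝒜) k (Component.mk hP h𝒜 k u hu) :=
  DirectSum.of_eq_of_gradedMonoid_eq (Component.gradedMonoid_mk_eq hgk h)

theorem elem_congr (ht : t.IsAdmissible 𝒜 P a b) (hu : u.IsAdmissible 𝒜 P a' b')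
    (h : a * b⁻¹ = a' * b'⁻¹) (h' : Equivalent P t u) : elem hP h𝒜 t ht = elem hP h𝒜 u hu :=
  of_mk_congr (congrArg Additive.ofMul h) h'

theorem of_mk {g : G} (ht : t.IsAdmissible 𝒜 P g 1) :
    DirectSum.of (Component hP h𝒜) (Additive.ofMul g)
      (Component.mk hP h𝒜 (Additive.ofMul g) t ht) = elem hP h𝒜 t ht :=
  of_mk_congr (congrArg Additive.ofMul (by simp)) (Equivalent.refl hP h𝒜 ht.toIsHomog)

theorem exists_elem {g : G} {x : GrLocalization hP h𝒜} (hx : x ∈ grading hP h𝒜 g) :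
    ∃ (t : SchurDatum G R) (ht : t.IsAdmissible 𝒜 P g 1), x = elem hP h𝒜 t ht := by
  obtain ⟨x, rfl⟩ := hx
  revert x
  exact Component.ind fun t ht => ⟨t, ht, of_mk ht⟩

theorem elem_add (ht : t.IsAdmissible 𝒜 P a b) (hu : u.IsAdmissible 𝒜 P a b) :
    elem hP h𝒜 (t.add u) (ht.add hP hu) = elem hP h𝒜 t ht + elem hP h𝒜 u hu := by
  rw [elem, elem, elem, ← map_add]
  refine congrArg _ (Component.mk_eq_iff.2 ?_)
  have h := Equivalent.refl hP h𝒜 (ht.add hP hu).toIsHomog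
  exact h

theorem elem_eq_zero_iff (ht : t.IsAdmissible 𝒜 P a b) : elem hP h𝒜 t ht = 0 ↔ t.IsNull P := by
  rw [elem, ← map_zero (DirectSum.of (Component hP h𝒜) (Additive.ofMul (a * b⁻¹))),
    (DirectSum.of_injective _).eq_iff, Component.mk_eq_zero_iff]
  rfl

theorem elem_mul (ht : t.IsAdmissible 𝒜 P a b) (hu : u.IsAdmissible 𝒜 P b d) :
    elem hP h𝒜 (t.mul u) (ht.mul hP h𝒜 hu) = elem hP h𝒜 t ht * elem hP h𝒜 u hu := by
  rw [elem, elem, elem, DirectSum.of_mul_of]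
  refine of_mk_congr (congrArg Additive.ofMul (by simp [mul_assoc])) ?_
  have h := Equivalent.refl hP h𝒜 (ht.mul hP h𝒜 hu).toIsHomog
  exact h

theorem one_eq_elem (a : G) (h : (const (1 : R)).IsAdmissible 𝒜 P a a) :
    (1 : GrLocalization hP h𝒜) = elem hP h𝒜 (const 1) h :=
  of_mk_congr (u := (const 1).shift a⁻¹) (congrArg Additive.ofMul (by simp))
    (Equivalent.refl hP h𝒜 h.toIsHomog)

variable (hP h𝒜)

include hP h𝒜 in
theorem admissible_one (a : G) : (const (1 : R)).IsAdmissible 𝒜 P a a :=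
  IsAdmissible.const hP h𝒜 (by simpa using h𝒜.one_mem)

theorem isGrading : IsGrading (grading hP h𝒜) := isGrading_range_of (Component hP h𝒜)

theorem nontrivial : Nontrivial (GrLocalization hP h𝒜) := by
  refine ⟨⟨1, 0, fun h => ?_⟩⟩
  rw [one_eq_elem 1 (admissible_one hP h𝒜 1), elem_eq_zero_iff] at h
  change Sing P ((Matrix.fromBlocks 0 0 0 (-Matrix.of fun _ _ => 1) : Matrix (Empty ⊕ Unit)
      (Empty ⊕ Unit) R)) at h
  have h1 : Homog 𝒜 (fun _ => 1) (fun _ => 1) (1 : Matrix (Empty ⊕ Unit) (Empty ⊕ Unit) R) :=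
    Homog.one h𝒜.one_mem
  refine hP.not_sing_one h𝒜 ((hP.sing_neg h𝒜 h1).1 ?_)
  convert h using 1
  ext (i | i) (j | j)
  exacts [i.elim, i.elim, j.elim, by simp]

theorem exists_mul_eq_one {g : G} {x : GrLocalization hP h𝒜} (hx : x ∈ grading hP h𝒜 g)
    (hx0 : x ≠ 0) : ∃ y ∈ grading hP h𝒜 g⁻¹, x * y = 1 := by
  obtain ⟨t, ht, rfl⟩ := exists_elem hx
  rw [Ne, elem_eq_zero_iff] at hx0
  have hi := ht.inv h𝒜 hx0
  have hm := elem_mem hP h𝒜 hi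
  rw [one_mul] at hm
  refine ⟨_, hm, ?_⟩
  rw [← elem_mul ht hi, one_eq_elem g (admissible_one hP h𝒜 g)]
  exact elem_congr _ _ rfl (equivalent_mul_inv hP h𝒜 ht hx0)

theorem isGrDivisionRing : IsGrDivisionRing (grading hP h𝒜) := by
  have := nontrivial hP h𝒜
  refine ⟨isGrading hP h𝒜, this, fun g x hx hx0 => ?_⟩
  obtain ⟨y, hy, hxy⟩ := exists_mul_eq_one hP h𝒜 hx hx0
  have hy0 : y ≠ 0 := by
    rintro rfl
    rw [mul_zero] at hxy
    exact zero_ne_one hxy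
  obtain ⟨z, -, hyz⟩ := exists_mul_eq_one hP h𝒜 hy hy0
  have : x = z := by rw [← mul_one x, ← hyz, ← mul_assoc, hxy, one_mul]
  exact ⟨⟨x, y, hxy, this ▸ hyz⟩, rfl⟩

/-- The canonical homomorphism to the localization, on a homogeneous component. -/
def homComponent (g : G) : 𝒜 g →+ GrLocalization hP h𝒜 where
  toFun r := elem hP h𝒜 (const (r : R)) (a := g) (b := 1)
    (IsAdmissible.const hP h𝒜 (by simp))
  map_zero' := (elem_eq_zero_iff _).2 (isNull_const_zero hP h𝒜)
  map_add' r s := by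
    rw [← elem_add]
    have h : ∀ r : 𝒜 g, (r : R) ∈ 𝒜 (g * 1⁻¹) := by simp
    exact elem_congr _ _ rfl (Equivalent.symm hP h𝒜
      ((IsHomog.const (h r)).add (IsHomog.const (h s)))
      (IsHomog.const (add_mem (h r) (h s))) (equivalent_const_add hP h𝒜 (h r) (h s)))

/-- The canonical homomorphism to the localization. -/
noncomputable def hom : R →+* GrLocalization hP h𝒜 :=
  h𝒜.liftRing (homComponent hP h𝒜) (one_eq_elem 1 (admissible_one hP h𝒜 1)).symm fun g k x y => by
    have hx : (x : R) ∈ 𝒜 (g * k * k⁻¹) := by simp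
    have hy : (y : R) ∈ 𝒜 (k * 1⁻¹) := by simp
    have hxy : (x * y : R) ∈ 𝒜 (g * k * 1⁻¹) := by simpa using h𝒜.mul_mem x.2 y.2
    have e : homComponent hP h𝒜 g x = elem hP h𝒜 (const (x : R)) (IsAdmissible.const hP h𝒜 hx) :=
      elem_congr (IsAdmissible.const hP h𝒜 (by simp)) _ (by simp)
        (Equivalent.refl hP h𝒜 (IsHomog.const hx))
    rw [e]
    refine Eq.trans ?_ (elem_mul (IsAdmissible.const hP h𝒜 hx) (IsAdmissible.const hP h𝒜 hy))
    exact elem_congr (IsAdmissible.const hP h𝒜 hxy) _ rfl (Equivalent.symm hP h𝒜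
      ((IsHomog.const hx).mul h𝒜 (IsHomog.const hy)) (IsHomog.const hxy)
      (equivalent_const_mul_const hP h𝒜 hx hy))

variable {hP h𝒜}

theorem elem_const {r : R} (hr : r ∈ 𝒜 (a * b⁻¹)) :
    elem hP h𝒜 (const r) (IsAdmissible.const hP h𝒜 hr) = hom hP h𝒜 r := by
  refine Eq.trans ?_ (h𝒜.liftRing_of_mem (homComponent hP h𝒜) _ _ hr).symm
  have hr' : r ∈ 𝒜 (a * b⁻¹ * 1⁻¹) := by simpa using hr
  exact elem_congr _ (IsAdmissible.const hP h𝒜 hr') (by simp)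
    (Equivalent.refl hP h𝒜 (IsHomog.const hr))

theorem hom_mem {g : G} {r : R} (hr : r ∈ 𝒜 g) : hom hP h𝒜 r ∈ grading hP h𝒜 g := by
  have hr' : r ∈ 𝒜 (g * 1⁻¹) := by simpa using hr
  rw [← elem_const hr']
  simpa using elem_mem hP h𝒜 (IsAdmissible.const hP h𝒜 hr')

end GrLocalization

end Localization

end

/-! ### Linear systems over the localization. -/

section

open SchurDatum DirectSum

namespace SchurDatum

variable {G : Type v} {R : Type u} [Ring R] [Group G] {𝒜 : G → AddSubgroup R}
  {P : Set (SqMatrix R)} {a a' b : G} {t : SchurDatum G R}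

/-- The datum with another last row. -/
def withRow (t : SchurDatum G R) (f : Matrix Unit t.index R) (c : Matrix Unit Unit R) :
    SchurDatum G R where
  index := t.index
  rowDeg := t.rowDeg
  colDeg := t.colDeg
  A := t.A
  x := t.x
  f := f
  c := c

theorem IsAdmissible.withRow (ht : t.IsAdmissible 𝒜 P a b) {f : Matrix Unit t.index R}
    {c : Matrix Unit Unit R} (hf : Homog 𝒜 (fun _ => a') t.colDeg f)
    (hc : Homog 𝒜 (fun _ => a') (fun _ => b) c) : (t.withRow f c).IsAdmissible 𝒜 P a' b :=
  ⟨⟨ht.A, ht.x, hf, hc⟩, ht.notSing⟩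

end SchurDatum

namespace GrLocalization

variable {G : Type v} {R : Type u} [Ring R] [Group G] {𝒜 : G → AddSubgroup R}
  {P : Set (SqMatrix R)} [DecidableEq G] {hP : IsGrPrimeMatrixIdeal 𝒜 P} {h𝒜 : IsGrading 𝒜}
  {a a' b d : G} {t : SchurDatum G R} {f f' : Matrix Unit t.index R} {c c' : Matrix Unit Unit R}

theorem elem_withRow_add (ht : t.IsAdmissible 𝒜 P a b)
    (hf : Homog 𝒜 (fun _ => a') t.colDeg f) (hc : Homog 𝒜 (fun _ => a') (fun _ => b) c)
    (hf' : Homog 𝒜 (fun _ => a') t.colDeg f') (hc' : Homog 𝒜 (fun _ => a') (fun _ => b) c') :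
    elem hP h𝒜 (t.withRow (f + f') (c + c')) (ht.withRow (hf.add hf') (hc.add hc')) =
      elem hP h𝒜 (t.withRow f c) (ht.withRow hf hc) +
        elem hP h𝒜 (t.withRow f' c') (ht.withRow hf' hc') := by
  rw [← elem_add]
  let X : Matrix (t.index ⊕ t.index) t.index R := Matrix.fromRows 1 1
  have hX : ∀ α : t.index → G, Homog 𝒜 (Sum.elim α α) α X := fun α =>
    Homog.fromRows (Homog.one h𝒜.one_mem) (Homog.one h𝒜.one_mem)
  refine elem_congr _ _ rfl (equivalent_of_intertwine hP h𝒜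
    (ht.withRow (hf.add hf') (hc.add hc')).toIsHomog
    ((ht.withRow hf hc).add hP (ht.withRow hf' hc')).toIsHomog (hX _) (hX _) ?_ ?_ ?_ rfl)
  · change X * t.A = Matrix.fromBlocks t.A 0 0 t.A * X
    rw [Matrix.fromRows_mul, Matrix.fromBlocks_mul_fromRows]
    simp
  · change f + f' = Matrix.fromCols f f' * X
    rw [Matrix.fromCols_mul_fromRows]
    simp
  · change Matrix.fromRows t.x t.x = X * t.x
    rw [Matrix.fromRows_mul]
    simp

theorem elem_withRow_zero_left (ht : t.IsAdmissible 𝒜 P a b) {r : R} (hr : r ∈ 𝒜 (a' * b⁻¹)) :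
    elem hP h𝒜 (t.withRow 0 (Matrix.of fun _ _ => r))
      (ht.withRow (a' := a') Homog.zero fun _ _ => hr) = hom hP h𝒜 r := by
  rw [← elem_const hr]
  refine elem_congr _ _ rfl (equivalent_of_intertwine hP h𝒜
    (ht.withRow (a' := a') Homog.zero fun _ _ => hr).toIsHomog
    (IsAdmissible.const hP h𝒜 hr).toIsHomog (X := (0 : Matrix Empty t.index R))
    (Y := (0 : Matrix Empty t.index R)) Homog.zero Homog.zero ?_ ?_ ?_ rfl)
  · ext i; exact i.elim
  · exact (Matrix.mul_zero (0 : Matrix Unit Empty R)).symm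
  · ext i; exact i.elim

theorem elem_withRow_smul (ht : t.IsAdmissible 𝒜 P a b) {r : R} (hr : r ∈ 𝒜 (a' * d⁻¹))
    (hf : Homog 𝒜 (fun _ => d) t.colDeg f) (hrf : Homog 𝒜 (fun _ => a') t.colDeg (r • f)) :
    elem hP h𝒜 (t.withRow (r • f) 0) (ht.withRow hrf Homog.zero) =
      hom hP h𝒜 r * elem hP h𝒜 (t.withRow f 0) (ht.withRow hf Homog.zero) := by
  have h1 := IsAdmissible.const hP h𝒜 hr
  have h2 := ht.withRow (c := 0) hf Homog.zero
  rw [← elem_const hr, ← elem_mul]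
  refine (elem_congr _ _ rfl (isNull_add_neg_of_equiv hP h𝒜 (h1.mul hP h𝒜 h2).toIsHomog
    (ht.withRow (c := 0) hrf Homog.zero).toIsHomog
    (Equiv.emptySum Empty t.index) ?_ ?_ ?_ ?_ ?_ ?_)).symm
  · rintro (i | i); exacts [i.elim, rfl]
  · rintro (i | i); exacts [i.elim, rfl]
  · rintro (i | i) (j | j); exacts [i.elim, i.elim, j.elim, rfl]
  · rintro i (j | j)
    · exact j.elim
    · have e : r • f = (Matrix.of fun _ _ => r : Matrix Unit Unit R) * f := by
        ext i j
        simp [Matrix.mul_apply]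
      exact congrFun (congrFun e i) j
  · rintro (i | i) j; exacts [i.elim, rfl]
  · exact (Matrix.mul_zero (Matrix.of fun _ _ => r : Matrix Unit Unit R)).symm

theorem homog_single (𝒜' : IsGrading 𝒜) {ι : Type*} [DecidableEq ι] (β : ι → G) (i : ι) :
    Homog 𝒜 (fun _ : Unit => β i) β (Matrix.of fun _ => Pi.single i (1 : R)) := by
  intro _ j
  by_cases h : j = i
  · subst h; simpa using 𝒜'.one_mem
  · simp [h]

variable (hP h𝒜) in
/-- The entries of the solution of the linear system given by a datum. -/
noncomputable def solution (ht : t.IsAdmissible 𝒜 P a b) (i : t.index) : GrLocalization hP h𝒜 :=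
  elem hP h𝒜 (t.withRow (Matrix.of fun _ => Pi.single i (1 : R)) 0)
    (ht.withRow (homog_single h𝒜 t.colDeg i) Homog.zero)

theorem solution_mem (ht : t.IsAdmissible 𝒜 P a b) (i : t.index) :
    solution hP h𝒜 ht i ∈ grading hP h𝒜 (t.colDeg i * b⁻¹) := elem_mem hP h𝒜 _

/-- The represented element depends linearly on the last row, so it is determined by its values at
the unit rows, which are the entries of `A⁻¹ x`. The induction peels off one coordinate of `f` at a
time. -/
theorem elem_withRow (ht : t.IsAdmissible 𝒜 P a b)
    (hf : Homog 𝒜 (fun _ => a') t.colDeg f) (hc : Homog 𝒜 (fun _ => a') (fun _ => b) c) :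
    elem hP h𝒜 (t.withRow f c) (ht.withRow hf hc) =
      ∑ i, hom hP h𝒜 (f () i) * solution hP h𝒜 ht i + hom hP h𝒜 (c () ()) := by
  have hrow : ∀ (r : t.index → R), (∀ i, r i ∈ 𝒜 (a' * (t.colDeg i)⁻¹)) →
      Homog 𝒜 (fun _ : Unit => a') t.colDeg (Matrix.of fun _ => r) := fun r hr _ i => hr i
  have key : ∀ (s : Finset t.index) (r : t.index → R)
      (hr : ∀ i, r i ∈ 𝒜 (a' * (t.colDeg i)⁻¹)), (∀ i ∉ s, r i = 0) →
      elem hP h𝒜 (t.withRow (Matrix.of fun _ => r) 0) (ht.withRow (hrow r hr) Homog.zero) =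
        ∑ i ∈ s, hom hP h𝒜 (r i) * solution hP h𝒜 ht i := by
    intro s
    induction s using Finset.induction_on with
    | empty =>
      intro r hr h0
      obtain rfl : r = 0 := funext fun i => h0 i (Finset.notMem_empty i)
      have h := elem_withRow_zero_left (hP := hP) (h𝒜 := h𝒜) ht (a' := a') (zero_mem _)
      rw [map_zero] at h
      rw [Finset.sum_empty]
      exact h
    | insert j s hj ih =>
      intro r hr h0
      have hr1 : ∀ i, Function.update r j 0 i ∈ 𝒜 (a' * (t.colDeg i)⁻¹) := by
        intro i
        by_cases h : i = j
        · subst h; simp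
        · simpa [h] using hr i
      have hs : (r j • Matrix.of fun _ => Pi.single j (1 : R) : Matrix Unit t.index R) =
          Matrix.of fun _ => Pi.single j (r j) := by
        ext _ i
        by_cases h : i = j
        · subst h; simp
        · simp [h]
      have hr2 : Homog 𝒜 (fun _ : Unit => a') t.colDeg
          (r j • Matrix.of fun _ => Pi.single j (1 : R)) := by
        rw [hs]
        intro _ i
        by_cases h : i = j
        · subst h; simpa using hr i
        · simp [h]
      have e : (Matrix.of fun _ => r : Matrix Unit t.index R) =
          r j • (Matrix.of fun _ => Pi.single j (1 : R)) +
            Matrix.of fun _ => Function.update r j 0 := by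
        rw [hs]
        ext _ i
        by_cases h : i = j
        · subst h; simp
        · simp [h]
      have h1 := elem_withRow_add (hP := hP) (h𝒜 := h𝒜) ht hr2 (Homog.zero (β := fun _ => b))
        (hrow _ hr1) (Homog.zero (β := fun _ => b))
      rw [elem_withRow_smul ht (hr j) (homog_single h𝒜 t.colDeg j) hr2, ih _ hr1] at h1
      · rw [Finset.sum_insert hj]
        refine Eq.trans ?_ (h1.trans ?_)
        · congr 2
          rw [add_zero]
        · refine congrArg₂ _ rfl (Finset.sum_congr rfl fun i hi => ?_)
          rw [Function.update_of_ne]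
          rintro rfl
          exact hj hi
      · intro i hi
        by_cases h : i = j
        · subst h; simp
        · rw [Function.update_of_ne h]
          exact h0 i (by simp [h, hi])
  have h1 := elem_withRow_add (hP := hP) (h𝒜 := h𝒜) ht (hrow (f ()) fun i => hf () i)
    (Homog.zero (β := fun _ => b)) Homog.zero (c' := Matrix.of fun _ _ => c () ())
    fun _ _ => hc () ()
  rw [key Finset.univ _ (fun i => hf () i) (fun i hi => absurd (Finset.mem_univ i) hi),
    elem_withRow_zero_left ht (hc () ())] at h1
  rw [← h1]
  congr 2
  · rw [add_zero]; rfl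
  · rw [zero_add]; rfl

theorem elem_eq_sum (ht : t.IsAdmissible 𝒜 P a b) : elem hP h𝒜 t ht =
    ∑ i, hom hP h𝒜 (t.f () i) * solution hP h𝒜 ht i + hom hP h𝒜 (t.c () ()) :=
  elem_withRow ht ht.f ht.c

/-- Equation `i` says that the datum with last row `(Aᵢ, -xᵢ)` represents zero. That row is the unit
row `p = eᵢ` times `A`, which is a homotopy to the zero datum. -/
theorem mulVec_solution (ht : t.IsAdmissible 𝒜 P a b) (i : t.index) :
    ∑ j, hom hP h𝒜 (t.A i j) * solution hP h𝒜 ht j = hom hP h𝒜 (t.x i ()) := by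
  have hf : Homog 𝒜 (fun _ => t.rowDeg i) t.colDeg (Matrix.of fun (_ : Unit) => t.A i) :=
    fun _ j => ht.A i j
  have hc : Homog 𝒜 (fun _ => t.rowDeg i) (fun _ => b)
      (-Matrix.of fun (_ : Unit) (_ : Unit) => t.x i ()) := fun _ _ => neg_mem (ht.x i ())
  have h := elem_withRow (hP := hP) (h𝒜 := h𝒜) ht hf hc
  have h0 : elem hP h𝒜 (t.withRow (Matrix.of fun _ => t.A i) (-Matrix.of fun _ _ => t.x i ()))
      (ht.withRow hf hc) = 0 := by
    have h00 : (const (0 : R)).IsAdmissible 𝒜 P (t.rowDeg i) b :=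
      IsAdmissible.const hP h𝒜 (zero_mem _)
    rw [elem_eq_zero_iff]
    refine (equivalent_const_zero_iff hP h𝒜 (ht.withRow hf hc).toIsHomog).1 ?_
    refine isNull_add_neg_of_intertwine hP h𝒜 (ht.withRow hf hc).toIsHomog h00.toIsHomog
      (X := (0 : Matrix Empty t.index R)) (Y := (0 : Matrix Empty t.index R))
      (p := Matrix.of fun _ => Pi.single i (1 : R)) (q := (0 : Matrix Empty Unit R))
      Homog.zero Homog.zero (homog_single h𝒜 t.rowDeg i) Homog.zero ?_ ?_ ?_ ?_
    · ext i; exact i.elim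
    · change (Matrix.of fun _ => t.A i) = (0 : Matrix Unit Empty R) * (0 : Matrix Empty t.index R)
        + (Matrix.of fun _ => Pi.single i (1 : R) : Matrix Unit t.index R) * t.A
      ext _ j
      simp [Matrix.mul_apply, Pi.single_apply]
    · ext i; exact i.elim
    · change (Matrix.of fun _ _ => 0 : Matrix Unit Unit R) = (-Matrix.of fun _ _ => t.x i ())
        + (Matrix.of fun _ => Pi.single i (1 : R) : Matrix Unit t.index R) * t.x
        - (0 : Matrix Unit Empty R) * (0 : Matrix Empty Unit R)
      ext _ j
      simp [Matrix.mul_apply, Pi.single_apply]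
  rw [h0] at h
  have h' : 0 = ∑ j, hom hP h𝒜 (t.A i j) * solution hP h𝒜 ht j + hom hP h𝒜 (-(t.x i ())) := h
  rw [map_neg, ← sub_eq_add_neg, eq_comm, sub_eq_zero] at h'
  exact h'

theorem homog_map_hom {ι κ : Type*} {α : ι → G} {β : κ → G} {A : Matrix ι κ R}
    (hA : Homog 𝒜 α β A) : Homog (grading hP h𝒜) α β (A.map (hom hP h𝒜)) :=
  hA.map fun _ _ hr => hom_mem hr

/-- Solving `A b = eₖ` for every `k` gives a right inverse; it is itself invertible by linear
algebra over the graded division ring. -/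
theorem isUnit_map_hom {ι : Type} [Fintype ι] [DecidableEq ι] {α β : ι → G} {A : Matrix ι ι R}
    (hA : Homog 𝒜 α β A) (hs : ¬ Sing P A) : IsUnit (A.map (hom hP h𝒜)) := by
  let t : ι → SchurDatum G R := fun k =>
    { index := ι
      rowDeg := α
      colDeg := β
      A := A
      x := Matrix.of fun i _ => if i = k then 1 else 0
      f := 0
      c := 0 }
  have ht : ∀ k, (t k).IsAdmissible 𝒜 P 1 (α k) := fun k =>
    ⟨⟨hA, fun i _ => by
      change (if i = k then 1 else 0) ∈ 𝒜 (α i * (α k)⁻¹)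
      split_ifs with h
      · simpa [h] using h𝒜.one_mem
      · exact zero_mem _, Homog.zero, Homog.zero⟩, hs⟩
  let B : Matrix ι ι (GrLocalization hP h𝒜) := Matrix.of fun j k => solution hP h𝒜 (ht k) j
  have hAB : A.map (hom hP h𝒜) * B = 1 := by
    refine Matrix.ext fun i k => ?_
    rw [Matrix.mul_apply]
    refine (mulVec_solution (hP := hP) (h𝒜 := h𝒜) (ht k) i).trans ?_
    change hom hP h𝒜 (if i = k then 1 else 0) = _
    rw [Matrix.one_apply]
    split_ifs <;> simp
  have hB : IsUnit B := by
    refine (isGrDivisionRing hP h𝒜).hasHomogInverses.isUnit_of_mulVec (α := β) (β := α)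
      (fun j k => solution_mem (ht k) j) fun γ v _ hv => ?_
    rw [← Matrix.one_mulVec v, ← hAB, ← Matrix.mulVec_mulVec, hv, Matrix.mulVec_zero]
  obtain ⟨C, hBC, hCB⟩ := isUnit_matrix_iff.1 hB
  have : A.map (hom hP h𝒜) = C := by rw [← mul_one (A.map _), ← hBC, ← mul_assoc, hAB, one_mul]
  exact isUnit_matrix_iff.2 ⟨B, hAB, this ▸ hBC⟩

end GrLocalization

/-- A homogeneous invertible matrix over a graded division ring has an invertible minor that
avoids the first column. -/
theorem HasHomogInverses.exists_isUnit_minor {G : Type v} [Group G] {D : Type u} [Ring D]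
    {𝒟 : G → AddSubgroup D} (h : HasHomogInverses 𝒟) {n : ℕ} {α β : Fin (n + 1) → G}
    {M : Matrix (Fin (n + 1)) (Fin (n + 1)) D} (hM : Homog 𝒟 α β M) (hu : IsUnit M) :
    ∃ i : Fin (n + 1), IsUnit (M.submatrix i.succAbove Fin.succ) := by
  have := h.nontrivial
  obtain ⟨B, hB, hMB⟩ := h.exists_right_inverse hM fun γ v _ hv =>
    eq_zero_of_isUnit_of_mulVec hu hv
  have hBM : B * M = 1 := by
    obtain ⟨C, h1, h2⟩ := isUnit_matrix_iff.1 hu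
    have : B = C := by rw [← one_mul B, ← h2, mul_assoc, hMB, mul_one]
    rw [this, h2]
  -- A nonzero entry in row `0` of the inverse marks the row to delete. A vector `v` in the kernel
  -- of the minor extends by `0` to `v'` with `M v'` supported at `i`, and then `B 0 i * (M v')ᵢ =
  -- v' 0 = 0`.
  obtain ⟨i, hi⟩ : ∃ i, B 0 i ≠ 0 := by
    by_contra! h0
    have := congrFun (congrFun hBM 0) 0
    rw [Matrix.mul_apply] at this
    simp [h0] at this
  refine ⟨i, h.isUnit_of_mulVec (hM.submatrix _ _) fun γ v _ hv => ?_⟩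
  let v' : Fin (n + 1) → D := Fin.cons 0 v
  have h1 : ∀ k, M.mulVec v' (i.succAbove k) = 0 := fun k => by
    have := congrFun hv k
    simpa [Matrix.mulVec, dotProduct, Fin.sum_univ_succ, v'] using this
  have h2 : B 0 i * M.mulVec v' i = 0 := by
    have h3 : B.mulVec (M.mulVec v') 0 = 0 := by
      rw [Matrix.mulVec_mulVec, hBM, Matrix.one_mulVec]; rfl
    rw [Matrix.mulVec, dotProduct, Fin.sum_univ_succAbove _ i] at h3
    simpa [h1] using h3
  obtain ⟨y, -, -, hy⟩ := h.exists_inv (hB 0 i) hi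
  have h4 : M.mulVec v' i = 0 := by
    rw [← one_mul (M.mulVec v' i), ← hy, mul_assoc, h2, mul_zero]
  have h5 : v' = 0 := eq_zero_of_isUnit_of_mulVec hu (funext fun k => by
    rcases Fin.eq_self_or_eq_succAbove i k with rfl | ⟨k, rfl⟩
    exacts [h4, h1 k])
  exact funext fun k => by simpa [v'] using congrFun h5 k.succ

namespace GrLocalization

variable {G : Type v} {R : Type u} [Ring R] [Group G] {𝒜 : G → AddSubgroup R}
  {P : Set (SqMatrix R)} [DecidableEq G] {hP : IsGrPrimeMatrixIdeal 𝒜 P} {h𝒜 : IsGrading 𝒜}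

/-- Induction on the size. An invertible minor is not in `P`, so `A` is, up to permutation, the
bordered matrix of an admissible datum. If `A` were in `P`, the represented element would be zero,
and the solution of the system extended by `-1` would be a nonzero kernel vector of `A`. -/
theorem not_sing_of_isUnit_map : ∀ (n : ℕ) {α β : Fin n → G} {A : Matrix (Fin n) (Fin n) R},
    Homog 𝒜 α β A → IsUnit (A.map (hom hP h𝒜)) → ¬ Sing P A := by
  intro n
  have hD := (isGrDivisionRing hP h𝒜).hasHomogInverses
  have := hD.nontrivial
  induction n with
  | zero => exact fun {_ _ A} _ _ => hP.not_sing_of_isEmpty h𝒜 A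
  | succ n ih =>
    intro α β A hA hu hs
    obtain ⟨i, hi⟩ := hD.exists_isUnit_minor (homog_map_hom hA) hu
    let t : SchurDatum G R :=
      { index := Fin n
        rowDeg := α ∘ i.succAbove
        colDeg := β ∘ Fin.succ
        A := A.submatrix i.succAbove Fin.succ
        x := A.submatrix i.succAbove fun _ => 0
        f := A.submatrix (fun _ => i) Fin.succ
        c := -A.submatrix (fun _ => i) fun _ => 0 }
    have ht : t.IsAdmissible 𝒜 P (α i) (β 0) :=
      ⟨⟨hA.submatrix _ _, hA.submatrix _ fun _ => 0, hA.submatrix (fun _ => i) _,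
        (hA.submatrix (fun _ => i) fun _ => 0).neg⟩, ih (hA.submatrix _ _) hi⟩
    have h0 : t.IsNull P := by
      refine (Sing.of_submatrix_eq
        ((Equiv.optionEquivSumPUnit _).symm.trans (finSuccEquiv' i).symm)
        ((Equiv.optionEquivSumPUnit _).symm.trans (finSuccEquiv' 0).symm) ?_).2 hs
      rintro (k | k) (l | l) <;> simp [t, SchurDatum.mat]
    rw [← elem_eq_zero_iff (hP := hP) (h𝒜 := h𝒜) ht, elem_eq_sum] at h0
    let w : Fin (n + 1) → GrLocalization hP h𝒜 := Fin.cons (-1) (solution hP h𝒜 ht)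
    have hw : w = 0 := by
      refine eq_zero_of_isUnit_of_mulVec hu (funext fun k => ?_)
      rw [Matrix.mulVec, dotProduct, Fin.sum_univ_succ]
      rcases Fin.eq_self_or_eq_succAbove i k with rfl | ⟨k, rfl⟩
      · have h1 : ∑ j : Fin n, hom hP h𝒜 (A k j.succ) * solution hP h𝒜 ht j +
          hom hP h𝒜 (-A k 0) = 0 := h0
        simpa [w, add_comm] using h1
      · have h1 : ∑ j : Fin n, hom hP h𝒜 (A (i.succAbove k) j.succ) * solution hP h𝒜 ht j =
          hom hP h𝒜 (A (i.succAbove k) 0) := mulVec_solution ht k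
        simp [w, h1]
    have := congrFun hw 0
    simp [w] at this

/-- The homogeneous matrices that are not invertible over the localization are those of the
matrix ideal. -/
theorem isUnit_map_hom_iff {A : SqMatrix R} (hA : A ∈ homSqMatrices 𝒜) :
    IsUnit (A.2.map (hom hP h𝒜)) ↔ A ∉ P := by
  obtain ⟨n, A⟩ := A
  obtain ⟨α, β, hA⟩ := hA
  rw [← hP.sing_mk_iff]
  exact ⟨not_sing_of_isUnit_map n hA, isUnit_map_hom hA⟩

end GrLocalization

end

/-! ### Graded division closures and the realization of gr-prime matrix ideals. -/

section Closure

variable {G : Type v} [Group G] {R : Type u} [Ring R] {𝒜 : G → AddSubgroup R}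
  {D : Type w} [Ring D] {𝒟 : G → AddSubgroup D} {φ : R →+* D}

theorem map_mem_grDivisionClosure (r : R) : φ r ∈ grDivisionClosure 𝒟 φ :=
  Subring.mem_sInf.2 fun _ hS => hS.1 ⟨r, rfl⟩

theorem inverse_mem_grDivisionClosure {g : G} {x : D} (hx : x ∈ 𝒟 g)
    (hx' : x ∈ grDivisionClosure 𝒟 φ) (hu : IsUnit x) :
    Ring.inverse x ∈ grDivisionClosure 𝒟 φ :=
  Subring.mem_sInf.2 fun S hS => hS.2 g x hx (Subring.mem_sInf.1 hx' S hS) hu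

theorem grDivisionClosure_le {S : Subring D} (h : φ.range ≤ S)
    (h' : ∀ (g : G) (x : D), x ∈ 𝒟 g → x ∈ S → IsUnit x → Ring.inverse x ∈ S) :
    grDivisionClosure 𝒟 φ ≤ S := sInf_le ⟨h, h'⟩

theorem IsGrading.inverse_mem (h : IsGrading 𝒟) {g : G} {x : D} (hx : x ∈ 𝒟 g) (hu : IsUnit x) :
    Ring.inverse x ∈ 𝒟 g⁻¹ := by
  obtain ⟨y, hy, h1, h2⟩ := h.exists_inv hx hu
  have : Ring.inverse x = y := by
    rw [← mul_one (Ring.inverse x), ← h1, Ring.inverse_mul_cancel_left _ _ hu]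
  exact this ▸ hy

/-- The graded division closure contains the homogeneous components of its elements. -/
theorem proj_mem_grDivisionClosure (h𝒜 : IsGrading 𝒜) (h𝒟 : IsGrading 𝒟)
    (hφ : ∀ g, ∀ r ∈ 𝒜 g, φ r ∈ 𝒟 g) {x : D} (hx : x ∈ grDivisionClosure 𝒟 φ) (g : G) :
    h𝒟.proj g x ∈ grDivisionClosure 𝒟 φ := by
  let S := grDivisionClosure 𝒟 φ
  -- The sum of the homogeneous parts of `S` is a subring containing the image of `φ` and closed
  -- under homogeneous inverses, so minimality of `S` makes it all of `S`.
  let 𝒮 : G → AddSubgroup D := fun g => S.toAddSubgroup ⊓ 𝒟 g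
  have hle : ∀ g, 𝒮 g ≤ ⨆ g, 𝒮 g := le_iSup 𝒮
  let T : Subring D :=
    { (⨆ g, 𝒮 g : AddSubgroup D) with
      one_mem' := hle 1 ⟨one_mem S, h𝒟.one_mem⟩
      mul_mem' := by
        intro x y hx hy
        refine AddSubgroup.iSup_induction 𝒮 (C := fun x => x * y ∈ ⨆ g, 𝒮 g) hx ?_ ?_ ?_
        · intro g x hx
          refine AddSubgroup.iSup_induction 𝒮 (C := fun y => x * y ∈ ⨆ g, 𝒮 g) hy ?_ ?_ ?_
          · intro k y hy
            exact hle (g * k) ⟨S.mul_mem hx.1 hy.1, h𝒟.mul_mem hx.2 hy.2⟩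
          · rw [mul_zero]; exact zero_mem _
          · intro y z hy hz; rw [mul_add]; exact add_mem hy hz
        · rw [zero_mul]; exact zero_mem _
        · intro y z hy hz; rw [add_mul]; exact add_mem hy hz }
  have hTS : T ≤ S := by
    intro x hx
    exact (iSup_le fun g => inf_le_left : ⨆ g, 𝒮 g ≤ S.toAddSubgroup) hx
  have hST : S ≤ T := by
    refine grDivisionClosure_le ?_ fun g x hx hxT hu => ?_
    · rintro _ ⟨r, rfl⟩
      induction r using h𝒜.induction with
      | hom g r hr => exact hle g ⟨map_mem_grDivisionClosure r, hφ g r hr⟩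
      | add r s hr hs => rw [map_add]; exact add_mem hr hs
    · exact hle g⁻¹ ⟨inverse_mem_grDivisionClosure hx (hTS hxT) hu, h𝒟.inverse_mem hx hu⟩
  refine AddSubgroup.iSup_induction 𝒮 (C := fun x => h𝒟.proj g x ∈ S) (hST hx) ?_ ?_ ?_
  · intro k x hx
    rw [h𝒟.proj_apply_of_mem hx.2]
    split_ifs
    exacts [hx.1, zero_mem S]
  · rw [map_zero]; exact zero_mem S
  · intro y z hy hz; rw [map_add]; exact S.add_mem hy hz

/-- Formal expressions in the elements of a ring and inverses. -/
inductive RationalTerm (R : Type u) : Type u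
  | of (r : R)
  | add (s t : RationalTerm R)
  | mul (s t : RationalTerm R)
  | neg (t : RationalTerm R)
  | inv (t : RationalTerm R)

/-- The value of a rational expression. -/
noncomputable def RationalTerm.eval (φ : R →+* D) : RationalTerm R → D
  | of r => φ r
  | add s t => s.eval φ + t.eval φ
  | mul s t => s.eval φ * t.eval φ
  | neg t => -t.eval φ
  | inv t => Ring.inverse (t.eval φ)

/-- Every element of the closure is the value of a rational expression in elements of `R`. This
brings the closure back to the universe of `R`, whatever the universe of `D`. -/
instance small_grDivisionClosure : Small.{u} (grDivisionClosure 𝒟 φ) := by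
  let T : Subring D :=
    { carrier := Set.range (RationalTerm.eval φ)
      zero_mem' := ⟨.of 0, map_zero φ⟩
      one_mem' := ⟨.of 1, map_one φ⟩
      add_mem' := by rintro _ _ ⟨s, rfl⟩ ⟨t, rfl⟩; exact ⟨.add s t, rfl⟩
      mul_mem' := by rintro _ _ ⟨s, rfl⟩ ⟨t, rfl⟩; exact ⟨.mul s t, rfl⟩
      neg_mem' := by rintro _ ⟨t, rfl⟩; exact ⟨.neg t, rfl⟩ }
  have h : grDivisionClosure 𝒟 φ ≤ T := by
    refine grDivisionClosure_le ?_ ?_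
    · rintro _ ⟨r, rfl⟩; exact ⟨.of r, rfl⟩
    · rintro g _ - ⟨t, rfl⟩ -; exact ⟨.inv t, rfl⟩
  exact small_subset (s := Set.range (RationalTerm.eval φ)) h

/-- A subring of a graded division ring that is closed under homogeneous components and inverses
of homogeneous elements is a graded division ring. -/
theorem IsGrDivisionRing.comap (hD : IsGrDivisionRing 𝒟) {K : Type u} [Ring K] (η : K →+* D)
    (hη : Function.Injective η) (hproj : ∀ x g, ∃ y, η y = hD.proj g (η x))
    (hinv : ∀ x g, η x ∈ 𝒟 g → x ≠ 0 → ∃ y, η y = Ring.inverse (η x)) :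
    IsGrDivisionRing fun g => (𝒟 g).comap η.toAddMonoidHom := by
  have := hD.nontrivial
  choose p hp using hproj
  let q : G → K →+ K := fun g =>
    { toFun := fun x => p x g
      map_zero' := hη (by simp [hp])
      map_add' := fun x y => hη (by simp [hp]) }
  have hq : ∀ g x, η (q g x) = hD.proj g (η x) := fun g x => hp x g
  refine ⟨⟨?_, ?_, isInternal_of_proj q ?_ ?_ ?_⟩, η.domain_nontrivial, ?_⟩
  · change η 1 ∈ 𝒟 1
    rw [map_one]; exact hD.one_mem
  · intro g k x y hx hy
    change η (x * y) ∈ 𝒟 (g * k)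
    rw [map_mul]; exact hD.mul_mem hx hy
  · intro g x hx
    exact hη ((hq g x).trans (hD.proj_same hx))
  · intro g k hgk x hx
    exact hη ((hq k x).trans ((hD.proj_ne hgk hx).trans (map_zero η).symm))
  · rw [eq_top_iff]
    intro x _
    obtain ⟨s, hs, -⟩ := hD.exists_finset_sum (η x)
    have : x = ∑ g ∈ s, q g x := hη (by rw [map_sum]; simp_rw [hq]; exact hs)
    rw [this]
    refine sum_mem fun g _ => AddSubgroup.mem_iSup_of_mem
      (S := fun g => (𝒟 g).comap η.toAddMonoidHom) g ?_
    change η (q g x) ∈ 𝒟 g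
    rw [hq]; exact hD.proj_mem g _
  · intro g x hx hx0
    obtain ⟨y, hy⟩ := hinv x g hx hx0
    have hu : IsUnit (η x) := hD.isUnit_of_mem g _ hx fun h => hx0 (hη (h.trans (map_zero η).symm))
    refine ⟨⟨x, y, hη ?_, hη ?_⟩, rfl⟩
    · rw [map_mul, hy, Ring.mul_inverse_cancel _ hu, map_one]
    · rw [map_mul, hy, Ring.inverse_mul_cancel _ hu, map_one]

/-- A homomorphism to a graded division ring, of any size, gives a graded epic division ring. -/
theorem exists_grEpicDivisionRing (h𝒜 : IsGrading 𝒜) (hD : IsGrDivisionRing 𝒟)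
    (hφ : ∀ g, ∀ r ∈ 𝒜 g, φ r ∈ 𝒟 g) : ∃ K : GrEpicDivisionRing 𝒜,
      (∀ A ∈ homSqMatrices 𝒜, K.Inverts A ↔ IsUnit (A.2.map φ)) ∧
      (Function.Injective φ → K.IsOfFractions) := by
  let S := grDivisionClosure 𝒟 φ
  let e : Shrink.{u} S ≃+* S := Shrink.ringEquiv S
  let η : Shrink.{u} S →+* D := S.subtype.comp e.toRingHom
  have hη : Function.Injective η := Subtype.val_injective.comp e.injective
  have hS : ∀ {y}, y ∈ S → ∃ x, η x = y := fun {y} hy =>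
    ⟨e.symm ⟨y, hy⟩, congrArg Subtype.val (e.apply_symm_apply ⟨y, hy⟩)⟩
  have hS' : ∀ x, η x ∈ S := fun x => (e x).2
  let ψ : R →+* Shrink.{u} S := e.symm.toRingHom.comp (φ.codRestrict S map_mem_grDivisionClosure)
  have hψ : ∀ r, η (ψ r) = φ r := fun r =>
    congrArg Subtype.val (e.apply_symm_apply ⟨φ r, map_mem_grDivisionClosure r⟩)
  have hK : IsGrDivisionRing fun g => (𝒟 g).comap η.toAddMonoidHom := hD.comap η hη
    (fun x g => hS (proj_mem_grDivisionClosure h𝒜 hD.toIsGrading hφ (hS' x) g))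
    fun x g hx hx0 => hS (inverse_mem_grDivisionClosure hx (hS' x)
      (hD.isUnit_of_mem g _ hx fun h => hx0 (hη (h.trans (map_zero η).symm))))
  have hψ' : ∀ g, ∀ r ∈ 𝒜 g, ψ r ∈ (𝒟 g).comap η.toAddMonoidHom := by
    intro g r hr
    change η (ψ r) ∈ 𝒟 g
    rw [hψ]; exact hφ g r hr
  refine ⟨⟨Shrink.{u} S, _, hK, ψ, hψ', ?_⟩, ?_, ?_⟩
  -- A subring of the shrunken copy that has the closure properties maps to a subring of `D` with
  -- the same properties, which therefore contains `S`.
  · refine top_unique (le_sInf fun T hT x _ => ?_)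
    have h1 : S ≤ T.map η := by
      refine grDivisionClosure_le ?_ ?_
      · rintro _ ⟨r, rfl⟩
        exact ⟨ψ r, hT.1 ⟨r, rfl⟩, hψ r⟩
      · rintro g _ hx ⟨x, hxT, rfl⟩ hu
        have := hD.nontrivial
        have hux : IsUnit x := hK.isUnit_of_mem g x hx fun h => by
          rw [h, map_zero] at hu
          exact not_isUnit_zero hu
        refine ⟨_, hT.2 g x hx hxT hux, ?_⟩
        obtain ⟨x, rfl⟩ := hux
        rw [Ring.inverse_unit]
        exact (Ring.inverse_unit (Units.map (η : _ →* D) x)).symm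
    obtain ⟨y, hy, hyx⟩ := h1 (hS' x)
    exact hη hyx ▸ hy
  · rintro ⟨n, A⟩ ⟨α, β, hA⟩
    have := hD.nontrivial
    have hA' : Homog 𝒜 α β A := hA
    rw [show A.map φ = (A.map ψ).map η from Matrix.ext fun i j => (hψ _).symm,
      hK.hasHomogInverses.isUnit_map_iff η (hA'.map hψ')]
    rfl
  · intro h r s hrs
    exact h (by rw [← hψ, ← hψ]; exact congrArg η hrs)

/-- Every graded prime matrix ideal is the singular kernel of a graded epic division ring. -/
theorem exists_singularKernel_eq (h𝒜 : IsGrading 𝒜) {P : Set (SqMatrix R)}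
    (hP : P ∈ grSpec 𝒜) : ∃ K : GrEpicDivisionRing 𝒜, K.singularKernel = P := by
  classical
  replace hP : IsGrPrimeMatrixIdeal 𝒜 P := hP
  obtain ⟨K, hK, -⟩ := exists_grEpicDivisionRing h𝒜 (GrLocalization.isGrDivisionRing hP h𝒜)
    (φ := GrLocalization.hom hP h𝒜) fun _ _ hr => GrLocalization.hom_mem hr
  refine ⟨K, Set.ext fun A => ⟨fun hA => ?_, fun hA => ?_⟩⟩
  · have h1 := hA.2
    rw [hK A hA.1, GrLocalization.isUnit_map_hom_iff hA.1, not_not] at h1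
    exact h1
  · have h1 := hP.subset_hom hA
    refine ⟨h1, ?_⟩
    rw [hK A h1, GrLocalization.isUnit_map_hom_iff h1, not_not]
    exact hA

end Closure

/-! ### Passing from a coarser grading to a finer one. -/

section Refinement

variable {G : Type v} [Group G] {R : Type u} [Ring R] {𝒜 : G → AddSubgroup R}
  {G' : Type w} [Group G'] {ℬ : G' → AddSubgroup R} {π : G →* G'}

open DirectSum in
/-- A graded epic division ring for a coarser grading gives one for a finer grading. -/
theorem exists_corresponding (h𝒜 : IsGrading 𝒜) (h : ∀ g, 𝒜 g ≤ ℬ (π g))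
    (K' : GrEpicDivisionRing ℬ) : ∃ K : GrEpicDivisionRing 𝒜,
      (∀ A ∈ homSqMatrices 𝒜, K.Inverts A ↔ K'.Inverts A) ∧
      (K'.IsOfFractions → K.IsOfFractions) := by
  classical
  have hK' := K'.isGrDivisionRing
  have := hK'.nontrivial
  -- Each degree `g` receives its own copy of the component of degree `π g`. The sum map `ε` to `K'`
  -- need not be injective, but it detects invertibility of homogeneous matrices, and `ε ∘ φ =
  -- K'.hom`.
  let C : Additive G → AddSubgroup K'.carrier := fun g => K'.grading (π g.toMul)
  have : SetLike.GradedMonoid C :=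
    { one_mem := by
        change 1 ∈ K'.grading (π 1)
        rw [map_one]; exact hK'.one_mem
      mul_mem := by
        intro g k x y hx hy
        change x * y ∈ K'.grading (π (g.toMul * k.toMul))
        rw [map_mul]; exact hK'.mul_mem hx hy }
  let ε : (⨁ g, C g) →+* K'.carrier := DirectSum.coeRingHom C
  have hC : IsGrading fun g : G => (DirectSum.of (fun g => C g) (Additive.ofMul g)).range :=
    isGrading_range_of fun g => C g
  have hD : IsGrDivisionRing
      fun g : G => (DirectSum.of (fun g => C g) (Additive.ofMul g)).range := by
    refine ⟨hC, ε.domain_nontrivial, ?_⟩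
    rintro g _ ⟨⟨x, hx⟩, rfl⟩ hx0
    have hx1 : x ≠ 0 := by
      rintro rfl
      exact hx0 (map_zero (DirectSum.of (fun g => C g) (Additive.ofMul g)))
    obtain ⟨y, hy, h1, h2⟩ := hK'.toIsGrading.exists_inv hx (hK'.isUnit_of_mem _ _ hx hx1)
    have hy' : y ∈ C (Additive.ofMul g⁻¹) := by
      change y ∈ K'.grading (π g⁻¹)
      rw [map_inv]; exact hy
    refine ⟨⟨_, DirectSum.of (fun g => C g) (Additive.ofMul g⁻¹) ⟨y, hy'⟩, ?_, ?_⟩, rfl⟩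
    · rw [DirectSum.of_mul_of]
      refine DirectSum.of_eq_of_gradedMonoid_eq (Sigma.subtype_ext ?_ h1)
      exact congrArg Additive.ofMul (mul_inv_cancel g)
    · rw [DirectSum.of_mul_of]
      refine DirectSum.of_eq_of_gradedMonoid_eq (Sigma.subtype_ext ?_ h2)
      exact congrArg Additive.ofMul (inv_mul_cancel g)
  let f : ∀ g : G, 𝒜 g →+ ⨁ g, C g := fun g =>
    (DirectSum.of (fun g => C g) (Additive.ofMul g)).comp
      ((K'.hom.toAddMonoidHom.comp (𝒜 g).subtype).codRestrict (C (Additive.ofMul g))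
        fun r => K'.hom_mem _ _ (h g r.2))
  have hone : f 1 ⟨1, h𝒜.one_mem⟩ = 1 := by
    refine DirectSum.of_eq_of_gradedMonoid_eq (Sigma.subtype_ext rfl ?_)
    exact map_one K'.hom
  have hmul : ∀ g k (x : 𝒜 g) (y : 𝒜 k),
      f (g * k) ⟨x * y, h𝒜.mul_mem x.2 y.2⟩ = f g x * f k y := by
    intro g k x y
    refine Eq.trans ?_ (DirectSum.of_mul_of _ _).symm
    refine DirectSum.of_eq_of_gradedMonoid_eq (Sigma.subtype_ext rfl ?_)
    exact map_mul K'.hom (x : R) y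
  let φ : R →+* ⨁ g, C g := h𝒜.liftRing f hone hmul
  have hφ : ∀ g, ∀ r ∈ 𝒜 g,
      φ r ∈ (DirectSum.of (fun g => C g) (Additive.ofMul g)).range := fun g r hr => by
    rw [show φ r = f g ⟨r, hr⟩ from h𝒜.liftRing_of_mem f hone hmul hr]
    exact ⟨_, rfl⟩
  have hε : ∀ r, ε (φ r) = K'.hom r := by
    intro r
    induction r using h𝒜.induction with
    | hom g r hr =>
      rw [show φ r = f g ⟨r, hr⟩ from h𝒜.liftRing_of_mem f hone hmul hr]
      exact DirectSum.coeRingHom_of C _ _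
    | add r s hr hs => rw [map_add, map_add, map_add, hr, hs]
  obtain ⟨K, hK, hK2⟩ := exists_grEpicDivisionRing h𝒜 hD hφ
  refine ⟨K, fun A hA => (hK A hA).trans ?_, fun hinj => hK2 fun r s hrs => hinj ?_⟩
  · obtain ⟨n, A⟩ := A
    obtain ⟨α, β, hA⟩ := hA
    have hA' : Homog 𝒜 α β A := hA
    rw [← hD.hasHomogInverses.isUnit_map_iff ε (hA'.map hφ), GrEpicDivisionRing.Inverts]
    rw [show (A.map φ).map ε = A.map K'.hom from Matrix.ext fun i j => hε _]
  · rw [← hε, ← hε, hrs]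

theorem singularKernel_eq_restrictTo_iff (h : ∀ g, 𝒜 g ≤ ℬ (π g)) {K : GrEpicDivisionRing 𝒜}
    {K' : GrEpicDivisionRing ℬ} : K.singularKernel = restrictTo 𝒜 K'.singularKernel ↔
      ∀ A ∈ homSqMatrices 𝒜, K.Inverts A ↔ K'.Inverts A := by
  constructor
  · intro h1 A hA
    have h2 := Set.ext_iff.1 h1 A
    have h3 := homSqMatrices_mono h hA
    simp only [GrEpicDivisionRing.singularKernel, restrictTo, Set.mem_ofPred_eq, Set.mem_inter_iff,
      hA, h3, true_and, and_true] at h2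
    exact not_iff_not.1 h2
  · intro h1
    ext A
    simp only [GrEpicDivisionRing.singularKernel, restrictTo, Set.mem_ofPred_eq, Set.mem_inter_iff]
    constructor
    · rintro ⟨hA, hA'⟩
      exact ⟨⟨homSqMatrices_mono h hA, fun h2 => hA' ((h1 A hA).2 h2)⟩, hA⟩
    · rintro ⟨⟨-, hA'⟩, hA⟩
      exact ⟨hA, fun h2 => hA' ((h1 A hA).1 h2)⟩

end Refinement

/-! ### Construction of gr-specializations. -/

section Subring

variable {G : Type v} [Group G] {S : Type u} [Ring S]

/-- The sum of a family of additive subgroups that multiply according to their degrees. -/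
def subringISup (T : G → AddSubgroup S) (hone : 1 ∈ T 1)
    (hmul : ∀ {g k x y}, x ∈ T g → y ∈ T k → x * y ∈ T (g * k)) : Subring S :=
  { (⨆ g, T g : AddSubgroup S) with
    one_mem' := le_iSup T 1 hone
    mul_mem' := by
      intro x y hx hy
      refine AddSubgroup.iSup_induction T (C := fun x => x * y ∈ ⨆ g, T g) hx ?_ ?_ ?_
      · intro g x hx
        refine AddSubgroup.iSup_induction T (C := fun y => x * y ∈ ⨆ g, T g) hy ?_ ?_ ?_
        · exact fun k y hy => le_iSup T (g * k) (hmul hx hy)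
        · rw [mul_zero]; exact zero_mem _
        · intro y z hy hz; rw [mul_add]; exact add_mem hy hz
      · rw [zero_mul]; exact zero_mem _
      · intro y z hy hz; rw [add_mul]; exact add_mem hy hz }

end Subring

section MatrixUnits

variable {S : Type*} [Ring S] {ι κ : Type*} [Fintype ι] [Fintype κ] [DecidableEq ι] [DecidableEq κ]

theorem isUnit_fromBlocks_upper {A : Matrix ι ι S} {B : Matrix ι κ S} {D : Matrix κ κ S}
    (hA : IsUnit A) (hD : IsUnit D) : IsUnit (Matrix.fromBlocks A B 0 D) := by
  obtain ⟨A', h1, h2⟩ := isUnit_matrix_iff.1 hA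
  obtain ⟨D', h3, h4⟩ := isUnit_matrix_iff.1 hD
  refine isUnit_matrix_iff.2 ⟨Matrix.fromBlocks A' (-(A' * B * D')) 0 D', ?_, ?_⟩
  · rw [Matrix.fromBlocks_multiply, ← Matrix.fromBlocks_one]
    simp [h1, h3, ← Matrix.mul_assoc]
  · rw [Matrix.fromBlocks_multiply, ← Matrix.fromBlocks_one]
    simp [h2, h4, Matrix.mul_assoc]

end MatrixUnits

/-- The inverse of a homogeneous matrix over a graded division ring is homogeneous. -/
theorem HasHomogInverses.homog_of_mul_eq_one {G : Type v} [Group G] {D : Type u} [Ring D]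
    {𝒟 : G → AddSubgroup D} (h : HasHomogInverses 𝒟) {ι : Type*} [Fintype ι] [DecidableEq ι]
    {α β : ι → G} {A B : Matrix ι ι D} (hA : Homog 𝒟 α β A) (hBA : B * A = 1) :
    Homog 𝒟 β α B := by
  obtain ⟨C, hC, hAC⟩ := h.exists_right_inverse hA fun γ v _ hv => by
    rw [← Matrix.one_mulVec v, ← hBA, ← Matrix.mulVec_mulVec, hv, Matrix.mulVec_zero]
  have : B = C := by rw [← Matrix.mul_one B, ← hAC, ← Matrix.mul_assoc, hBA, Matrix.one_mul]
  exact this ▸ hC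

namespace SchurDatum

variable {G : Type v} [Group G] {R : Type u} [Ring R] {𝒜 : G → AddSubgroup R}
  {D : Type w} [Ring D] {𝒟 : G → AddSubgroup D} {φ : R →+* D} {t u : SchurDatum G R} {g k : G}
  {x y : D}

/-- The element `c + f A⁻¹ x` represented by a datum over a ring, when `A⁻¹ x` makes sense. -/
def Represents (𝒟 : G → AddSubgroup D) (φ : R →+* D) (t : SchurDatum G R) (y : D) : Prop :=
  ∃ w : t.index → D, (∀ i, w i ∈ 𝒟 (t.colDeg i)) ∧
    (∀ i, ∑ j, φ (t.A i j) * w j = φ (t.x i ())) ∧ y = ∑ j, φ (t.f () j) * w j + φ (t.c () ())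

namespace Represents

theorem mem (hD : HasHomogInverses 𝒟) (hφ : ∀ g, ∀ r ∈ 𝒜 g, φ r ∈ 𝒟 g)
    (ht : t.IsHomog 𝒜 g 1) (h : t.Represents 𝒟 φ y) : y ∈ 𝒟 g := by
  obtain ⟨w, hw, -, rfl⟩ := h
  refine add_mem (sum_mem fun j _ => ?_) ?_
  · simpa using hD.mul_mem (hφ _ _ (ht.f () j)) (hw j)
  · simpa using hφ _ _ (ht.c () ())

theorem add (hx : t.Represents 𝒟 φ x) (hy : u.Represents 𝒟 φ y) :
    (t.add u).Represents 𝒟 φ (x + y) := by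
  obtain ⟨w, hw, hw', rfl⟩ := hx
  obtain ⟨z, hz, hz', rfl⟩ := hy
  refine ⟨Sum.elim w z, ?_, ?_, ?_⟩
  · rintro (i | i); exacts [hw i, hz i]
  · rintro (i | i)
    · refine (Fintype.sum_sum_type _).trans ?_
      simpa [SchurDatum.add] using hw' i
    · refine (Fintype.sum_sum_type _).trans ?_
      simpa [SchurDatum.add] using hz' i
  · refine Eq.trans ?_ (congrArg₂ _ (Fintype.sum_sum_type _).symm rfl)
    simp [SchurDatum.add]
    abel

theorem neg (hx : t.Represents 𝒟 φ x) : t.neg.Represents 𝒟 φ (-x) := by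
  obtain ⟨w, hw, hw', rfl⟩ := hx
  have h1 : ∀ i, ∑ j, φ (t.A i j) * -w j = φ (-t.x i ()) := fun i => by
    rw [map_neg, ← hw' i, ← Finset.sum_neg_distrib]
    exact Finset.sum_congr rfl fun j _ => mul_neg _ _
  have h2 : -(∑ j, φ (t.f () j) * w j + φ (t.c () ())) =
      ∑ j, φ (t.f () j) * -w j + φ (-t.c () ()) := by
    simp only [mul_neg, Finset.sum_neg_distrib, map_neg]
    abel
  exact ⟨fun i => -w i, fun i => neg_mem (hw i), h1, h2⟩

theorem const (r : R) : (SchurDatum.const (G := G) r).Represents 𝒟 φ (φ r) :=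
  ⟨fun i => i.elim, fun i => i.elim, fun i => i.elim, by
    change _ = ∑ j : Empty, _ + φ r
    simp⟩

/-- The system of the product is solved by `w * y` on the coordinates of `t` and by `z` on those of
`u`, because `y - u.f z = u.c`. -/
theorem mul (hD : HasHomogInverses 𝒟) (hφ : ∀ g, ∀ r ∈ 𝒜 g, φ r ∈ 𝒟 g)
    (hu : u.IsHomog 𝒜 k 1) (hx : t.Represents 𝒟 φ x) (hy : u.Represents 𝒟 φ y) :
    ((t.shift k).mul u).Represents 𝒟 φ (x * y) := by
  have hyk := hy.mem hD hφ hu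
  obtain ⟨w, hw, hw', rfl⟩ := hx
  obtain ⟨z, hz, hz', hy⟩ := hy
  have h1 : ∀ i, ∑ j, φ (t.A i j) * (w j * y) + ∑ j, φ ((-(t.x * u.f)) i j) * z j =
      φ ((t.x * u.c) i ()) := fun i => by
    have e1 : ∑ j, φ (t.A i j) * (w j * y) = φ (t.x i ()) * y := by
      simp_rw [← mul_assoc]
      rw [← Finset.sum_mul, hw']
    have e2 : ∑ j, φ ((-(t.x * u.f)) i j) * z j = -(φ (t.x i ()) * ∑ j, φ (u.f () j) * z j) := by
      rw [Finset.mul_sum, ← Finset.sum_neg_distrib]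
      exact Finset.sum_congr rfl fun j _ => by simp [Matrix.mul_apply, mul_assoc]
    rw [e1, e2]
    nth_rw 1 [hy]
    simp [Matrix.mul_apply, mul_add]
  have h2 : ∀ i, ∑ j, φ ((0 : Matrix u.index t.index R) i j) * (w j * y) +
      ∑ j, φ (u.A i j) * z j = φ (u.x i ()) := fun i => by simp [hz']
  have h3 : (∑ j, φ (t.f () j) * w j + φ (t.c () ())) * y = ∑ j, φ (t.f () j) * (w j * y) +
      ∑ j, φ ((t.c * u.f) () j) * z j + φ ((t.c * u.c) () ()) := by
    simp only [Matrix.mul_apply, Finset.univ_unique, Finset.sum_singleton, map_mul, mul_assoc,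
      ← Finset.mul_sum, add_assoc]
    rw [← mul_add, show (default : Unit) = () from rfl, ← hy, add_mul, Finset.sum_mul]
    simp_rw [mul_assoc]
  refine ⟨Sum.elim (fun i => w i * y) z, ?_, ?_, ?_⟩
  · rintro (i | i); exacts [hD.mul_mem (hw i) hyk, hz i]
  · rintro (i | i)
    · exact (Fintype.sum_sum_type _).trans (h1 i)
    · exact (Fintype.sum_sum_type _).trans (h2 i)
  · refine h3.trans (congrArg₂ _ (Eq.symm ?_) rfl)
    exact Fintype.sum_sum_type _

theorem not_isUnit_mat [Nontrivial D] (h : t.Represents 𝒟 φ 0) : ¬ IsUnit (t.mat.map φ) := by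
  intro hu
  obtain ⟨w, hw, hw', h0⟩ := h
  have h1 : (Sum.elim w fun _ => -1 : t.index ⊕ Unit → D) = 0 := by
    refine eq_zero_of_isUnit_of_mulVec hu (funext ?_)
    rintro (i | i)
    · simp [Matrix.mulVec, dotProduct, Fintype.sum_sum_type, mat, hw']
    · simpa [Matrix.mulVec, dotProduct, Fintype.sum_sum_type, mat] using h0.symm
  simpa using congrFun h1 (Sum.inr ())

/-- Eliminating the first block from a kernel vector leaves `y` times its last coordinate equal to
zero. With `not_isUnit_mat`, vanishing of the value becomes a matrix condition that can be moved
between two rings. -/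
theorem isUnit_mat (hD : HasHomogInverses 𝒟) (hφ : ∀ g, ∀ r ∈ 𝒜 g, φ r ∈ 𝒟 g)
    (ht : t.IsHomog 𝒜 g 1) (hA : IsUnit (t.A.map φ)) (h : t.Represents 𝒟 φ y) (hy : y ≠ 0) :
    IsUnit (t.mat.map φ) := by
  have hyg := h.mem hD hφ ht
  obtain ⟨w, hw, hw', hy'⟩ := h
  refine hD.isUnit_of_mulVec (ht.mat.map hφ) fun γ v _ hv => ?_
  have h1 : ∀ i, ∑ j, φ (t.A i j) * v (Sum.inl j) + φ (t.x i ()) * v (Sum.inr ()) = 0 := fun i => by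
    have := congrFun hv (Sum.inl i)
    simpa [Matrix.mulVec, dotProduct, Fintype.sum_sum_type, mat] using this
  have h2 : ∑ j, φ (t.f () j) * v (Sum.inl j) + -φ (t.c () ()) * v (Sum.inr ()) = 0 := by
    have := congrFun hv (Sum.inr ())
    simpa [Matrix.mulVec, dotProduct, Fintype.sum_sum_type, mat] using this
  have h3 : (fun j => v (Sum.inl j) + w j * v (Sum.inr ())) = 0 := by
    refine eq_zero_of_isUnit_of_mulVec hA (funext fun i => ?_)
    have := h1 i
    rw [← hw' i, Finset.sum_mul, ← Finset.sum_add_distrib] at this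
    simpa [Matrix.mulVec, dotProduct, mul_add, mul_assoc] using this
  have h4 : ∀ j, v (Sum.inl j) = -(w j * v (Sum.inr ())) := fun j =>
    eq_neg_of_add_eq_zero_left (congrFun h3 j)
  have h5 : y * v (Sum.inr ()) = 0 := by
    rw [hy', add_mul, Finset.sum_mul, ← neg_eq_zero, ← h2, _root_.neg_add, neg_mul,
      ← Finset.sum_neg_distrib]
    exact congrArg₂ _ (Finset.sum_congr rfl fun j _ => by rw [h4, mul_neg, mul_assoc]) rfl
  obtain ⟨z, -, -, hz⟩ := hD.exists_inv hyg hy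
  have h6 : v (Sum.inr ()) = 0 := by
    rw [← one_mul (v (Sum.inr ())), ← hz, mul_assoc, h5, mul_zero]
  funext i
  rcases i with i | i
  · rw [h4, h6, mul_zero, neg_zero]; rfl
  · exact h6

end Represents

/-- The datum of an entry of the inverse of a matrix. -/
def invEntry {n : ℕ} (α β : Fin n → G) (A : Matrix (Fin n) (Fin n) R) (i j : Fin n) :
    SchurDatum G R where
  index := Fin n
  -- The degrees are translated by `(α j)⁻¹` so that the column `x` has degree `1`.
  rowDeg := fun k => α k * (α j)⁻¹
  colDeg := fun k => β k * (α j)⁻¹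
  A := A
  x := Matrix.of fun k _ => if k = j then 1 else 0
  f := Matrix.of fun _ k => if k = i then 1 else 0
  c := 0

theorem IsHomog.invEntry (h𝒜 : IsGrading 𝒜) {n : ℕ} {α β : Fin n → G}
    {A : Matrix (Fin n) (Fin n) R} (hA : Homog 𝒜 α β A) (i j : Fin n) :
    (invEntry α β A i j).IsHomog 𝒜 (β i * (α j)⁻¹) 1 := by
  refine ⟨hA.of_right_mul _, fun (k : Fin n) _ => ?_, fun _ (k : Fin n) => ?_, Homog.zero⟩
  · change (if k = j then 1 else 0) ∈ 𝒜 (α k * (α j)⁻¹ * 1⁻¹)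
    split_ifs with h
    · simpa [h] using h𝒜.one_mem
    · exact zero_mem _
  · change (if k = i then 1 else 0) ∈ 𝒜 (β i * (α j)⁻¹ * (β k * (α j)⁻¹)⁻¹)
    split_ifs with h
    · simpa [h] using h𝒜.one_mem
    · exact zero_mem _

theorem represents_invEntry (hD : HasHomogInverses 𝒟) (hφ : ∀ g, ∀ r ∈ 𝒜 g, φ r ∈ 𝒟 g) {n : ℕ}
    {α β : Fin n → G} {A : Matrix (Fin n) (Fin n) R} (hA : Homog 𝒜 α β A)
    {B : Matrix (Fin n) (Fin n) D} (h1 : A.map φ * B = 1) (h2 : B * A.map φ = 1) (i j : Fin n) :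
    (invEntry α β A i j).Represents 𝒟 φ (B i j) := by
  have hB := hD.homog_of_mul_eq_one (hA.map hφ) h2
  refine ⟨fun k => B k j, fun k => hB k j, fun (k : Fin n) => ?_, ?_⟩
  · have := congrFun (congrFun h1 k) j
    rw [Matrix.mul_apply, Matrix.one_apply] at this
    refine this.trans ?_
    change _ = φ (if k = j then 1 else 0)
    split_ifs <;> simp
  · change _ = ∑ k : Fin n, φ (if k = i then 1 else 0) * B k j + φ 0
    simp [apply_ite φ, ite_mul]

end SchurDatum

namespace GrEpicDivisionRing

open SchurDatum

variable {G : Type v} [Group G] {R : Type u} [Ring R] {𝒜 : G → AddSubgroup R}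
  {K L : GrEpicDivisionRing 𝒜}

theorem isUnit_map_of_inverts_imp (h : ∀ A ∈ homSqMatrices 𝒜, L.Inverts A → K.Inverts A)
    {ι : Type} [Fintype ι] [DecidableEq ι] {α β : ι → G} {A : Matrix ι ι R} (hA : Homog 𝒜 α β A)
    (hu : IsUnit (A.map L.hom)) : IsUnit (A.map K.hom) := by
  let e := (Fintype.equivFin ι).symm
  have := h ⟨_, A.submatrix e e⟩ ⟨α ∘ e, β ∘ e, hA.submatrix e e⟩
    ((isUnit_submatrix_iff e e).2 hu)
  exact (isUnit_submatrix_iff (A := A.map K.hom) e e).1 this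

variable (K L) in
/-- The pairs of elements of two graded epic division rings that are represented by the same
datum. -/
def pairs (g : G) : AddSubgroup (K.carrier × L.carrier) where
  carrier := {z | ∃ t : SchurDatum G R, t.IsHomog 𝒜 g 1 ∧ IsUnit (t.A.map L.hom) ∧
    t.Represents K.grading K.hom z.1 ∧ t.Represents L.grading L.hom z.2}
  zero_mem' := ⟨SchurDatum.const 0, IsHomog.const (zero_mem _),
    isUnit_matrix_iff.2 ⟨0, by ext i; exact i.elim, by ext i; exact i.elim⟩, by
      have := Represents.const (𝒟 := K.grading) (φ := K.hom) 0
      rwa [map_zero] at this, by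
      have := Represents.const (𝒟 := L.grading) (φ := L.hom) 0
      rwa [map_zero] at this⟩
  add_mem' := by
    rintro _ _ ⟨t, ht, htA, ht1, ht2⟩ ⟨u, hu, huA, hu1, hu2⟩
    refine ⟨t.add u, ht.add hu, ?_, ht1.add hu1, ht2.add hu2⟩
    have h1 := isUnit_fromBlocks_upper (B := 0) htA huA
    have e : (Matrix.fromBlocks t.A 0 0 u.A).map L.hom =
      Matrix.fromBlocks (t.A.map L.hom) 0 0 (u.A.map L.hom) := by
      simp [Matrix.fromBlocks_map]
    rw [← e] at h1
    exact h1
  neg_mem' := by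
    rintro _ ⟨t, ht, htA, ht1, ht2⟩
    exact ⟨t.neg, ht.neg, htA, ht1.neg, ht2.neg⟩

theorem hom_mem_pairs {g : G} {r : R} (hr : r ∈ 𝒜 g) : (K.hom r, L.hom r) ∈ pairs K L g :=
  ⟨SchurDatum.const r, IsHomog.const (by simpa using hr),
    isUnit_matrix_iff.2 ⟨0, by ext i; exact i.elim, by ext i; exact i.elim⟩,
    Represents.const r, Represents.const r⟩

theorem mul_mem_pairs (h𝒜 : IsGrading 𝒜) {g k : G} {x y : K.carrier × L.carrier}
    (hx : x ∈ pairs K L g) (hy : y ∈ pairs K L k) : x * y ∈ pairs K L (g * k) := by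
  obtain ⟨t, ht, htA, ht1, ht2⟩ := hx
  obtain ⟨u, hu, huA, hu1, hu2⟩ := hy
  have ht' : (t.shift k).IsHomog 𝒜 (g * k) k := by simpa using ht.shift k
  refine ⟨(t.shift k).mul u, ht'.mul h𝒜 hu, ?_,
    ht1.mul K.isGrDivisionRing.hasHomogInverses K.hom_mem hu hu1,
    ht2.mul L.isGrDivisionRing.hasHomogInverses L.hom_mem hu hu2⟩
  have h1 := isUnit_fromBlocks_upper (B := (-(t.x * u.f)).map L.hom) htA huA
  have e : (Matrix.fromBlocks t.A (-(t.x * u.f)) 0 u.A).map L.hom =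
    Matrix.fromBlocks (t.A.map L.hom) ((-(t.x * u.f)).map L.hom) 0 (u.A.map L.hom) := by
    simp [Matrix.fromBlocks_map]
  rw [← e] at h1
  exact h1

theorem snd_mem_of_mem_pairs {g : G} {z : K.carrier × L.carrier} (hz : z ∈ pairs K L g) :
    z.1 ∈ K.grading g ∧ z.2 ∈ L.grading g := by
  obtain ⟨t, ht, -, ht1, ht2⟩ := hz
  exact ⟨ht1.mem K.isGrDivisionRing.hasHomogInverses K.hom_mem ht,
    ht2.mem L.isGrDivisionRing.hasHomogInverses L.hom_mem ht⟩

/-- If the value in `L` were nonzero, the bordered matrix would be invertible over `L`, hence over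
`K`, and the value in `K` could not be zero. This makes the specialization well defined. -/
theorem snd_eq_zero_of_mem_pairs (h : ∀ A ∈ homSqMatrices 𝒜, L.Inverts A → K.Inverts A) {g : G}
    {z : K.carrier × L.carrier} (hz : z ∈ pairs K L g) (h0 : z.1 = 0) : z.2 = 0 := by
  have := K.isGrDivisionRing.nontrivial
  obtain ⟨t, ht, htA, ht1, ht2⟩ := hz
  by_contra hne
  rw [h0] at ht1
  exact ht1.not_isUnit_mat (isUnit_map_of_inverts_imp h ht.mat
    (ht2.isUnit_mat L.isGrDivisionRing.hasHomogInverses L.hom_mem ht htA hne))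

/-- A gr-specialization exists as soon as the matrices that become invertible over the target
become invertible over the source. -/
theorem nonempty_grSpecialization (h𝒜 : IsGrading 𝒜)
    (h : ∀ A ∈ homSqMatrices 𝒜, L.Inverts A → K.Inverts A) :
    Nonempty (GrSpecialization K L) := by
  have hK := K.isGrDivisionRing
  have hL := L.isGrDivisionRing
  -- The graph of the specialization: sums of pairs of values of a common datum. Vanishing of the
  -- first coordinate forces vanishing of the second, one component at a time.
  let T : Subring (K.carrier × L.carrier) := subringISup (pairs K L)
    (by
      have := hom_mem_pairs (K := K) (L := L) h𝒜.one_mem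
      rwa [map_one, map_one] at this)
    (mul_mem_pairs h𝒜)
  have hle : ∀ {g z}, z ∈ pairs K L g → z ∈ T := fun {g z} hz => le_iSup (pairs K L) g hz
  have hproj : ∀ {z}, z ∈ T → ∀ g,
      (hK.toIsGrading.proj g z.1, hL.toIsGrading.proj g z.2) ∈ pairs K L g := by
    intro z hz g
    refine AddSubgroup.iSup_induction (pairs K L) (C := fun z =>
      (hK.toIsGrading.proj g z.1, hL.toIsGrading.proj g z.2) ∈ pairs K L g) hz ?_ ?_ ?_
    · intro k z hz
      obtain ⟨h1, h2⟩ := snd_mem_of_mem_pairs hz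
      rw [hK.toIsGrading.proj_apply_of_mem h1, hL.toIsGrading.proj_apply_of_mem h2]
      split_ifs with hk
      · exact hk ▸ hz
      · exact zero_mem _
    · simp only [Prod.fst_zero, Prod.snd_zero, map_zero]
      exact zero_mem _
    · intro y z hy hz
      simp only [Prod.fst_add, Prod.snd_add, map_add]
      exact add_mem hy hz
  have hzero : ∀ {z}, z ∈ T → ∀ g, hK.toIsGrading.proj g z.1 = 0 →
      hL.toIsGrading.proj g z.2 = 0 := fun hz g h0 => snd_eq_zero_of_mem_pairs h (hproj hz g) h0
  have hhom : ∀ r, (K.hom r, L.hom r) ∈ T := by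
    intro r
    induction r using h𝒜.induction with
    | hom g r hr => exact hle (hom_mem_pairs hr)
    | add r s hr hs =>
      rw [map_add, map_add]
      exact T.add_mem hr hs
  -- The first projection from `T` reaches the whole core, since entries of inverses are values of
  -- `invEntry` in both rings; cutting down to the core makes it a bijection, whose inverse followed
  -- by the second projection is the specialization.
  let T' : Subring (K.carrier × L.carrier) := T ⊓ (core K L).comap (RingHom.fst _ _)
  let p : T' →+* core K L := ((RingHom.fst _ _).comp T'.subtype).codRestrict (core K L)
    fun z => z.2.2
  have hp : Function.Bijective p := by
    constructor
    · rw [injective_iff_map_eq_zero]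
      rintro ⟨⟨x, y⟩, hz⟩ h0
      obtain rfl : x = 0 := congrArg Subtype.val h0
      obtain rfl : y = 0 := hL.toIsGrading.eq_zero_of_proj fun g => hzero hz.1 g (map_zero _)
      rfl
    · rintro ⟨x, hx⟩
      have hcore : core K L ≤ T.map (RingHom.fst _ _) := by
        refine Subring.closure_le.2 ?_
        rintro x (⟨r, rfl⟩ | ⟨⟨n, A⟩, ⟨α, β, hA⟩, hAL, B, h1, h2, i, j, rfl⟩)
        · exact ⟨_, hhom r, rfl⟩
        · obtain ⟨B', h1', h2'⟩ := isUnit_matrix_iff.1 hAL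
          exact ⟨(B i j, B' i j), hle ⟨_, IsHomog.invEntry h𝒜 hA i j, hAL,
            represents_invEntry hK.hasHomogInverses K.hom_mem hA h1 h2 i j,
            represents_invEntry hL.hasHomogInverses L.hom_mem hA h1' h2' i j⟩, rfl⟩
      obtain ⟨z, hz, rfl⟩ := hcore hx
      exact ⟨⟨z, hz, hx⟩, rfl⟩
  let e : T' ≃+* core K L := RingEquiv.ofBijective p hp
  let f : core K L →+* L.carrier := ((RingHom.snd _ _).comp T'.subtype).comp e.symm.toRingHom
  have hf : ∀ z : T', f (p z) = z.1.2 := fun z =>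
    congrArg (fun z : T' => z.1.2) (e.symm_apply_apply z)
  refine ⟨⟨h, f, fun r => hf ⟨_, hhom r, hom_mem_core K L r⟩, fun g x hx => ?_⟩⟩
  obtain ⟨z, rfl⟩ := hp.2 x
  rw [hf]
  have e1 : z.1.2 = hL.toIsGrading.proj g z.1.2 := by
    refine hL.toIsGrading.ext_proj fun k => ?_
    by_cases hk : g = k
    · subst hk
      rw [hL.toIsGrading.proj_same (hL.toIsGrading.proj_mem g z.1.2)]
    · rw [hL.toIsGrading.proj_ne hk (hL.toIsGrading.proj_mem g z.1.2)]
      exact hzero z.2.1 k (hK.toIsGrading.proj_ne hk hx)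
  rw [e1]
  exact hL.toIsGrading.proj_mem g _

end GrEpicDivisionRing

/-! ### Malcev–Neumann series over an ordered group. -/

section OrderedGroup

variable {Γ : Type v} [Group Γ] [LinearOrder Γ] [MulLeftMono Γ] [MulRightMono Γ]

theorem isPWO_image2_mul {s t : Set Γ} (hs : s.IsPWO) (ht : t.IsPWO) :
    (Set.image2 (· * ·) s t).IsPWO := by
  rw [← Set.image_prod]
  exact (hs.prod ht).image_of_monotone fun x y h => mul_le_mul' h.1 h.2

/-- Infinitely many such `a` would contain an increasing sequence; the elements `a⁻¹ * c` then
strictly decrease, contradicting partial well-ordering of `t`. -/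
theorem finite_mulAntidiagonal {s t : Set Γ} (hs : s.IsPWO) (ht : t.IsPWO) (c : Γ) :
    {a | a ∈ s ∧ a⁻¹ * c ∈ t}.Finite := by
  by_contra hinf
  have hinf : {a | a ∈ s ∧ a⁻¹ * c ∈ t}.Infinite := hinf
  let f := hinf.natEmbedding
  obtain ⟨k, hk⟩ := hs.exists_monotone_subseq (f := fun n => (f n : Γ)) fun n => (f n).2.1
  obtain ⟨m, n, hmn, h⟩ := ht.exists_lt (f := fun n => (f (k n) : Γ)⁻¹ * c) fun n => (f (k n)).2.2
  have h1 : (f (k m) : Γ) ≤ f (k n) := hk hmn.le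
  have h2 : (f (k n) : Γ) ≤ f (k m) := inv_le_inv_iff.1 (le_of_mul_le_mul_right' h)
  have h3 := k.injective (f.injective (Subtype.ext (le_antisymm h1 h2)))
  exact hmn.ne h3

theorem list_prod_le_prod_of_sublistForall₂ {l l' : List Γ}
    (h : List.SublistForall₂ (· ≤ ·) l l') (hl : ∀ x ∈ l', 1 ≤ x) : l.prod ≤ l'.prod := by
  induction h with
  | nil => exact List.one_le_prod_of_one_le hl
  | cons hab _ ih =>
    rw [List.prod_cons, List.prod_cons]
    exact mul_le_mul' hab (ih fun x hx => hl x (List.mem_cons_of_mem _ hx))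
  | cons_right _ ih =>
    rw [List.prod_cons]
    exact le_mul_of_one_le_of_le (hl _ List.mem_cons_self)
      (ih fun x hx => hl x (List.mem_cons_of_mem _ hx))

/-- Higman's lemma: words over `s` are partially well-ordered by domination of subwords, and the
product is monotone for this order because all letters are at least `1`. -/
theorem isPWO_submonoid_closure {s : Set Γ} (hpos : ∀ x ∈ s, 1 ≤ x) (h : s.IsPWO) :
    (Submonoid.closure s : Set Γ).IsPWO := by
  rw [Submonoid.closure_eq_image_prod]
  exact (h.partiallyWellOrderedOn_sublistForall₂ (· ≤ ·)).image_of_monotone_on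
    fun l _ l' hl' h' => list_prod_le_prod_of_sublistForall₂ h' fun x hx => hpos x (hl' x hx)

end OrderedGroup

section Convolution

variable {Γ : Type v} [Group Γ] [LinearOrder Γ] [MulLeftMono Γ] [MulRightMono Γ]
  {D : Type u} [Ring D]

/-- The convolution product of functions on a group. -/
noncomputable def convolution (f g : Γ → D) (c : Γ) : D := ∑ᶠ a, f a * g (a⁻¹ * c)

theorem hasFiniteSupport_convolution {f g : Γ → D} (hf : (Function.support f).IsPWO)
    (hg : (Function.support g).IsPWO) (c : Γ) :
    Function.HasFiniteSupport fun a => f a * g (a⁻¹ * c) :=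
  (finite_mulAntidiagonal hf hg c).subset fun _ ha =>
    ⟨left_ne_zero_of_mul ha, right_ne_zero_of_mul ha⟩

theorem support_convolution_subset (f g : Γ → D) : Function.support (convolution f g) ⊆
    Set.image2 (· * ·) (Function.support f) (Function.support g) := by
  intro c hc
  by_contra h
  refine hc (finsum_eq_zero_of_forall_eq_zero fun a => ?_)
  by_contra ha
  exact h ⟨a, left_ne_zero_of_mul ha, a⁻¹ * c, right_ne_zero_of_mul ha, mul_inv_cancel_left a c⟩

theorem isPWO_support_convolution {f g : Γ → D} (hf : (Function.support f).IsPWO)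
    (hg : (Function.support g).IsPWO) : (Function.support (convolution f g)).IsPWO :=
  (isPWO_image2_mul hf hg).mono (support_convolution_subset f g)

/-- Both sides sum the same function of two variables, whose support is finite, so the order of
summation can be exchanged. The supports are needed because `∑ᶠ` returns `0` on infinite supports.
-/
theorem convolution_assoc {f g h : Γ → D} (hf : (Function.support f).IsPWO)
    (hg : (Function.support g).IsPWO) (hh : (Function.support h).IsPWO) :
    convolution (convolution f g) h = convolution f (convolution g h) := by
  funext d
  let F : Γ × Γ → D := fun p => f p.1 * g (p.1⁻¹ * p.2) * h (p.2⁻¹ * d)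
  have hF : Function.HasFiniteSupport F := by
    have h1 := finite_mulAntidiagonal (isPWO_image2_mul hf hg) hh d
    refine (h1.biUnion fun x _ => (finite_mulAntidiagonal hf hg x).image fun a => (a, x)).subset ?_
    rintro ⟨a, x⟩ hax
    have h2 := left_ne_zero_of_mul hax
    have h3 : a ∈ {a | a ∈ Function.support f ∧ a⁻¹ * x ∈ Function.support g} :=
      ⟨left_ne_zero_of_mul h2, right_ne_zero_of_mul h2⟩
    refine Set.mem_biUnion (x := x) ⟨?_, right_ne_zero_of_mul hax⟩ ⟨a, h3, rfl⟩
    exact ⟨a, h3.1, a⁻¹ * x, h3.2, mul_inv_cancel_left a x⟩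
  have hF' : Function.HasFiniteSupport fun p : Γ × Γ => F (p.2, p.1) :=
    (hF.preimage Prod.swap_injective.injOn : (Prod.swap ⁻¹' Function.support F).Finite)
  calc ∑ᶠ x, convolution f g x * h (x⁻¹ * d)
      = ∑ᶠ x, ∑ᶠ a, F (a, x) := finsum_congr fun x =>
        finsum_mul' _ _ (hasFiniteSupport_convolution hf hg x)
    _ = ∑ᶠ p : Γ × Γ, F (p.2, p.1) := (finsum_curry _ hF').symm
    _ = ∑ᶠ p : Γ × Γ, F p := finsum_comp_equiv (Equiv.prodComm Γ Γ)
    _ = ∑ᶠ a, ∑ᶠ x, F (a, x) := finsum_curry _ hF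
    _ = ∑ᶠ a, f a * convolution g h (a⁻¹ * d) := finsum_congr fun a => by
        rw [convolution, mul_finsum' _ _ (hasFiniteSupport_convolution hg hh _),
          ← finsum_comp_equiv (Equiv.mulLeft a)]
        refine finsum_congr fun b => ?_
        simp [F, mul_assoc]

theorem convolution_add_left {f f' g : Γ → D} (hf : (Function.support f).IsPWO)
    (hf' : (Function.support f').IsPWO) (hg : (Function.support g).IsPWO) :
    convolution (f + f') g = convolution f g + convolution f' g := by
  funext c
  refine Eq.trans ?_ (finsum_add_distrib (hasFiniteSupport_convolution hf hg c)
    (hasFiniteSupport_convolution hf' hg c))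
  exact finsum_congr fun a => add_mul _ _ _

theorem convolution_add_right {f g g' : Γ → D} (hf : (Function.support f).IsPWO)
    (hg : (Function.support g).IsPWO) (hg' : (Function.support g').IsPWO) :
    convolution f (g + g') = convolution f g + convolution f g' := by
  funext c
  refine Eq.trans ?_ (finsum_add_distrib (hasFiniteSupport_convolution hf hg c)
    (hasFiniteSupport_convolution hf hg' c))
  exact finsum_congr fun a => mul_add _ _ _

theorem convolution_single_left (a : Γ) (r : D) (g : Γ → D) (c : Γ) :
    convolution (Pi.single a r) g c = r * g (a⁻¹ * c) := by
  rw [convolution, finsum_eq_single _ a fun x hx => by rw [Pi.single_eq_of_ne hx, zero_mul],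
    Pi.single_eq_same]

theorem convolution_single_right (a : Γ) (r : D) (f : Γ → D) (c : Γ) :
    convolution f (Pi.single a r) c = f (c * a⁻¹) * r := by
  rw [convolution, finsum_eq_single _ (c * a⁻¹) fun x hx => by
    rw [Pi.single_eq_of_ne, mul_zero]
    rintro h
    exact hx (by rw [← h]; group)]
  simp

theorem isPWO_support_single (a : Γ) (r : D) : (Function.support (Pi.single a r)).IsPWO :=
  (Set.isPWO_singleton a).mono Pi.support_single_subset

/-- A series of the form `1 - ε`, with `ε` supported on elements greater than one, has a right
inverse. -/
theorem exists_convolution_eq_one {𝒟 : Γ → AddSubgroup D} (hD : IsGrading 𝒟) {ε : Γ → D}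
    (hε : ∀ g, ε g ∈ 𝒟 g) (hpwo : (Function.support ε).IsPWO) (hpos : ∀ g, ε g ≠ 0 → 1 < g) :
    ∃ y : Γ → D, (∀ g, y g ∈ 𝒟 g) ∧ (Function.support y).IsPWO ∧
      y = Pi.single 1 1 + convolution ε y := by
  classical
  let S := Submonoid.closure (Function.support ε)
  have hS : (S : Set Γ).IsPWO := isPWO_submonoid_closure (fun x hx => (hpos x hx).le) hpwo
  have hwf : WellFounded fun x y : S => x < y := hS.isWF
  -- Instead of summing the powers of `ε`, the equation `y = 1 + ε y` is solved by recursion on the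
  -- well-ordered monoid `S`: the coefficient at `c` uses only those at `e⁻¹ * c < c`, as `e > 1`.
  let z : S → D := hwf.fix fun c ih => (if c = 1 then 1 else 0) +
    ∑ᶠ e : Γ, if h : ε e ≠ 0 ∧ e⁻¹ * (c : Γ) ∈ S then
      ε e * ih ⟨e⁻¹ * c, h.2⟩ (show e⁻¹ * (c : Γ) < c from
        inv_mul_lt_iff_lt_mul.2 (lt_mul_of_one_lt_left' _ (hpos e h.1))) else 0
  let y : Γ → D := fun c => if h : c ∈ S then z ⟨c, h⟩ else 0
  have hy : ∀ c ∉ S, y c = 0 := fun c hc => dif_neg hc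
  have hmul : ∀ {e c}, ε e ≠ 0 → e⁻¹ * c ∈ S → c ∈ S := fun {e c} he hc => by
    have := S.mul_mem (Submonoid.subset_closure he) hc
    rwa [mul_inv_cancel_left] at this
  have hrec : ∀ c, y c = (Pi.single 1 1 : Γ → D) c + convolution ε y c := by
    intro c
    by_cases hc : c ∈ S
    · have h1 : y c = z ⟨c, hc⟩ := dif_pos hc
      rw [h1]
      refine (hwf.fix_eq _ _).trans ?_
      refine congrArg₂ _ ?_ (finsum_congr fun e => ?_)
      · rw [Pi.single_apply]
        exact if_congr Subtype.ext_iff rfl rfl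
      · split_ifs with h
        · have h2 : y (e⁻¹ * c) = z ⟨e⁻¹ * c, h.2⟩ := dif_pos h.2
          rw [h2]
        · rw [not_and_or, not_not] at h
          rcases h with h | h
          · rw [h, zero_mul]
          · rw [hy _ h, mul_zero]
    · rw [hy c hc, Pi.single_eq_of_ne (by rintro rfl; exact hc S.one_mem), zero_add]
      refine (finsum_eq_zero_of_forall_eq_zero fun e => ?_).symm
      by_cases he : ε e = 0
      · rw [he, zero_mul]
      · rw [hy _ fun h => hc (hmul he h), mul_zero]
  have hmem : ∀ c : S, y c ∈ 𝒟 c := by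
    intro c
    induction c using hwf.induction with
    | _ c ih =>
      rw [hrec]
      refine add_mem ?_ (finsum_induction (· ∈ 𝒟 (c : Γ)) (zero_mem _)
        (fun _ _ => add_mem) fun e => ?_)
      · rw [Pi.single_apply]
        split_ifs with h
        · rw [h]; exact hD.one_mem
        · exact zero_mem _
      · by_cases h : ε e ≠ 0 ∧ e⁻¹ * (c : Γ) ∈ S
        · have h1 := ih ⟨e⁻¹ * c, h.2⟩ (show e⁻¹ * (c : Γ) < c from
            inv_mul_lt_iff_lt_mul.2 (lt_mul_of_one_lt_left' _ (hpos e h.1)))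
          simpa using hD.mul_mem (hε e) h1
        · rw [not_and_or, not_not] at h
          rcases h with h | h
          · rw [h, zero_mul]; exact zero_mem _
          · rw [hy _ h, mul_zero]; exact zero_mem _
  refine ⟨y, fun g => ?_, hS.mono fun c hc => ?_, funext hrec⟩
  · by_cases hg : g ∈ S
    · exact hmem ⟨g, hg⟩
    · rw [hy g hg]; exact zero_mem _
  · by_contra h
    exact hc (hy c h)

end Convolution

section NeumannSeries

variable {Γ : Type v} [Group Γ] [LinearOrder Γ] [MulLeftMono Γ] [MulRightMono Γ]
  {D : Type u} [Ring D] {𝒟 : Γ → AddSubgroup D}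

/-- The Malcev–Neumann series: formal sums of homogeneous elements with well-ordered support. -/
def neumannSeries (_ : IsGrading 𝒟) : AddSubgroup (Γ → D) where
  carrier := {f | (∀ g, f g ∈ 𝒟 g) ∧ (Function.support f).IsPWO}
  zero_mem' := ⟨fun _ => zero_mem _, by simp⟩
  add_mem' hf hg := ⟨fun c => add_mem (hf.1 c) (hg.1 c),
    (hf.2.union hg.2).mono (Function.support_add _ _)⟩
  neg_mem' hf := ⟨fun c => neg_mem (hf.1 c), by rw [Function.support_neg]; exact hf.2⟩

variable {hD : IsGrading 𝒟}

theorem single_mem_neumannSeries {g : Γ} {r : D} (hr : r ∈ 𝒟 g) :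
    Pi.single g r ∈ neumannSeries hD := by
  refine ⟨fun c => ?_, isPWO_support_single g r⟩
  rw [Pi.single_apply]
  split_ifs with h
  · exact h ▸ hr
  · exact zero_mem _

theorem convolution_mem_neumannSeries {f g : Γ → D} (hf : f ∈ neumannSeries hD)
    (hg : g ∈ neumannSeries hD) : convolution f g ∈ neumannSeries hD := by
  refine ⟨fun c => finsum_induction (· ∈ 𝒟 c) (zero_mem _) (fun _ _ => add_mem) fun a => ?_,
    isPWO_support_convolution hf.2 hg.2⟩
  simpa using hD.mul_mem (hf.1 a) (hg.1 (a⁻¹ * c))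

noncomputable instance : Mul (neumannSeries hD) :=
  ⟨fun f g => ⟨convolution f g, convolution_mem_neumannSeries f.2 g.2⟩⟩

noncomputable instance : One (neumannSeries hD) :=
  ⟨⟨Pi.single 1 1, single_mem_neumannSeries hD.one_mem⟩⟩

noncomputable instance : Ring (neumannSeries hD) :=
  { (inferInstance : AddCommGroup (neumannSeries hD)) with
    mul_assoc := fun f g h => Subtype.ext (convolution_assoc f.2.2 g.2.2 h.2.2)
    one_mul := fun f => Subtype.ext (funext fun c =>
      (convolution_single_left 1 1 f.1 c).trans (by simp))
    mul_one := fun f => Subtype.ext (funext fun c =>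
      (convolution_single_right 1 1 f.1 c).trans (by simp))
    left_distrib := fun f g h => Subtype.ext (convolution_add_right f.2.2 g.2.2 h.2.2)
    right_distrib := fun f g h => Subtype.ext (convolution_add_left f.2.2 g.2.2 h.2.2)
    zero_mul := fun f => Subtype.ext (funext fun c =>
      finsum_eq_zero_of_forall_eq_zero fun a => zero_mul _)
    mul_zero := fun f => Subtype.ext (funext fun c =>
      finsum_eq_zero_of_forall_eq_zero fun a => mul_zero _)
    zsmul := fun n f => n • f
    neg_add_cancel := neg_add_cancel }

/-- The least term of `f` is homogeneous, hence invertible. Multiplying on the right by its inverse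
turns `f` into `1 - ε` with `ε` supported above `1`, and such a series has a right inverse. -/
theorem neumannSeries.exists_mul_eq_one (hdiv : IsGrDivisionRing 𝒟)
    (f : neumannSeries hdiv.toIsGrading) (hf : f ≠ 0) : ∃ g, f * g = 1 := by
  have hne : (Function.support f.1).Nonempty := by
    rw [Function.support_nonempty_iff]
    exact fun h => hf (Subtype.ext h)
  let g := f.2.2.isWF.min hne
  have hg : f.1 g ≠ 0 := f.2.2.isWF.min_mem hne
  have hmin : ∀ c, f.1 c ≠ 0 → g ≤ c := fun c hc => f.2.2.isWF.min_le hne hc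
  obtain ⟨v, hv, h1, h2⟩ := hdiv.toIsGrading.exists_inv (f.2.1 g)
    (hdiv.isUnit_of_mem g _ (f.2.1 g) hg)
  let s : neumannSeries hdiv.toIsGrading := ⟨Pi.single g⁻¹ v, single_mem_neumannSeries hv⟩
  let ε := 1 - f * s
  have hε : ∀ c, ε.1 c = (Pi.single 1 1 : Γ → D) c - f.1 (c * g) * v := fun c => by
    change (Pi.single 1 1 : Γ → D) c - convolution f.1 (Pi.single g⁻¹ v) c = _
    rw [convolution_single_right, inv_inv]
  obtain ⟨y, hy, hy', hrec⟩ := exists_convolution_eq_one hdiv.toIsGrading ε.2.1 ε.2.2 fun c hc => by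
    rcases eq_or_ne c 1 with rfl | hc1
    · exact absurd (by rw [hε, Pi.single_eq_same, one_mul, h1, sub_self]) hc
    · rw [hε, Pi.single_eq_of_ne hc1, zero_sub, neg_ne_zero] at hc
      have := hmin _ (left_ne_zero_of_mul hc)
      exact lt_of_le_of_ne (by simpa using this) hc1.symm
  let y' : neumannSeries hdiv.toIsGrading := ⟨y, hy, hy'⟩
  have e : y' = 1 + ε * y' := Subtype.ext hrec
  refine ⟨s * y', ?_⟩
  rw [sub_mul, one_mul, mul_assoc] at e
  rw [← sub_eq_of_eq_add e, sub_sub_self]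

/-- Every graded division ring over an ordered group embeds in a division ring. -/
theorem exists_divisionRing_hom (hdiv : IsGrDivisionRing 𝒟) :
    ∃ (E : Type (max u v)) (_ : DivisionRing E), Nonempty (D →+* E) := by
  classical
  have hD := hdiv.toIsGrading
  let E := neumannSeries hD
  let f : ∀ g, 𝒟 g →+ E := fun g =>
    { toFun := fun r => ⟨Pi.single g (r : D), single_mem_neumannSeries r.2⟩
      map_zero' := Subtype.ext (Pi.single_zero g)
      map_add' := fun r s => Subtype.ext (Pi.single_add (f := fun _ : Γ => D) g (r : D) (s : D)) }
  have hmul : ∀ g k (x : 𝒟 g) (y : 𝒟 k),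
      f (g * k) ⟨x * y, hD.mul_mem x.2 y.2⟩ = f g x * f k y := fun g k x y =>
    Subtype.ext (funext fun c => by
      refine Eq.trans ?_ (convolution_single_left g (x : D) _ c).symm
      change (Pi.single (g * k) (x * y : D) : Γ → D) c = x * (Pi.single k (y : D) : Γ → D) (g⁻¹ * c)
      simp only [Pi.single_apply, inv_mul_eq_iff_eq_mul, mul_ite, mul_zero])
  let φ : D →+* E := hD.liftRing f rfl hmul
  have := hdiv.nontrivial
  have hE : Nontrivial E := by
    refine ⟨⟨1, 0, fun h => one_ne_zero (α := D) ?_⟩⟩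
    have := congrFun (congrArg Subtype.val h) 1
    rwa [show (1 : E).1 = Pi.single 1 1 from rfl, Pi.single_eq_same] at this
  have hunit : ∀ x : E, IsUnit x ∨ x = 0 := by
    intro x
    by_cases hx : x = 0
    · exact Or.inr hx
    · obtain ⟨y, hxy⟩ := neumannSeries.exists_mul_eq_one hdiv x hx
      have hy : y ≠ 0 := by
        rintro rfl
        rw [mul_zero] at hxy
        exact zero_ne_one hxy
      obtain ⟨z, hyz⟩ := neumannSeries.exists_mul_eq_one hdiv y hy
      have : x = z := by rw [← mul_one x, ← hyz, ← mul_assoc, hxy, one_mul]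
      exact Or.inl ⟨⟨x, y, hxy, this ▸ hyz⟩, rfl⟩
  exact ⟨E, DivisionRing.ofIsUnitOrEqZero hunit, ⟨φ⟩⟩

end NeumannSeries

/-! ### Deduction of the statements on spectra and universal objects. -/

section Main

variable {G : Type v} [Group G] {R : Type u} [Ring R] {𝒜 : G → AddSubgroup R}
  {G' : Type*} [Group G'] {ℬ : G' → AddSubgroup R} {π : G →* G'}

open GrEpicDivisionRing

theorem le_trivialGrading (g : G) : 𝒜 g ≤ trivialGrading R ((1 : G →* Unit) g) := le_top

theorem nonempty_grSpecialization_of_corresponding (h𝒜 : IsGrading 𝒜) (h : ∀ g, 𝒜 g ≤ ℬ (π g))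
    {K' L' : GrEpicDivisionRing ℬ} {K L : GrEpicDivisionRing 𝒜}
    (hK : K.singularKernel = restrictTo 𝒜 K'.singularKernel)
    (hL : L.singularKernel = restrictTo 𝒜 L'.singularKernel)
    (hs : Nonempty (GrSpecialization K' L')) : Nonempty (GrSpecialization K L) := by
  obtain ⟨s⟩ := hs
  rw [singularKernel_eq_restrictTo_iff h] at hK hL
  exact nonempty_grSpecialization h𝒜 fun A hA hLA =>
    (hK A hA).2 (s.inverts A (homSqMatrices_mono h hA) ((hL A hA).1 hLA))

/-- Surjectivity lifts the singular kernel of any `L` to a gr-prime matrix ideal for `ℬ`, realized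
by some `L'`; the specialization from `U'` to `L'` then descends to one from `U` to `L`. -/
theorem exists_isUniversal (h𝒜 : IsGrading 𝒜) (hℬ : IsGrading ℬ) (h : ∀ g, 𝒜 g ≤ ℬ (π g))
    (hsurj : Set.SurjOn (restrictTo 𝒜) (grSpec ℬ) (grSpec 𝒜)) {U' : GrEpicDivisionRing ℬ}
    (hU' : U'.IsUniversal) :
    ∃ U : GrEpicDivisionRing 𝒜, U.IsUniversal ∧ (U'.IsOfFractions → U.IsOfFractions) := by
  obtain ⟨U, hU, hU2⟩ := exists_corresponding h𝒜 h U'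
  refine ⟨U, fun L => ?_, hU2⟩
  obtain ⟨P', hP', hPL⟩ := hsurj L.isGrPrimeMatrixIdeal_singularKernel
  obtain ⟨L', rfl⟩ := exists_singularKernel_eq hℬ hP'
  exact nonempty_grSpecialization_of_corresponding h𝒜 h
    ((singularKernel_eq_restrictTo_iff h).2 hU) hPL.symm (hU' L')

theorem hasHomogInverses_trivialGrading (E : Type w) [DivisionRing E] :
    HasHomogInverses (trivialGrading E) :=
  ⟨inferInstance, trivial, fun _ _ => trivial,
    fun {_ x} _ hx => ⟨x⁻¹, trivial, mul_inv_cancel₀ hx, inv_mul_cancel₀ hx⟩⟩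

/-- The preimage of the singular kernel of `D` is found in the ungraded spectrum, as the singular
kernel of `R → D → E`, and then restricted to `ℬ`. On `𝒜`-homogeneous matrices invertibility over
`E` and over `D` agree. -/
theorem surjOn_restrictTo (h𝒜 : IsGrading 𝒜) (h : ∀ g, 𝒜 g ≤ ℬ (π g))
    (hE : ∀ D : GrEpicDivisionRing 𝒜, ∃ (E : Type w) (_ : DivisionRing E),
      Nonempty (D.carrier →+* E)) :
    Set.SurjOn (restrictTo 𝒜) (grSpec ℬ) (grSpec 𝒜) := by
  intro Q hQ
  obtain ⟨D, rfl⟩ := exists_singularKernel_eq h𝒜 hQ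
  obtain ⟨E, _, ⟨η⟩⟩ := hE D
  have hP := isGrPrimeMatrixIdeal_of_hom (𝒜 := trivialGrading R)
    (hasHomogInverses_trivialGrading E) (η.comp D.hom) fun _ _ _ => trivial
  refine ⟨_, restrictTo_mem_grSpec (𝒜 := ℬ) le_trivialGrading hP, ?_⟩
  have hinv : ∀ A ∈ homSqMatrices 𝒜, IsUnit (A.2.map (η.comp D.hom)) ↔ D.Inverts A := by
    rintro ⟨n, A⟩ ⟨α, β, hA⟩
    have hA' : Homog 𝒜 α β A := hA
    exact D.isGrDivisionRing.hasHomogInverses.isUnit_map_iff η (hA'.map D.hom_mem)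
  ext A
  constructor
  · rintro ⟨⟨⟨-, hA⟩, -⟩, hA'⟩
    exact ⟨hA', fun hu => hA ((hinv A hA').2 hu)⟩
  · rintro ⟨hA', hA⟩
    have hB := homSqMatrices_mono h hA'
    exact ⟨⟨⟨homSqMatrices_mono (π := (1 : G' →* Unit)) le_trivialGrading hB,
      fun hu => hA ((hinv A hA').1 hu)⟩, hB⟩, hA'⟩

end Main
theorem mainTheorem11 {Γ : Type v} [Group Γ] {R : Type u} [Ring R]
    (𝒜 : Γ → AddSubgroup R) (h𝒜 : IsGrading 𝒜)
    (Ω Ω' : Subgroup Γ) [Ω.Normal] [Ω'.Normal] (hΩ : Ω ≤ Ω') :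
    -- (0) restriction maps between the spectra
    (Set.MapsTo (restrictTo (coarsen 𝒜 Ω)) (grSpec (coarsen 𝒜 Ω')) (grSpec (coarsen 𝒜 Ω)) ∧
      Set.MapsTo (restrictTo (coarsen 𝒜 Ω)) (grSpec (trivialGrading R))
        (grSpec (coarsen 𝒜 Ω)) ∧
      Set.MapsTo (restrictTo 𝒜) (grSpec (coarsen 𝒜 Ω)) (grSpec 𝒜)) ∧
    -- (1) non-existence of graded epic division rings (of fractions)
    ((IsEmpty (GrEpicDivisionRing (coarsen 𝒜 Ω)) →
        IsEmpty (GrEpicDivisionRing (coarsen 𝒜 Ω'))) ∧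
      ((¬ ∃ K : GrEpicDivisionRing (coarsen 𝒜 Ω), K.IsOfFractions) →
        ¬ ∃ K' : GrEpicDivisionRing (coarsen 𝒜 Ω'), K'.IsOfFractions) ∧
      (IsEmpty (GrEpicDivisionRing (coarsen 𝒜 Ω)) → IsEmpty (EpicDivisionRing R)) ∧
      ((¬ ∃ K : GrEpicDivisionRing (coarsen 𝒜 Ω), K.IsOfFractions) →
        ¬ ∃ E : EpicDivisionRing R, E.IsOfFractions)) ∧
    -- (2) every graded epic division ring has a corresponding one, and this preserves
    -- specializations
    ((∀ K' : GrEpicDivisionRing (coarsen 𝒜 Ω'), ∃ K : GrEpicDivisionRing (coarsen 𝒜 Ω),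
        K.singularKernel = restrictTo (coarsen 𝒜 Ω) K'.singularKernel) ∧
      (∀ (K' L' : GrEpicDivisionRing (coarsen 𝒜 Ω')) (K L : GrEpicDivisionRing (coarsen 𝒜 Ω)),
        K.singularKernel = restrictTo (coarsen 𝒜 Ω) K'.singularKernel →
        L.singularKernel = restrictTo (coarsen 𝒜 Ω) L'.singularKernel →
        Nonempty (GrEpicDivisionRing.GrSpecialization K' L') →
        Nonempty (GrEpicDivisionRing.GrSpecialization K L))) ∧
    -- (3) universal objects
    ((Set.SurjOn (restrictTo (coarsen 𝒜 Ω)) (grSpec (coarsen 𝒜 Ω')) (grSpec (coarsen 𝒜 Ω)) →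
        ((∃ U' : GrEpicDivisionRing (coarsen 𝒜 Ω'), U'.IsUniversal) →
          ∃ U : GrEpicDivisionRing (coarsen 𝒜 Ω), U.IsUniversal) ∧
        ((∃ U' : GrEpicDivisionRing (coarsen 𝒜 Ω'), U'.IsUniversal ∧ U'.IsOfFractions) →
          ∃ U : GrEpicDivisionRing (coarsen 𝒜 Ω), U.IsUniversal ∧ U.IsOfFractions)) ∧
      (Set.SurjOn (restrictTo (coarsen 𝒜 Ω)) (grSpec (trivialGrading R))
          (grSpec (coarsen 𝒜 Ω)) →
        ((∃ U' : EpicDivisionRing R, U'.IsUniversal) →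
          ∃ U : GrEpicDivisionRing (coarsen 𝒜 Ω), U.IsUniversal) ∧
        ((∃ U' : EpicDivisionRing R, U'.IsUniversal ∧ U'.IsOfFractions) →
          ∃ U : GrEpicDivisionRing (coarsen 𝒜 Ω), U.IsUniversal ∧ U.IsOfFractions))) ∧
    -- (4) surjectivity onto the spectrum for the finest grading
    ((∀ D : GrEpicDivisionRing 𝒜, ∃ (E : Type w) (_ : DivisionRing E),
        Nonempty (D.carrier →+* E)) →
      Set.SurjOn (restrictTo 𝒜) (grSpec (coarsen 𝒜 Ω)) (grSpec 𝒜)) ∧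
    -- the case of ordered groups
    (IsOrderableGroup Γ →
      (∀ (D : Type u) [Ring D] (𝒟 : Γ → AddSubgroup D), IsGrDivisionRing 𝒟 →
        ∃ (E : Type (max u v)) (_ : DivisionRing E), Nonempty (D →+* E)) ∧
      Set.SurjOn (restrictTo 𝒜) (grSpec (coarsen 𝒜 Ω)) (grSpec 𝒜)) := by

  have hΩg := h𝒜.coarsen Ω
  have h01 : ∀ a : Γ ⧸ Ω, coarsen 𝒜 Ω a ≤
      coarsen 𝒜 Ω' (QuotientGroup.map Ω Ω' (MonoidHom.id Γ) hΩ a) := coarsen_le_coarsen 𝒜 hΩ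
  have h02 : ∀ a : Γ ⧸ Ω, coarsen 𝒜 Ω a ≤ trivialGrading R ((1 : Γ ⧸ Ω →* Unit) a) :=
    le_trivialGrading
  have h00 : ∀ g : Γ, 𝒜 g ≤ coarsen 𝒜 Ω (QuotientGroup.mk' Ω g) := le_coarsen 𝒜 Ω
  refine ⟨⟨fun P hP => restrictTo_mem_grSpec h01 hP, fun P hP => restrictTo_mem_grSpec h02 hP,
    fun P hP => restrictTo_mem_grSpec h00 hP⟩, ⟨?_, ?_, ?_, ?_⟩, ⟨?_, ?_⟩, ⟨?_, ?_⟩, ?_, ?_⟩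
  · exact fun h => ⟨fun K' => h.elim (exists_corresponding hΩg h01 K').choose⟩
  · rintro h ⟨K', hK'⟩
    obtain ⟨K, -, hK⟩ := exists_corresponding hΩg h01 K'
    exact h ⟨K, hK hK'⟩
  · exact fun h => ⟨fun K' => h.elim (exists_corresponding hΩg h02 K').choose⟩
  · rintro h ⟨K', hK'⟩
    obtain ⟨K, -, hK⟩ := exists_corresponding hΩg h02 K'
    exact h ⟨K, hK hK'⟩
  · intro K'
    obtain ⟨K, hK, -⟩ := exists_corresponding hΩg h01 K'
    exact ⟨K, (singularKernel_eq_restrictTo_iff h01).2 hK⟩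
  · exact fun K' L' K L hK hL hs => nonempty_grSpecialization_of_corresponding hΩg h01 hK hL hs
  · intro hsurj
    have key := fun {U'} => exists_isUniversal hΩg (h𝒜.coarsen Ω') h01 hsurj (U' := U')
    refine ⟨?_, ?_⟩
    · rintro ⟨U', hU'⟩
      obtain ⟨U, hU, -⟩ := key hU'
      exact ⟨U, hU⟩
    · rintro ⟨U', hU', hf⟩
      obtain ⟨U, hU, hf'⟩ := key hU'
      exact ⟨U, hU, hf' hf⟩
  · intro hsurj
    have key := fun {U'} => exists_isUniversal hΩg (isGrading_trivialGrading R) h02 hsurj (U' := U')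
    refine ⟨?_, ?_⟩
    · rintro ⟨U', hU'⟩
      obtain ⟨U, hU, -⟩ := key hU'
      exact ⟨U, hU⟩
    · rintro ⟨U', hU', hf⟩
      obtain ⟨U, hU, hf'⟩ := key hU'
      exact ⟨U, hU, hf' hf⟩
  · exact surjOn_restrictTo h𝒜 h00
  · rintro ⟨_, _, _⟩
    exact ⟨fun D _ 𝒟 h𝒟 => exists_divisionRing_hom h𝒟,
      surjOn_restrictTo h𝒜 h00 fun D => exists_divisionRing_hom D.isGrDivisionRing⟩
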